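/- Let $0<L<\pi$ and $x_c=-2\log\tan\frac L4>0$. For $0\le x\le x_c$ there is exactly one $T=T(x)\in[0,\pi-L]$ with $$\frac1\pi\int_{[-L,L]\cup[\pi-T,\pi+T]}\log\left|\frac{1+e^{i\theta}}{1-e^{i\theta}}\right|\sqrt{\frac{\cos\theta+\cos T}{\cos\theta-\cos L}}\,d\theta=x .$$ With this $T$, put $$\Omega_{x,L}=\frac1{2\pi}\int_{\pi-T}^{\pi+T}\sqrt{\frac{\cos\theta+\cos T}{\cos\theta-\cos L}}\,d\theta,\qquad \ell_{x,L}=-\int_0^1\frac1u\left(1-\sqrt{\frac{u^2+2u\cos T+1}{u^2-2u\cos L+1}}\right)du$$ ($\ell_{x,L}$ is called the Euler–Lagrange constant), and let $\ell_{\infty,L}$ be the value of the last expression at $T=0$. Proposition. For $0<x<x_c$ the functions $\Omega_{x,L}$ and $\ell_{x,L}$ are differentiable in $x$, and $$\Omega_{x,L}=\frac{\partial\ell_{x,L}}{\partial x}+x\,\frac{\partial\Omega_{x,L}}{\partial x}=-\frac{\partial}{\partial x}\left[-\frac{\ell_{\infty,L}}2\left(\frac x{x_c}\right)^2-\int_{x/x_c}^1\zeta\,\ell_{x/\zeta,L}\,d\zeta\right].$$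 Corollary. $$-\int_0^{x_c}\Omega_{x,L}\,dx=-\frac{\ell_{\infty,L}}2=\log\sin\frac L2 .$$ -/

import Mathlib

open Real Set MeasureTheory

noncomputable section

namespace ThinnedCUE

/-- The critical value `x_c = -2 log tan (L/4)`. -/
def xCrit (L : ℝ) : ℝ := -2 * Real.log (Real.tan (L / 4))

/-- `√((cos θ + cos T) / (cos θ - cos L))`, which is `2π` times the density of the equilibrium
measure on its support, the arcs `[-L, L]` and `[π - T, π + T]`. -/
def edgeRatio (L T θ : ℝ) : ℝ :=
  Real.sqrt ((Real.cos θ + Real.cos T) / (Real.cos θ - Real.cos L))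

/-- The left-hand side of the equation which determines `T` as a function of `x`:
`(1/π) ∫ log |(1 + e^{iθ}) / (1 - e^{iθ})| √((cos θ + cos T) / (cos θ - cos L)) dθ`
over `[-L, L] ∪ [π - T, π + T]`. -/
def endpointIntegral (L T : ℝ) : ℝ :=
  (1 / π) * ∫ θ in Icc (-L) L ∪ Icc (π - T) (π + T),
    Real.log ‖(1 + Complex.exp (Complex.I * θ)) / (1 - Complex.exp (Complex.I * θ))‖ *
      edgeRatio L T θ

/-- `T` lies in `[0, π - L]` and solves the endpoint equation with parameter `x`. -/
def IsEndpoint (L x T : ℝ) : Prop :=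
  T ∈ Icc 0 (π - L) ∧ endpointIntegral L T = x

open Classical in
/-- The solution `T ∈ [0, π - L]` of the endpoint equation with parameter `x`. For `x > x_c` there
is none, and then `T = 0` (the support of the equilibrium measure is the single arc `[-L, L]`). -/
def endpointT (L x : ℝ) : ℝ :=
  if h : ∃ T, IsEndpoint L x T then Classical.choose h else 0

/-- `(1/2π) ∫_{π-T}^{π+T} √((cos θ + cos T) / (cos θ - cos L)) dθ`. -/
def arcMass (L T : ℝ) : ℝ :=
  (1 / (2 * π)) * ∫ θ in (π - T)..(π + T), edgeRatio L T θ

/-- `-∫_0^1 (1/u) (1 - √((u² + 2u cos T + 1) / (u² - 2u cos L + 1))) du`. -/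
def elConst (L T : ℝ) : ℝ :=
  -∫ u in (0 : ℝ)..1, (1 / u) *
    (1 - Real.sqrt ((u ^ 2 + 2 * u * Real.cos T + 1) / (u ^ 2 - 2 * u * Real.cos L + 1)))

/-- `Ω_{x,L}`, the mass of the equilibrium measure on the arc `[π - T, π + T]`. -/
def Omega (L x : ℝ) : ℝ := arcMass L (endpointT L x)

/-- The Euler-Lagrange constant `ℓ_{x,L}`. -/
def ell (L x : ℝ) : ℝ := elConst L (endpointT L x)

/-- The Euler-Lagrange constant `ℓ_{∞,L}` of the one-arc measure (`T = 0`). -/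
def ellInfty (L : ℝ) : ℝ := elConst L 0

end ThinnedCUE

end

namespace ThinnedCUE

open Filter Topology

/-! ### Mean values and boundary limits in the unit disc -/

section

/-! Put a = cos T, b = cos L and s(u) = √((u² + 2au + 1)/(u² - 2bu + 1)), the function `sqrtRatio`.
It is analytic in the unit disc, commutes with conjugation, and s(0) = 1. At e^{iθ} the square s²
equals the real number (cos θ + a)/(cos θ - b), so on the upper half circle s is real on the two
arcs of the support and purely imaginary on the gap (L, π - T). Everything is read off from s.

The function log((1+u)/(1-u)) vanishes at 0 and has constant imaginary part π/2 on the upper half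
circle. The mean value property for its product with s turns the endpoint integral into the integral
of |s| over the gap (`integral_log_mul_sqrt`, `endpointIntegral_eq_gap`). Integrals of (s - 1)/u
along radii give the rest: the radius to 1 gives ℓ, the radii to 1 and -1 differ by the gap integral
(`endpointIntegral_eq_sub`), and the imaginary part on a radius ending in the gap gives Ω
(`arcMass_eq_rayIntegral`).

The T-derivative of (s - 1)/u is -sin T · k with k = 1/√((u² + 2au + 1)(u² - 2bu + 1)). Let H be the
primitive of k with H(0) = 0. On the circle, Re H is a constant A on the inner arc and a constant B
on the outer arc, and Im H is a constant C on the gap. Since H s vanishes at 0, its mean vanishes,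
which reads πA(1 - Ω) + πBΩ - Cx = 0 (`bilinear_relation`). As dℓ/dT = -sin T · A, dx/dT = -sin T ·
(A - B) and dΩ/dT = sin T · C/π, this is dℓ/dT + x dΩ/dT = Ω dx/dT (`exists_derivatives`).

Because A > 0 > B, x is strictly decreasing in T; its values at T = 0 and T = π - L are x_c and 0.
So T is a continuous function of x, differentiable inside, and division by dx/dT gives ℓ' + xΩ' = Ω,
that is (ℓ + xΩ)' = 2Ω. Both integral formulas come from this primitive together with Ω(x_c) = 0,
ℓ(0) = 0 and the elementary evaluation of ℓ at T = 0. -/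

lemma circleMap_mem_unitBall {r : ℝ} (h0 : 0 ≤ r) (h1 : r < 1) (θ : ℝ) :
    circleMap 0 r θ ∈ Metric.ball (0 : ℂ) 1 := by
  simp [abs_of_nonneg h0, h1]

lemma conj_circleMap_zero (r θ : ℝ) :
    (starRingEnd ℂ) (circleMap 0 r θ) = circleMap 0 r (-θ) := by
  simp [circleMap_zero, ← Complex.exp_conj]

lemma circleMap_zero_two_pi_sub (r θ : ℝ) :
    circleMap 0 r (2 * π - θ) = (starRingEnd ℂ) (circleMap 0 r θ) := by
  rw [conj_circleMap_zero, show 2 * π - θ = -θ + 2 * π by ring, periodic_circleMap]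

/-- An even function about `π` has twice its half integral over a period. -/
lemma integral_two_pi_eq_two_mul {φ : ℝ → ℝ} (hφ : IntervalIntegrable φ volume 0 π)
    (hsymm : ∀ θ, φ (2 * π - θ) = φ θ) :
    IntervalIntegrable φ volume π (2 * π) ∧
      ∫ θ in (0 : ℝ)..(2 * π), φ θ = 2 * ∫ θ in (0 : ℝ)..π, φ θ := by
  have h1 : IntervalIntegrable φ volume π (2 * π) := by
    have := hφ.comp_sub_left (2 * π)
    simp only [hsymm] at this
    rw [show 2 * π - 0 = 2 * π by ring, show 2 * π - π = π by ring] at this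
    exact this.symm
  refine ⟨h1, ?_⟩
  rw [← intervalIntegral.integral_add_adjacent_intervals hφ h1]
  have := intervalIntegral.integral_comp_sub_left (a := (0 : ℝ)) (b := π) φ (2 * π)
  simp only [hsymm] at this
  rw [show 2 * π - 0 = 2 * π by ring, show 2 * π - π = π by ring] at this
  rw [← this]; ring

lemma continuous_comp_circleMap {F : ℂ → ℂ} (hF : DifferentiableOn ℂ F (Metric.ball 0 1))
    {r : ℝ} (h0 : 0 ≤ r) (h1 : r < 1) : Continuous fun θ => F (circleMap 0 r θ) :=
  hF.continuousOn.comp_continuous (continuous_circleMap 0 r)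
    (fun θ => circleMap_mem_unitBall h0 h1 θ)

/-- Mean value property on the upper half circle for a function commuting with conjugation. -/
lemma integral_re_circleMap {F : ℂ → ℂ} (hF : DifferentiableOn ℂ F (Metric.ball 0 1))
    (hconj : ∀ z ∈ Metric.ball (0 : ℂ) 1, F ((starRingEnd ℂ) z) = (starRingEnd ℂ) (F z))
    {r : ℝ} (h0 : 0 ≤ r) (h1 : r < 1) :
    ∫ θ in (0 : ℝ)..π, (F (circleMap 0 r θ)).re = π * (F 0).re := by
  have hc := continuous_comp_circleMap hF h0 h1
  have hmv : Real.circleAverage F 0 r = F 0 := by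
    apply DiffContOnCl.circleAverage
    apply DifferentiableOn.diffContOnCl
    apply hF.mono
    intro z hz
    have := Metric.closure_ball_subset_closedBall hz
    rw [Metric.mem_closedBall, abs_of_nonneg h0] at this
    exact Metric.mem_ball.2 (this.trans_lt h1)
  rw [Real.circleAverage_def] at hmv
  have h2 : (∫ θ in (0 : ℝ)..(2 * π), F (circleMap 0 r θ)).re =
      ∫ θ in (0 : ℝ)..(2 * π), (F (circleMap 0 r θ)).re :=
    ((Complex.reCLM.intervalIntegral_comp_comm (hc.intervalIntegrable _ _))).symm
  have h3 := (integral_two_pi_eq_two_mul (φ := fun θ => (F (circleMap 0 r θ)).re)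
    ((Complex.continuous_re.comp hc).intervalIntegrable _ _) (fun θ => by
      rw [circleMap_zero_two_pi_sub, hconj _ (circleMap_mem_unitBall h0 h1 θ)]; simp)).2
  rw [← h2] at h3
  have h4 := congrArg Complex.re hmv
  rw [Complex.real_smul, Complex.re_ofReal_mul, h3] at h4
  rw [← h4]
  field_simp

lemma eventually_mem_Ioo_left_one : ∀ᶠ r : ℝ in 𝓝[<] 1, r ∈ Ioo (1 / 2 : ℝ) 1 :=
  Ioo_mem_nhdsLT (by norm_num)

/-- A dominated pointwise limit of functions is integrable. -/
lemma intervalIntegrable_of_dominated_limit {f : ℝ → ℝ → ℂ} {fhat : ℝ → ℂ} {D : ℝ → ℝ} {c d : ℝ}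
    (hcd : c ≤ d) (hf : ∀ᶠ r in 𝓝[<] (1 : ℝ), Continuous (f r))
    (hD : IntervalIntegrable D volume c d)
    (hb : ∀ᶠ r in 𝓝[<] (1 : ℝ), ∀ᵐ θ, θ ∈ Ioc c d → ‖f r θ‖ ≤ D θ)
    (hlim : ∀ᵐ θ, θ ∈ Ioc c d → Tendsto (fun r => f r θ) (𝓝[<] 1) (𝓝 (fhat θ))) :
    IntervalIntegrable fhat volume c d ∧
      Tendsto (fun r => ∫ θ in c..d, f r θ) (𝓝[<] 1) (𝓝 (∫ θ in c..d, fhat θ)) := by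
  -- Measurability of the limit, and a single null set for all the bounds, require countably many
  -- radii.
  obtain ⟨u, hu⟩ := (𝓝[<] (1 : ℝ)).exists_seq_tendsto
  have hfu : ∀ᶠ n in atTop, Continuous (f (u n)) := hu.eventually hf
  have hbu : ∀ᶠ n in atTop, ∀ᵐ θ, θ ∈ Ioc c d → ‖f (u n) θ‖ ≤ D θ := hu.eventually hb
  obtain ⟨N, hN⟩ := eventually_atTop.1 (hfu.and hbu)
  constructor
  · rw [intervalIntegrable_iff_integrableOn_Ioc_of_le hcd] at hD ⊢
    have hlim' : ∀ᵐ θ ∂(volume.restrict (Ioc c d)),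
        Tendsto (fun n => f (u (n + N)) θ) atTop (𝓝 (fhat θ)) := by
      rw [ae_restrict_iff' measurableSet_Ioc]
      filter_upwards [hlim] with θ hθ h
      exact ((hθ h).comp hu).comp (tendsto_add_atTop_nat N)
    refine Integrable.mono' hD ?_ ?_
    · exact aestronglyMeasurable_of_tendsto_ae atTop
        (fun n => (hN (n + N) (by omega)).1.aestronglyMeasurable) hlim'
    · have hb' : ∀ᵐ θ ∂(volume.restrict (Ioc c d)), ∀ n, ‖f (u (n + N)) θ‖ ≤ D θ := by
        rw [ae_all_iff]
        intro n
        rw [ae_restrict_iff' measurableSet_Ioc]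
        exact (hN (n + N) (by omega)).2
      filter_upwards [hlim', hb'] with θ h1 h2
      exact le_of_tendsto h1.norm (Eventually.of_forall h2)
  · refine intervalIntegral.tendsto_integral_filter_of_dominated_convergence D ?_ ?_ hD ?_
    · filter_upwards [hf] with r hr using hr.aestronglyMeasurable
    · simpa only [uIoc_of_le hcd] using hb
    · simpa only [uIoc_of_le hcd] using hlim

/-- Mean value property for boundary values. -/
lemma integral_re_boundary {F : ℂ → ℂ} {Fhat : ℝ → ℂ} {D : ℝ → ℝ}
    (hF : DifferentiableOn ℂ F (Metric.ball 0 1))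
    (hconj : ∀ z ∈ Metric.ball (0 : ℂ) 1, F ((starRingEnd ℂ) z) = (starRingEnd ℂ) (F z))
    (hD : IntervalIntegrable D volume 0 π)
    (hb : ∀ᶠ r in 𝓝[<] (1 : ℝ), ∀ᵐ θ, θ ∈ Ioc 0 π → ‖F (circleMap 0 r θ)‖ ≤ D θ)
    (hlim : ∀ᵐ θ, θ ∈ Ioc 0 π →
      Tendsto (fun r => F (circleMap 0 r θ)) (𝓝[<] 1) (𝓝 (Fhat θ))) :
    IntervalIntegrable Fhat volume 0 π ∧
      ∫ θ in (0 : ℝ)..π, (Fhat θ).re = π * (F 0).re := by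
  have hc : ∀ᶠ r in 𝓝[<] (1 : ℝ), Continuous fun θ => F (circleMap 0 r θ) := by
    filter_upwards [eventually_mem_Ioo_left_one] with r hr
    exact continuous_comp_circleMap hF (by linarith [hr.1]) hr.2
  obtain ⟨hi, ht⟩ := intervalIntegrable_of_dominated_limit pi_pos.le hc hD hb hlim
  refine ⟨hi, ?_⟩
  have h1 : Tendsto (fun r => (∫ θ in (0 : ℝ)..π, F (circleMap 0 r θ)).re) (𝓝[<] 1)
      (𝓝 (∫ θ in (0 : ℝ)..π, Fhat θ).re) := (Complex.continuous_re.tendsto _).comp ht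
  rw [show (∫ θ in (0 : ℝ)..π, (Fhat θ).re) = (∫ θ in (0 : ℝ)..π, Fhat θ).re from
    Complex.reCLM.intervalIntegral_comp_comm hi]
  refine tendsto_nhds_unique h1 (tendsto_const_nhds.congr' ?_)
  filter_upwards [eventually_mem_Ioo_left_one] with r hr
  have hr0 : 0 ≤ r := by linarith [hr.1]
  rw [← integral_re_circleMap hF hconj hr0 hr.2]
  exact Complex.reCLM.intervalIntegral_comp_comm
    ((continuous_comp_circleMap hF hr0 hr.2).intervalIntegrable _ _)

/-! ### Primitives along radii and along the circle -/

/-- The integral of `h` along the radius ending at `exp (iθ)`. -/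
noncomputable def rayIntegral (h : ℂ → ℂ) (θ : ℝ) : ℂ :=
  ∫ t in (0 : ℝ)..1, Complex.exp (θ * Complex.I) * h (circleMap 0 t θ)

lemma hasDerivAt_comp_circleMap_radius {H h : ℂ → ℂ}
    (hH : ∀ z ∈ Metric.ball (0 : ℂ) 1, HasDerivAt H (h z) z) {t : ℝ} (h0 : 0 ≤ t) (h1 : t < 1)
    (θ : ℝ) : HasDerivAt (fun s : ℝ => H (circleMap 0 s θ))
      (Complex.exp (θ * Complex.I) * h (circleMap 0 t θ)) t := by
  have h2 : HasDerivAt (fun s : ℝ => circleMap 0 s θ) (Complex.exp (θ * Complex.I)) t := by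
    simpa [circleMap_zero] using
      (Complex.ofRealCLM.hasDerivAt (x := t)).mul_const (Complex.exp (θ * Complex.I))
  have := (hH _ (circleMap_mem_unitBall h0 h1 θ)).comp t h2
  rwa [mul_comm] at this

lemma primitive_circleMap {H h : ℂ → ℂ} (hh : DifferentiableOn ℂ h (Metric.ball 0 1))
    (hH : ∀ z ∈ Metric.ball (0 : ℂ) 1, HasDerivAt H (h z) z) {r : ℝ} (h0 : 0 ≤ r) (h1 : r < 1)
    (θ : ℝ) : H (circleMap 0 r θ) = H 0 +
      ∫ t in (0 : ℝ)..r, Complex.exp (θ * Complex.I) * h (circleMap 0 t θ) := by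
  have hcont : ContinuousOn (fun t : ℝ => Complex.exp (θ * Complex.I) * h (circleMap 0 t θ))
      (uIcc 0 r) := by
    rw [uIcc_of_le h0]
    refine continuousOn_const.mul (hh.continuousOn.comp (t := Metric.ball 0 1) ?_ ?_)
    · simp only [circleMap_zero]; fun_prop
    · intro t ht; exact circleMap_mem_unitBall ht.1 (ht.2.trans_lt h1) θ
  rw [intervalIntegral.integral_eq_sub_of_hasDerivAt (f := fun s : ℝ => H (circleMap 0 s θ)) ?_
    hcont.intervalIntegrable]
  · simp
  · intro t ht
    rw [uIcc_of_le h0] at ht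
    exact hasDerivAt_comp_circleMap_radius hH ht.1 (ht.2.trans_lt h1) θ

lemma primitive_circleMap_angle {H h : ℂ → ℂ} (hh : DifferentiableOn ℂ h (Metric.ball 0 1))
    (hH : ∀ z ∈ Metric.ball (0 : ℂ) 1, HasDerivAt H (h z) z) {r : ℝ} (h0 : 0 ≤ r) (h1 : r < 1)
    (θ : ℝ) : H (circleMap 0 r θ) = H (circleMap 0 r 0) +
      ∫ α in (0 : ℝ)..θ, Complex.I * (circleMap 0 r α * h (circleMap 0 r α)) := by
  have hcont : Continuous (fun α : ℝ => Complex.I * (circleMap 0 r α * h (circleMap 0 r α))) :=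
    continuous_const.mul ((continuous_circleMap 0 r).mul (continuous_comp_circleMap hh h0 h1))
  rw [intervalIntegral.integral_eq_sub_of_hasDerivAt (f := fun α : ℝ => H (circleMap 0 r α)) ?_
    (hcont.intervalIntegrable _ _)]
  · simp
  · intro α _
    have := (hH _ (circleMap_mem_unitBall h0 h1 α)).comp α (hasDerivAt_circleMap 0 r α)
    rw [show Complex.I * (circleMap 0 r α * h (circleMap 0 r α)) =
      h (circleMap 0 r α) * (circleMap 0 r α * Complex.I) by ring]
    exact this

lemma tendsto_primitive_ray {H h : ℂ → ℂ} (hh : DifferentiableOn ℂ h (Metric.ball 0 1))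
    (hH : ∀ z ∈ Metric.ball (0 : ℂ) 1, HasDerivAt H (h z) z) {θ : ℝ}
    (hi : IntervalIntegrable
      (fun t : ℝ => Complex.exp (θ * Complex.I) * h (circleMap 0 t θ)) volume 0 1) :
    Tendsto (fun r : ℝ => H (circleMap 0 r θ)) (𝓝[<] 1) (𝓝 (H 0 + rayIntegral h θ)) := by
  have h1 := intervalIntegral.continuousOn_primitive_interval (a := (0 : ℝ)) (b := 1)
    (f := fun t : ℝ => Complex.exp (θ * Complex.I) * h (circleMap 0 t θ)) (μ := volume)
    (by
      rw [uIcc_of_le zero_le_one]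
      exact (intervalIntegrable_iff_integrableOn_Icc_of_le zero_le_one).1 hi)
  have h2 := (h1 1 (by simp)).tendsto.const_add (H 0)
  have h3 : 𝓝[<] (1 : ℝ) ≤ 𝓝[uIcc 0 1] 1 := by
    rw [uIcc_of_le zero_le_one]
    refine le_inf nhdsWithin_le_nhds (le_principal_iff.2 ?_)
    filter_upwards [eventually_mem_Ioo_left_one] with r hr
    exact ⟨by linarith [hr.1], hr.2.le⟩
  refine (h2.mono_left h3).congr' ?_
  filter_upwards [eventually_mem_Ioo_left_one] with r hr
  exact (primitive_circleMap hh hH (by linarith [hr.1]) hr.2 θ).symm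

section Boundary

variable {H h : ℂ → ℂ} {hhat : ℝ → ℂ} {D : ℝ → ℝ}

/-- Boundary values of a primitive, obtained by integrating along the circle. -/
lemma tendsto_primitive_boundary (hh : DifferentiableOn ℂ h (Metric.ball 0 1))
    (hH : ∀ z ∈ Metric.ball (0 : ℂ) 1, HasDerivAt H (h z) z)
    (h0 : IntervalIntegrable
      (fun t : ℝ => Complex.exp ((0 : ℝ) * Complex.I) * h (circleMap 0 t 0)) volume 0 1)
    (hD : IntervalIntegrable D volume 0 π)
    (hb : ∀ᶠ r in 𝓝[<] (1 : ℝ), ∀ᵐ θ, θ ∈ Ioc 0 π →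
      ‖circleMap 0 r θ * h (circleMap 0 r θ)‖ ≤ D θ)
    (hlim : ∀ᵐ θ, θ ∈ Ioc 0 π →
      Tendsto (fun r => circleMap 0 r θ * h (circleMap 0 r θ)) (𝓝[<] 1) (𝓝 (hhat θ)))
    {θ : ℝ} (hθ : θ ∈ Icc 0 π) :
    Tendsto (fun r : ℝ => H (circleMap 0 r θ)) (𝓝[<] 1)
      (𝓝 (H 0 + (rayIntegral h 0 + ∫ α in (0 : ℝ)..θ, Complex.I * hhat α))) := by
  have hc : ∀ᶠ r in 𝓝[<] (1 : ℝ),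
      Continuous fun θ => circleMap 0 r θ * h (circleMap 0 r θ) := by
    filter_upwards [eventually_mem_Ioo_left_one] with r hr
    exact (continuous_circleMap 0 r).mul
      (continuous_comp_circleMap hh (by linarith [hr.1]) hr.2)
  have hsub : uIcc 0 θ ⊆ uIcc 0 π := by
    rw [uIcc_of_le hθ.1, uIcc_of_le pi_pos.le]; exact Icc_subset_Icc_right hθ.2
  have h3 := (intervalIntegrable_of_dominated_limit hθ.1 hc (hD.mono_set hsub)
    (by
      filter_upwards [hb] with r hr
      filter_upwards [hr] with α hα h
      exact hα ⟨h.1, h.2.trans hθ.2⟩)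
    (by
      filter_upwards [hlim] with α hα h
      exact hα ⟨h.1, h.2.trans hθ.2⟩)).2
  have h4 := (tendsto_primitive_ray hh hH h0).add (h3.const_mul Complex.I)
  rw [← intervalIntegral.integral_const_mul, add_assoc] at h4
  refine h4.congr' ?_
  filter_upwards [eventually_mem_Ioo_left_one] with r hr
  rw [primitive_circleMap_angle hh hH (by linarith [hr.1]) hr.2 θ,
    intervalIntegral.integral_const_mul]

/-- The inverse square root singularities of the derivative are integrable along the circle, so the
primitive stays bounded. This supplies the majorant when the mean value property is applied to a
product containing `H`. -/
lemma exists_bound_primitive_boundary (hh : DifferentiableOn ℂ h (Metric.ball 0 1))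
    (hH : ∀ z ∈ Metric.ball (0 : ℂ) 1, HasDerivAt H (h z) z)
    (h0 : IntervalIntegrable
      (fun t : ℝ => Complex.exp ((0 : ℝ) * Complex.I) * h (circleMap 0 t 0)) volume 0 1)
    (hD : IntervalIntegrable D volume 0 π)
    (hb : ∀ᶠ r in 𝓝[<] (1 : ℝ), ∀ᵐ θ, θ ∈ Ioc 0 π →
      ‖circleMap 0 r θ * h (circleMap 0 r θ)‖ ≤ D θ) :
    ∃ M, ∀ᶠ r in 𝓝[<] (1 : ℝ), ∀ θ ∈ Icc 0 π, ‖H (circleMap 0 r θ)‖ ≤ M := by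
  refine ⟨‖H 0 + rayIntegral h 0‖ + 1 + ∫ θ in (0 : ℝ)..π, |D θ|, ?_⟩
  have h1 := (tendsto_primitive_ray hh hH h0).norm.eventually
    (eventually_le_nhds (lt_add_one ‖H 0 + rayIntegral h 0‖))
  filter_upwards [h1, hb, eventually_mem_Ioo_left_one] with r h2 h3 hr θ hθ
  rw [primitive_circleMap_angle hh hH (by linarith [hr.1]) hr.2 θ]
  refine (norm_add_le _ _).trans (add_le_add h2 ?_)
  have hsub : uIcc 0 θ ⊆ uIcc 0 π := by
    rw [uIcc_of_le hθ.1, uIcc_of_le pi_pos.le]; exact Icc_subset_Icc_right hθ.2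
  calc ‖∫ α in (0 : ℝ)..θ, Complex.I * (circleMap 0 r α * h (circleMap 0 r α))‖
      ≤ ∫ α in (0 : ℝ)..θ, |D α| := by
        refine intervalIntegral.norm_integral_le_of_norm_le hθ.1 ?_ (hD.mono_set hsub).abs
        filter_upwards [h3] with α hα h
        rw [norm_mul, Complex.norm_I, one_mul]
        exact (hα ⟨h.1, h.2.trans hθ.2⟩).trans (le_abs_self _)
    _ ≤ ∫ α in (0 : ℝ)..π, |D α| := by
        refine intervalIntegral.integral_mono_interval le_rfl hθ.1 hθ.2 ?_ hD.abs
        exact Eventually.of_forall fun α => abs_nonneg _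

/-- The integrals over two radii differ by the integral along the circle. -/
lemma rayIntegral_eq_add (hh : DifferentiableOn ℂ h (Metric.ball 0 1))
    (h0 : IntervalIntegrable
      (fun t : ℝ => Complex.exp ((0 : ℝ) * Complex.I) * h (circleMap 0 t 0)) volume 0 1)
    (hD : IntervalIntegrable D volume 0 π)
    (hb : ∀ᶠ r in 𝓝[<] (1 : ℝ), ∀ᵐ θ, θ ∈ Ioc 0 π →
      ‖circleMap 0 r θ * h (circleMap 0 r θ)‖ ≤ D θ)
    (hlim : ∀ᵐ θ, θ ∈ Ioc 0 π →
      Tendsto (fun r => circleMap 0 r θ * h (circleMap 0 r θ)) (𝓝[<] 1) (𝓝 (hhat θ)))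
    {θ : ℝ} (hθ : θ ∈ Icc 0 π)
    (hi : IntervalIntegrable
      (fun t : ℝ => Complex.exp (θ * Complex.I) * h (circleMap 0 t θ)) volume 0 1) :
    rayIntegral h θ = rayIntegral h 0 + ∫ α in (0 : ℝ)..θ, Complex.I * hhat α := by
  -- The disc carries a primitive; its radial limit at e^{iθ} is computed along both paths and the
  -- limit is unique.
  obtain ⟨H, hH⟩ := hh.isExactOn_ball
  have h1 := tendsto_primitive_ray hh hH hi
  have h2 := tendsto_primitive_boundary hh hH h0 hD hb hlim hθ
  exact add_left_cancel (tendsto_nhds_unique h1 h2)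

end Boundary

/-- A primitive vanishing at the centre inherits the symmetry under conjugation. -/
lemma primitive_conj {H h : ℂ → ℂ} (hh : DifferentiableOn ℂ h (Metric.ball 0 1))
    (hH : ∀ z ∈ Metric.ball (0 : ℂ) 1, HasDerivAt H (h z) z) (hH0 : H 0 = 0)
    (hconj : ∀ z ∈ Metric.ball (0 : ℂ) 1, h ((starRingEnd ℂ) z) = (starRingEnd ℂ) (h z)) :
    ∀ z ∈ Metric.ball (0 : ℂ) 1, H ((starRingEnd ℂ) z) = (starRingEnd ℂ) (H z) := by
  intro z hz
  have hz1 : ‖z‖ < 1 := by simpa using hz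
  have hzr : circleMap 0 ‖z‖ z.arg = z := by
    rw [circleMap_zero]; exact Complex.norm_mul_exp_arg_mul_I z
  rw [← hzr, conj_circleMap_zero, primitive_circleMap hh hH (norm_nonneg z) hz1,
    primitive_circleMap hh hH (norm_nonneg z) hz1, hH0, zero_add, zero_add,
    ← intervalIntegral.intervalIntegral_conj]
  refine intervalIntegral.integral_congr fun t ht => ?_
  rw [uIcc_of_le (norm_nonneg z)] at ht
  simp only [map_mul]
  rw [← hconj _ (circleMap_mem_unitBall ht.1 (ht.2.trans_lt hz1) _), conj_circleMap_zero,
    ← Complex.exp_conj]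
  simp

end

/-! ### The analytic square root and its boundary values -/

section

/-- The quadratic polynomial `u² + 2cu + 1`. -/
def quad (c : ℝ) (u : ℂ) : ℂ := u ^ 2 + 2 * c * u + 1

/-- `√((u² + 2au + 1) / (u² - 2bu + 1))`, analytic in the unit disc. -/
noncomputable def sqrtRatio (a b : ℝ) (u : ℂ) : ℂ := (quad a u / quad (-b) u) ^ (1 / 2 : ℂ)

/-- The boundary values of `sqrtRatio` on the upper half circle. -/
noncomputable def sqrtRatioBoundary (a b θ : ℝ) : ℂ :=
  (√((cos θ + a) / (cos θ - b)) : ℝ) + (√(-((cos θ + a) / (cos θ - b))) : ℝ) * Complex.I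

/-- For c = cos β the roots -e^{±iβ} lie on the unit circle; this gives both the absence of zeros in
the disc and the lower bounds near the boundary. -/
lemma quad_eq_mul (β : ℝ) (u : ℂ) : quad (cos β) u =
    (u + Complex.exp (β * Complex.I)) * (u + Complex.exp (-(β * Complex.I))) := by
  have h1 : Complex.exp (β * Complex.I) * Complex.exp (-(β * Complex.I)) = 1 := by
    rw [← Complex.exp_add]; simp
  have h2 : (2 : ℂ) * (cos β : ℝ) =
      Complex.exp (β * Complex.I) + Complex.exp (-(β * Complex.I)) := by
    rw [Complex.ofReal_cos, Complex.cos, neg_mul]; ring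
  unfold quad
  rw [h2]
  linear_combination -h1

/-- Replacing rw by w costs at most 1 - r, and 1 - r is itself at most the distance from rw to the
unit vector -v. Boundary values thus bound the interior ones from below, uniformly in r. -/
lemma norm_smul_add_lower {w v : ℂ} (hw : ‖w‖ = 1) (hv : ‖v‖ = 1) {r : ℝ} (h0 : 0 ≤ r)
    (h1 : r ≤ 1) : ‖w + v‖ ≤ 2 * ‖(r : ℂ) * w + v‖ := by
  have e1 : ‖w + v‖ ≤ (1 - r) + ‖(r : ℂ) * w + v‖ := by
    have : w + v = ((1 - r : ℝ) : ℂ) * w + (r * w + v) := by push_cast; ring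
    rw [this]
    refine (norm_add_le _ _).trans (add_le_add_left ?_ _)
    rw [norm_mul, hw, Complex.norm_real, Real.norm_of_nonneg (by linarith), mul_one]
  have e2 : 1 - r ≤ ‖(r : ℂ) * w + v‖ := by
    have := norm_sub_norm_le v (-((r : ℂ) * w))
    rw [norm_neg, norm_mul, hw, hv, Complex.norm_real, Real.norm_of_nonneg h0] at this
    calc 1 - r = 1 - r * 1 := by ring
      _ ≤ _ := this
      _ = _ := by congr 1; ring
  linarith

lemma quad_exp (c θ : ℝ) : quad c (Complex.exp (θ * Complex.I)) =
    2 * Complex.exp (θ * Complex.I) * ((cos θ + c : ℝ) : ℂ) := by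
  have h1 : Complex.exp (θ * Complex.I) * Complex.exp (-(θ * Complex.I)) = 1 := by
    rw [← Complex.exp_add]; simp
  have h2 : (2 : ℂ) * (cos θ : ℝ) =
      Complex.exp (θ * Complex.I) + Complex.exp (-(θ * Complex.I)) := by
    rw [Complex.ofReal_cos, Complex.cos, neg_mul]; ring
  unfold quad
  push_cast [← Complex.ofReal_cos]
  linear_combination - Complex.exp (θ * Complex.I) * h2 - h1

lemma norm_quad_exp (c θ : ℝ) : ‖quad c (Complex.exp (θ * Complex.I))‖ = 2 * |cos θ + c| := by
  rw [quad_exp, norm_mul, norm_mul, Complex.norm_exp_ofReal_mul_I, Complex.norm_real]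
  simp

lemma norm_exp_neg_mul_I (β : ℝ) : ‖Complex.exp (-(β * Complex.I))‖ = 1 := by
  have := Complex.norm_exp_ofReal_mul_I (-β)
  simpa using this

/-- On the unit circle the modulus is 2|cos θ + c|, and passing to radius r loses at most a factor 2
for each of the two linear factors. -/
lemma abs_cos_add_le_norm_quad {c : ℝ} (hc : c ∈ Icc (-1 : ℝ) 1) {r : ℝ} (h0 : 0 ≤ r)
    (h1 : r ≤ 1) (θ : ℝ) : |cos θ + c| ≤ 2 * ‖quad c (circleMap 0 r θ)‖ := by
  rw [← cos_arccos hc.1 hc.2]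
  generalize arccos c = β
  have h2 := norm_quad_exp (cos β) θ
  rw [quad_eq_mul, norm_mul] at h2 ⊢
  rw [circleMap_zero]
  have e := Complex.norm_exp_ofReal_mul_I
  have e1 := norm_smul_add_lower (e θ) (e β) h0 h1
  have e2 := norm_smul_add_lower (e θ) (norm_exp_neg_mul_I β) h0 h1
  have := mul_le_mul e1 e2 (norm_nonneg _) (by positivity)
  nlinarith

lemma quad_ne_zero {c : ℝ} (hc : c ∈ Icc (-1 : ℝ) 1) {u : ℂ} (hu : u ∈ Metric.ball (0 : ℂ) 1) :
    quad c u ≠ 0 := by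
  have hu1 : ‖u‖ < 1 := by simpa using hu
  rw [← cos_arccos hc.1 hc.2, quad_eq_mul]
  generalize arccos c = β
  refine mul_ne_zero ?_ ?_ <;> intro h
  · rw [eq_neg_of_add_eq_zero_left h, norm_neg, Complex.norm_exp_ofReal_mul_I] at hu1
    exact lt_irrefl _ hu1
  · rw [eq_neg_of_add_eq_zero_left h, norm_neg, norm_exp_neg_mul_I] at hu1
    exact lt_irrefl _ hu1

lemma quad_conj (c : ℝ) (u : ℂ) :
    quad c ((starRingEnd ℂ) u) = (starRingEnd ℂ) (quad c u) := by
  simp [quad, Complex.conj_ofNat]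

lemma quad_ofReal (c x : ℝ) : quad c (x : ℂ) = ((x ^ 2 + 2 * c * x + 1 : ℝ) : ℂ) := by
  simp [quad]

lemma quad_real_pos {c x : ℝ} (hc : c ∈ Icc (-1 : ℝ) 1) (hx : |x| < 1) :
    0 < x ^ 2 + 2 * c * x + 1 := by
  obtain ⟨h1, h2⟩ := abs_lt.1 hx
  have h3 : 0 < (1 + x) ^ 2 := pow_pos (by linarith) 2
  have h4 : 0 < (1 - x) ^ 2 := pow_pos (by linarith) 2
  rcases le_or_gt c 0 with h | h <;> nlinarith [hc.1, hc.2]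

lemma quad_mul_conj_im (a b : ℝ) (u : ℂ) :
    (quad a u * (starRingEnd ℂ) (quad (-b) u)).im =
      2 * (a + b) * u.im * (1 - Complex.normSq u) := by
  simp [quad, Complex.normSq_apply, pow_two]
  ring

lemma quad_div_im (a b : ℝ) (u : ℂ) :
    (quad a u / quad (-b) u).im =
      2 * (a + b) * u.im * (1 - Complex.normSq u) / Complex.normSq (quad (-b) u) := by
  rw [← quad_mul_conj_im, div_eq_mul_inv, Complex.inv_def, ← mul_assoc, Complex.im_mul_ofReal,
    div_eq_mul_inv]

variable {a b : ℝ}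

/-- For a + b > 0 the imaginary part of the ratio has the sign of Im u, so the ratio can be real
only on the real diameter, where it is positive. Hence the principal root is analytic in the whole
disc. -/
lemma quad_div_mem_slitPlane (ha : a ∈ Icc (-1 : ℝ) 1) (hb : -b ∈ Icc (-1 : ℝ) 1)
    {u : ℂ} (hu : u ∈ Metric.ball (0 : ℂ) 1) (hab : 0 ≤ a + b) :
    quad a u / quad (-b) u ∈ Complex.slitPlane := by
  have hu1 : ‖u‖ < 1 := by simpa using hu
  rcases hab.eq_or_lt with h | h
  · rw [show -b = a by linarith, div_self (quad_ne_zero ha hu)]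
    exact Complex.one_mem_slitPlane
  rw [Complex.mem_slitPlane_iff]
  by_cases hi : u.im = 0
  · left
    have hur : u = (u.re : ℂ) := by apply Complex.ext <;> simp [hi]
    have hx : |u.re| < 1 := (Complex.abs_re_le_norm u).trans_lt hu1
    rw [hur, quad_ofReal, quad_ofReal, ← Complex.ofReal_div, Complex.ofReal_re]
    exact div_pos (quad_real_pos ha hx) (quad_real_pos hb hx)
  · right
    rw [quad_div_im]
    have h1 : 0 < Complex.normSq (quad (-b) u) := Complex.normSq_pos.2 (quad_ne_zero hb hu)
    have h2 : Complex.normSq u < 1 := by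
      rw [Complex.normSq_eq_norm_sq]; nlinarith [norm_nonneg u]
    have h3 : (1 - Complex.normSq u) ≠ 0 := by linarith
    positivity

lemma quad_div_im_nonneg {u : ℂ} (hu : u ∈ Metric.ball (0 : ℂ) 1) (hab : 0 ≤ a + b)
    (hi : 0 ≤ u.im) : 0 ≤ (quad a u / quad (-b) u).im := by
  have hu1 : ‖u‖ < 1 := by simpa using hu
  have h2 : Complex.normSq u < 1 := by
    rw [Complex.normSq_eq_norm_sq]; nlinarith [norm_nonneg u]
  rw [quad_div_im]
  have h3 : 0 ≤ (1 - Complex.normSq u) := by linarith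
  exact div_nonneg (by positivity) (Complex.normSq_nonneg _)

lemma differentiable_quad (c : ℝ) : Differentiable ℂ (quad c) := by
  unfold quad; fun_prop

lemma sqrtRatio_sq (a b : ℝ) (u : ℂ) : sqrtRatio a b u ^ 2 = quad a u / quad (-b) u := by
  unfold sqrtRatio
  rw [one_div]
  exact Complex.cpow_nat_inv_pow _ two_ne_zero

lemma norm_sqrtRatio_sq (a b : ℝ) (u : ℂ) :
    ‖sqrtRatio a b u‖ ^ 2 = ‖quad a u‖ / ‖quad (-b) u‖ := by
  rw [← norm_pow, sqrtRatio_sq, norm_div]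

lemma differentiableOn_sqrtRatio (ha : a ∈ Icc (-1 : ℝ) 1)
    (hb : -b ∈ Icc (-1 : ℝ) 1) (hab : 0 ≤ a + b) :
    DifferentiableOn ℂ (sqrtRatio a b) (Metric.ball 0 1) := by
  refine DifferentiableOn.cpow_const ?_ fun u hu => quad_div_mem_slitPlane ha hb hu hab
  exact (differentiable_quad a).differentiableOn.div (differentiable_quad (-b)).differentiableOn
    fun u hu => quad_ne_zero hb hu

lemma sqrtRatio_conj (ha : a ∈ Icc (-1 : ℝ) 1) (hb : -b ∈ Icc (-1 : ℝ) 1) (hab : 0 ≤ a + b)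
    {u : ℂ} (hu : u ∈ Metric.ball (0 : ℂ) 1) :
    sqrtRatio a b ((starRingEnd ℂ) u) = (starRingEnd ℂ) (sqrtRatio a b u) := by
  unfold sqrtRatio
  rw [quad_conj, quad_conj, ← map_div₀, Complex.conj_cpow _ _
    (Complex.slitPlane_arg_ne_pi (quad_div_mem_slitPlane ha hb hu hab))]
  simp [Complex.conj_ofNat]

lemma sqrtRatio_ofReal (ha : a ∈ Icc (-1 : ℝ) 1) (hb : -b ∈ Icc (-1 : ℝ) 1)
    {x : ℝ} (hx : |x| < 1) : sqrtRatio a b (x : ℂ) =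
    (√((x ^ 2 + 2 * a * x + 1) / (x ^ 2 + 2 * (-b) * x + 1)) : ℝ) := by
  unfold sqrtRatio
  rw [quad_ofReal, quad_ofReal, ← Complex.ofReal_div, Real.sqrt_eq_rpow,
    Complex.ofReal_cpow (div_pos (quad_real_pos ha hx) (quad_real_pos hb hx)).le]
  simp

lemma sqrtRatio_zero (a b : ℝ) : sqrtRatio a b 0 = 1 := by
  simp [sqrtRatio, quad]

/-- A principal square root has argument in [-π/2, π/2]. This keeps 1 + `sqrtRatio` away from zero.
-/
lemma sqrtRatio_re_nonneg (a b : ℝ) (u : ℂ) :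
    0 ≤ (sqrtRatio a b u).re := by
  unfold sqrtRatio
  have h := Complex.cpow_ofReal_re (quad a u / quad (-b) u) (1 / 2)
  push_cast at h
  rw [h]
  refine mul_nonneg (rpow_nonneg (norm_nonneg _) _) (cos_nonneg_of_mem_Icc ?_)
  have h1 := Complex.neg_pi_lt_arg (quad a u / quad (-b) u)
  have h2 := Complex.arg_le_pi (quad a u / quad (-b) u)
  constructor <;> linarith

lemma norm_sqrtRatio_circleMap_le (ha : a ∈ Icc (-1 : ℝ) 1) (hb : -b ∈ Icc (-1 : ℝ) 1)
    {r : ℝ} (h0 : 0 ≤ r) (h1 : r < 1) {θ : ℝ}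
    (hθ : cos θ ≠ b) : ‖sqrtRatio a b (circleMap 0 r θ)‖ ≤ 3 * |cos θ - b| ^ (-(1 / 2) : ℝ) := by
  have hp : 0 < |cos θ - b| := abs_pos.2 (sub_ne_zero.2 hθ)
  have e1 : ‖quad a (circleMap 0 r θ)‖ ≤ 4 := by
    unfold quad
    have hn : ‖circleMap 0 r θ‖ ≤ 1 := by simp [abs_of_nonneg h0, h1.le]
    have ha' : |a| ≤ 1 := abs_le.2 ha
    calc _ ≤ ‖(circleMap 0 r θ) ^ 2‖ + ‖2 * (a : ℂ) * circleMap 0 r θ‖ + ‖(1 : ℂ)‖ :=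
          norm_add₃_le
      _ = ‖circleMap 0 r θ‖ ^ 2 + 2 * |a| * ‖circleMap 0 r θ‖ + 1 := by
          rw [norm_pow, norm_mul, norm_mul, Complex.norm_real, norm_one, Real.norm_eq_abs]; simp
      _ ≤ 1 ^ 2 + 2 * 1 * 1 + 1 := by gcongr
      _ = 4 := by norm_num
  have e2 : |cos θ - b| ≤ 2 * ‖quad (-b) (circleMap 0 r θ)‖ := by
    have := abs_cos_add_le_norm_quad hb h0 h1.le θ
    rwa [← sub_eq_add_neg] at this
  -- The two estimates give a quotient of at most 8 / |cos θ - b|; the constant 3 only needs 8 ≤ 3².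
  have e3 : ‖sqrtRatio a b (circleMap 0 r θ)‖ ^ 2 ≤ (3 * |cos θ - b| ^ (-(1 / 2) : ℝ)) ^ 2 := by
    rw [norm_sqrtRatio_sq, mul_pow, ← rpow_natCast (|cos θ - b| ^ (-(1 / 2) : ℝ)),
      ← rpow_mul hp.le]
    norm_num [rpow_neg_one]
    rw [← div_eq_mul_inv, div_le_div_iff₀ (by linarith) hp]
    nlinarith
  exact le_of_sq_le_sq e3 (by positivity)

/-- The square of the left side is 1 / (‖quad a‖ ‖quad (-b)‖), and each factor is at least half the
corresponding |cos θ + a|, |cos θ - b|. -/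
lemma norm_sqrtRatio_div_quad_le (ha : a ∈ Icc (-1 : ℝ) 1) (hb : -b ∈ Icc (-1 : ℝ) 1)
    {r : ℝ} (h0 : 0 ≤ r) (h1 : r < 1) {θ : ℝ}
    (hθ : cos θ ≠ b) (hθa : cos θ + a ≠ 0) :
    ‖sqrtRatio a b (circleMap 0 r θ) / quad a (circleMap 0 r θ)‖ ≤
      2 * (|cos θ - b| ^ (-(1 / 2) : ℝ) * |cos θ + a| ^ (-(1 / 2) : ℝ)) := by
  have hp : 0 < |cos θ - b| := abs_pos.2 (sub_ne_zero.2 hθ)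
  have hq : 0 < |cos θ + a| := abs_pos.2 hθa
  have e1 := abs_cos_add_le_norm_quad ha h0 h1.le θ
  have e2 : |cos θ - b| ≤ 2 * ‖quad (-b) (circleMap 0 r θ)‖ := by
    have := abs_cos_add_le_norm_quad hb h0 h1.le θ
    rwa [← sub_eq_add_neg] at this
  refine le_of_sq_le_sq ?_ (by positivity)
  rw [norm_div, div_pow, norm_sqrtRatio_sq, mul_pow, mul_pow,
    ← rpow_natCast (|cos θ - b| ^ (-(1 / 2) : ℝ)), ← rpow_natCast (|cos θ + a| ^ (-(1 / 2) : ℝ)),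
      ← rpow_mul hp.le, ← rpow_mul hq.le]
  norm_num [rpow_neg_one]
  have h3 : 0 < ‖quad a (circleMap 0 r θ)‖ := by linarith
  have h4 : 0 < ‖quad (-b) (circleMap 0 r θ)‖ := by linarith
  rw [← mul_inv, ← div_eq_mul_inv, div_div, div_le_div_iff₀ (by positivity) (by positivity)]
  have := mul_le_mul e1 e2 hp.le (by positivity)
  nlinarith

/-- Where the limit R of the ratio is positive, the root is continuous. Where R is negative, the
ratio reaches the branch cut from the closed upper half plane, so its logarithm tends to log|R| + iπ
and the root to i√(-R). -/
lemma tendsto_sqrtRatio_boundary (ha : a ∈ Icc (-1 : ℝ) 1) (hb : -b ∈ Icc (-1 : ℝ) 1) (hab : 0 ≤ a + b)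
    {θ : ℝ} (h0 : 0 ≤ θ) (hπ : θ ≤ π) (hθ : cos θ ≠ b)
    (hθa : cos θ + a ≠ 0) :
    Tendsto (fun r : ℝ => sqrtRatio a b (circleMap 0 r θ)) (𝓝[<] 1)
      (𝓝 (sqrtRatioBoundary a b θ)) := by
  set R := (cos θ + a) / (cos θ - b) with hR
  have hR0 : R ≠ 0 := div_ne_zero hθa (sub_ne_zero.2 hθ)
  have hlim : Tendsto (fun r : ℝ => quad a (circleMap 0 r θ) / quad (-b) (circleMap 0 r θ))
      (𝓝[<] 1) (𝓝 (R : ℂ)) := by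
    have hval : quad a (circleMap 0 1 θ) / quad (-b) (circleMap 0 1 θ) = (R : ℂ) := by
      have hne : (cos θ - b) ≠ 0 := sub_ne_zero.2 hθ
      simp only [circleMap_zero, Complex.ofReal_one, one_mul]
      rw [quad_exp, quad_exp, mul_div_mul_left _ _ (by simp [Complex.exp_ne_zero]), hR]
      push_cast
      rw [sub_eq_add_neg]
    rw [← hval]
    have hcm : Continuous fun r : ℝ => circleMap 0 r θ := by
      simp only [circleMap_zero]; fun_prop
    have hc : ContinuousAt
        (fun r : ℝ => quad a (circleMap 0 r θ) / quad (-b) (circleMap 0 r θ)) 1 := by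
      refine ContinuousAt.div ?_ ?_ ?_
      · exact ((differentiable_quad a).continuous.comp hcm).continuousAt
      · exact ((differentiable_quad (-b)).continuous.comp hcm).continuousAt
      · simp only [circleMap_zero, Complex.ofReal_one, one_mul]
        rw [quad_exp]
        refine mul_ne_zero (by simp [Complex.exp_ne_zero]) (Complex.ofReal_ne_zero.2 ?_)
        rw [← sub_eq_add_neg]; exact sub_ne_zero.2 hθ
    exact hc.tendsto.mono_left nhdsWithin_le_nhds
  unfold sqrtRatio sqrtRatioBoundary
  rw [← hR]
  rcases lt_or_gt_of_ne hR0 with hneg | hpos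
  · rw [Real.sqrt_eq_zero_of_nonpos hneg.le]
    have hlim2 : Tendsto (fun r : ℝ => quad a (circleMap 0 r θ) / quad (-b) (circleMap 0 r θ))
        (𝓝[<] 1) (𝓝[{z | 0 ≤ z.im}] (R : ℂ)) := by
      refine tendsto_nhdsWithin_iff.2 ⟨hlim, ?_⟩
      filter_upwards [eventually_mem_Ioo_left_one] with r hr
      have hr0 : 0 ≤ r := by linarith [hr.1]
      refine quad_div_im_nonneg (circleMap_mem_unitBall hr0 hr.2 θ) hab ?_
      rw [circleMap_zero, Complex.im_ofReal_mul, Complex.exp_ofReal_mul_I_im]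
      exact mul_nonneg hr0 (sin_nonneg_of_nonneg_of_le_pi h0 hπ)
    have hlog := (Complex.tendsto_log_nhdsWithin_im_nonneg_of_re_neg_of_im_zero
      (z := (R : ℂ)) (by simpa using hneg) (by simp)).comp hlim2
    have hexp := (Complex.continuous_exp.tendsto _).comp (hlog.mul_const (1 / 2 : ℂ))
    have hv : Complex.exp ((↑(Real.log ‖(R : ℂ)‖) + ↑π * Complex.I) * (1 / 2)) =
        ((0 : ℝ) : ℂ) + ((√(-R) : ℝ) : ℂ) * Complex.I := by
      rw [add_mul, Complex.exp_add, show (π : ℂ) * Complex.I * (1 / 2) = π / 2 * Complex.I by ring,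
        Complex.exp_pi_div_two_mul_I, Complex.norm_real, Real.norm_of_nonpos hneg.le,
        Real.sqrt_eq_rpow, Real.rpow_def_of_pos (by linarith)]
      push_cast
      ring_nf
    rw [← hv]
    refine hexp.congr' ?_
    filter_upwards [eventually_mem_Ioo_left_one] with r hr
    have hr0 : 0 ≤ r := by linarith [hr.1]
    have hm := circleMap_mem_unitBall hr0 hr.2 θ
    simp only [Function.comp]
    rw [Complex.cpow_def_of_ne_zero (div_ne_zero (quad_ne_zero ha hm) (quad_ne_zero hb hm))]
  · rw [Real.sqrt_eq_zero_of_nonpos (x := -R) (by linarith)]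
    have hv : (R : ℂ) ^ (1 / 2 : ℂ) = ((√R : ℝ) : ℂ) + ((0 : ℝ) : ℂ) * Complex.I := by
      rw [Real.sqrt_eq_rpow, Complex.ofReal_cpow hpos.le]
      simp
    rw [← hv]
    have : ContinuousAt (fun z : ℂ => z ^ (1 / 2 : ℂ)) (R : ℂ) :=
      continuousAt_id.cpow continuousAt_const (Complex.mem_slitPlane_iff.2 (Or.inl (by simpa using hpos)))
    exact this.tendsto.comp hlim

end

/-! ### Integrability of inverse square root singularities -/

lemma intervalIntegrable_abs_sub_rpow (β c d : ℝ) :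
    IntervalIntegrable (fun θ => |θ - β| ^ (-(1 / 2) : ℝ)) volume c d := by
  have h := (intervalIntegral.intervalIntegrable_cpow' (a := c - β) (b := d - β)
    (r := ((-(1 / 2) : ℝ) : ℂ)) (by rw [Complex.ofReal_re]; norm_num)).norm
  have h2 := h.comp_sub_right β
  simp only [sub_add_cancel] at h2
  refine h2.congr fun θ _ => ?_
  simp only [Complex.norm_cpow_real, Complex.norm_real, Real.norm_eq_abs]

lemma rpow_neg_half_le {p q C : ℝ} (hq : 0 < q) (hC : 0 < C) (h : C * q ≤ p) :
    p ^ (-(1 / 2) : ℝ) ≤ C ^ (-(1 / 2) : ℝ) * q ^ (-(1 / 2) : ℝ) := by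
  rw [← mul_rpow hC.le hq.le]
  exact rpow_le_rpow_of_nonpos (by positivity) h (by norm_num)

lemma measurable_rpow_neg_half {f : ℝ → ℝ} (hf : Continuous f) :
    AEStronglyMeasurable (fun θ => |f θ| ^ (-(1 / 2) : ℝ)) (volume.restrict (Ioc 0 π)) :=
  (hf.abs.measurable.pow_const _).aestronglyMeasurable

lemma intervalIntegrable_of_abs_le {f g : ℝ → ℝ}
    (hf : AEStronglyMeasurable f (volume.restrict (Ioc 0 π)))
    (hg : IntervalIntegrable g volume 0 π) (h : ∀ᵐ θ, θ ∈ Ioc 0 π → |f θ| ≤ g θ) :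
    IntervalIntegrable f volume 0 π := by
  rw [intervalIntegrable_iff_integrableOn_Ioc_of_le pi_pos.le] at hg ⊢
  refine Integrable.mono' hg hf ?_
  rw [ae_restrict_iff' measurableSet_Ioc]
  exact h

lemma ae_ne_real (x : ℝ) : ∀ᵐ θ : ℝ, θ ≠ x := by
  rw [ae_iff]; simp

lemma ae_cos_ne {c : ℝ} : ∀ᵐ θ : ℝ, θ ∈ Ioc 0 π → cos θ ≠ c := by
  filter_upwards [ae_ne_real (arccos c)] with θ h hθ hc
  exact h (by rw [← hc, arccos_cos hθ.1.le hθ.2])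

/-- With c = cos β, the difference is -2 sin((θ+β)/2) sin((θ-β)/2). The first sine is bounded below
and the second is at least |θ-β|/π in modulus by Jordan's inequality, so the singularity is that of
|θ-β|^{-1/2}. -/
lemma intervalIntegrable_cos_sub_rpow {c : ℝ} (hc : c ∈ Ioo (-1 : ℝ) 1) :
    IntervalIntegrable (fun θ => |cos θ - c| ^ (-(1 / 2) : ℝ)) volume 0 π := by
  obtain ⟨β, hβ, rfl⟩ : ∃ β ∈ Ioo 0 π, cos β = c := by
    have hpi := pi_pos
    exact
    ⟨arccos c, ⟨arccos_pos.2 hc.2, by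
      have := arccos_lt_pi.2 hc.1; exact this⟩, cos_arccos hc.1.le hc.2.le⟩
  -- On θ ∈ [0, π] the angle (θ+β)/2 runs over [β/2, (π+β)/2], where the sine is smallest at an end:
  -- sin(β/2) or cos(β/2).
  set m := min (sin (β / 2)) (cos (β / 2)) with hm
  have hm0 : 0 < m := lt_min (sin_pos_of_pos_of_lt_pi (by linarith [hβ.1])
    (by linarith [hβ.2, pi_pos]))
    (cos_pos_of_mem_Ioo ⟨by linarith [hβ.1, pi_pos], by linarith [hβ.2]⟩)
  have hπ := pi_pos
  refine intervalIntegrable_of_abs_le (measurable_rpow_neg_half (by fun_prop))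
    ((intervalIntegrable_abs_sub_rpow β 0 π).const_mul ((2 * m / π) ^ (-(1 / 2) : ℝ))) ?_
  filter_upwards [ae_ne_real β] with θ hne hθ
  rw [abs_of_nonneg (by positivity)]
  refine rpow_neg_half_le (abs_pos.2 (sub_ne_zero.2 hne)) (by positivity) ?_
  rw [cos_sub_cos, abs_mul, abs_mul, abs_neg, abs_two]
  have h1 : m ≤ |sin ((θ + β) / 2)| := by
    refine le_trans ?_ (le_abs_self _)
    rcases le_or_gt ((θ + β) / 2) (π / 2) with h | h
    · exact (min_le_left _ _).trans (sin_le_sin_of_le_of_le_pi_div_two (by linarith [hβ.1])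
        h (by linarith [hθ.1]))
    · rw [← sin_pi_sub]
      refine (min_le_right _ _).trans ?_
      rw [← sin_pi_div_two_sub]
      exact sin_le_sin_of_le_of_le_pi_div_two (by linarith [hβ.1, hβ.2]) (by linarith)
        (by linarith [hθ.2])
  have h2 : |θ - β| / π ≤ |sin ((θ - β) / 2)| := by
    have hle : |θ - β| ≤ π := by
      rw [abs_le]; constructor <;> linarith [hθ.1, hθ.2, hβ.1, hβ.2]
    have := mul_le_sin (x := |θ - β| / 2) (by positivity) (by linarith)
    have e : sin (|θ - β| / 2) ≤ |sin ((θ - β) / 2)| := by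
      rcases abs_cases (θ - β) with h | h
      · rw [h.1]; exact le_abs_self _
      · rw [h.1, neg_div, sin_neg]; exact neg_le_abs _
    refine le_trans (le_of_eq ?_) (this.trans e)
    field_simp
  have := mul_le_mul h1 h2 (by positivity) (abs_nonneg _)
  calc 2 * m / π * |θ - β| = 2 * (m * (|θ - β| / π)) := by ring
    _ ≤ 2 * (|sin ((θ + β) / 2)| * |sin ((θ - β) / 2)|) := by linarith
    _ = _ := by ring

lemma intervalIntegrable_sin_rpow :
    IntervalIntegrable (fun θ => |sin θ| ^ (-(1 / 2) : ℝ)) volume 0 π := by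
  have hπ := pi_pos
  refine intervalIntegrable_of_abs_le (measurable_rpow_neg_half (by fun_prop))
    (((intervalIntegrable_abs_sub_rpow 0 0 π).add
      (intervalIntegrable_abs_sub_rpow π 0 π)).const_mul ((2 / π) ^ (-(1 / 2) : ℝ))) ?_
  filter_upwards [ae_ne_real π] with θ hne hθ
  rw [abs_of_nonneg (by positivity), mul_add]
  have hlt : θ < π := lt_of_le_of_ne hθ.2 hne
  rcases le_or_gt θ (π / 2) with h | h
  · refine (rpow_neg_half_le (q := |θ - 0|) (C := 2 / π) ?_ (by positivity) ?_).trans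
      (le_add_of_nonneg_right (by positivity))
    · simpa using hθ.1.ne'
    · rw [sub_zero, abs_of_pos hθ.1]
      exact (mul_le_sin hθ.1.le h).trans (le_abs_self _)
  · refine (rpow_neg_half_le (q := |θ - π|) (C := 2 / π) ?_ (by positivity) ?_).trans
      (le_add_of_nonneg_left (by positivity))
    · exact abs_pos.2 (sub_ne_zero.2 hne)
    · rw [abs_sub_comm, abs_of_pos (by linarith), ← sin_pi_sub θ]
      exact (mul_le_sin (by linarith) (by linarith)).trans (le_abs_self _)

/-- One of p, q is at least d/2, so its factor is bounded. Thus a product of two singularities at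
different places is no worse than their sum. -/
lemma rpow_neg_half_mul_le {p q d : ℝ} (hp : 0 ≤ p) (hq : 0 ≤ q) (hd : 0 < d) (h : d ≤ p + q) :
    p ^ (-(1 / 2) : ℝ) * q ^ (-(1 / 2) : ℝ) ≤
      (d / 2) ^ (-(1 / 2) : ℝ) * (p ^ (-(1 / 2) : ℝ) + q ^ (-(1 / 2) : ℝ)) := by
  have hp' := rpow_nonneg hp (-(1 / 2) : ℝ)
  have hq' := rpow_nonneg hq (-(1 / 2) : ℝ)
  have hd' := rpow_nonneg (half_pos hd).le (-(1 / 2) : ℝ)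
  rcases le_or_gt (d / 2) p with h1 | h1
  · have := rpow_le_rpow_of_nonpos (half_pos hd) h1 (by norm_num : (-(1 / 2) : ℝ) ≤ 0)
    nlinarith [mul_le_mul_of_nonneg_right this hq', mul_nonneg hd' hp']
  · have := rpow_le_rpow_of_nonpos (half_pos hd) (by linarith : d / 2 ≤ q)
      (by norm_num : (-(1 / 2) : ℝ) ≤ 0)
    nlinarith [mul_le_mul_of_nonneg_right this hp', mul_nonneg hd' hq']

lemma intervalIntegrable_mul_rpow {f g : ℝ → ℝ} {d : ℝ} (hd : 0 < d) (hfc : Continuous f)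
    (hgc : Continuous g) (hfg : ∀ θ, d ≤ |f θ| + |g θ|)
    (hf : IntervalIntegrable (fun θ => |f θ| ^ (-(1 / 2) : ℝ)) volume 0 π)
    (hg : IntervalIntegrable (fun θ => |g θ| ^ (-(1 / 2) : ℝ)) volume 0 π) :
    IntervalIntegrable (fun θ => |f θ| ^ (-(1 / 2) : ℝ) * |g θ| ^ (-(1 / 2) : ℝ)) volume 0 π := by
  refine intervalIntegrable_of_abs_le
    ((measurable_rpow_neg_half hfc).mul (measurable_rpow_neg_half hgc))
    ((hf.add hg).const_mul ((d / 2) ^ (-(1 / 2) : ℝ))) (Eventually.of_forall fun θ _ => ?_)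
  rw [abs_of_nonneg (by positivity)]
  exact rpow_neg_half_mul_le (abs_nonneg _) (abs_nonneg _) hd (hfg θ)

lemma intervalIntegrable_cos_sub_mul_cos_add_rpow {a b : ℝ} (ha : a ∈ Ioo (-1 : ℝ) 1)
    (hb : b ∈ Ioo (-1 : ℝ) 1) (hab : 0 < a + b) :
    IntervalIntegrable (fun θ => |cos θ - b| ^ (-(1 / 2) : ℝ) * |cos θ + a| ^ (-(1 / 2) : ℝ))
      volume 0 π := by
  refine intervalIntegrable_mul_rpow hab (by fun_prop) (by fun_prop) (fun θ => ?_)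
    (intervalIntegrable_cos_sub_rpow hb) ?_
  · have h1 := neg_le_abs (cos θ - b)
    have h2 := le_abs_self (cos θ + a)
    linarith
  · have := intervalIntegrable_cos_sub_rpow (c := -a) ⟨by linarith [ha.2], by linarith [ha.1]⟩
    simpa using this

lemma intervalIntegrable_sin_mul_cos_sub_rpow {b : ℝ} (hb : b ∈ Ioo (-1 : ℝ) 1) :
    IntervalIntegrable (fun θ => |sin θ| ^ (-(1 / 2) : ℝ) * |cos θ - b| ^ (-(1 / 2) : ℝ))
      volume 0 π := by
  have hb1 : |b| < 1 := abs_lt.2 hb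
  refine intervalIntegrable_mul_rpow (d := 1 - |b|) (by linarith) (by fun_prop) (by fun_prop)
    (fun θ => ?_) intervalIntegrable_sin_rpow (intervalIntegrable_cos_sub_rpow hb)
  have h1 := abs_sub_abs_le_abs_sub (cos θ) b
  have h2 : 1 ≤ |sin θ| + |cos θ| := by
    have h3 := sin_sq_add_cos_sq θ
    rw [← sq_abs (sin θ), ← sq_abs (cos θ)] at h3
    nlinarith [abs_nonneg (sin θ), abs_nonneg (cos θ)]
  linarith

/-! ### Mean value of the root, and the logarithmic integral -/

section

variable {a b : ℝ}

lemma sqrtRatioBoundary_re (a b θ : ℝ) :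
    (sqrtRatioBoundary a b θ).re = √((cos θ + a) / (cos θ - b)) := by
  simp [sqrtRatioBoundary]

lemma sqrtRatioBoundary_im (a b θ : ℝ) :
    (sqrtRatioBoundary a b θ).im = √(-((cos θ + a) / (cos θ - b))) := by
  simp [sqrtRatioBoundary]

lemma mem_Icc_of_mem_Ioo_neg (hb : b ∈ Ioo (-1 : ℝ) 1) : -b ∈ Icc (-1 : ℝ) 1 :=
  ⟨by linarith [hb.2], by linarith [hb.1]⟩

lemma ae_tendsto_sqrtRatio (ha : a ∈ Icc (-1 : ℝ) 1) (hb : b ∈ Ioo (-1 : ℝ) 1)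
    (hab : 0 ≤ a + b) : ∀ᵐ θ : ℝ, θ ∈ Ioc 0 π →
      Tendsto (fun r => sqrtRatio a b (circleMap 0 r θ)) (𝓝[<] 1)
        (𝓝 (sqrtRatioBoundary a b θ)) := by
  filter_upwards [ae_cos_ne (c := b), ae_cos_ne (c := -a)] with θ h1 h2 hθ
  refine tendsto_sqrtRatio_boundary ha (mem_Icc_of_mem_Ioo_neg hb) hab hθ.1.le hθ.2 (h1 hθ) ?_
  intro h; exact h2 hθ (by linarith)

lemma ae_norm_sqrtRatio_le (ha : a ∈ Icc (-1 : ℝ) 1) (hb : b ∈ Ioo (-1 : ℝ) 1) :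
    ∀ᶠ r in 𝓝[<] (1 : ℝ), ∀ᵐ θ : ℝ, θ ∈ Ioc 0 π →
      ‖sqrtRatio a b (circleMap 0 r θ)‖ ≤ 3 * |cos θ - b| ^ (-(1 / 2) : ℝ) := by
  filter_upwards [eventually_mem_Ioo_left_one] with r hr
  filter_upwards [ae_cos_ne (c := b)] with θ h1 hθ
  exact norm_sqrtRatio_circleMap_le ha (mem_Icc_of_mem_Ioo_neg hb) (by linarith [hr.1]) hr.2
    (h1 hθ)

/-- Integrability of the boundary values, and their mean value. -/
lemma integral_sqrtRatioBoundary (ha : a ∈ Icc (-1 : ℝ) 1) (hb : b ∈ Ioo (-1 : ℝ) 1)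
    (hab : 0 ≤ a + b) : IntervalIntegrable (sqrtRatioBoundary a b) volume 0 π ∧
      ∫ θ in (0 : ℝ)..π, √((cos θ + a) / (cos θ - b)) = π := by
  have h := integral_re_boundary
    (differentiableOn_sqrtRatio ha (mem_Icc_of_mem_Ioo_neg hb) hab)
    (fun z hz => sqrtRatio_conj ha (mem_Icc_of_mem_Ioo_neg hb) hab hz)
    ((intervalIntegrable_cos_sub_rpow hb).const_mul 3) (ae_norm_sqrtRatio_le ha hb)
    (ae_tendsto_sqrtRatio ha hb hab)
  simpa [sqrtRatioBoundary_re, sqrtRatio_zero] using h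

lemma intervalIntegrable_re {f : ℝ → ℂ} {c d : ℝ} (h : IntervalIntegrable f volume c d) :
    IntervalIntegrable (fun θ => (f θ).re) volume c d :=
  ⟨h.1.re, h.2.re⟩

lemma intervalIntegrable_im {f : ℝ → ℂ} {c d : ℝ} (h : IntervalIntegrable f volume c d) :
    IntervalIntegrable (fun θ => (f θ).im) volume c d :=
  ⟨h.1.im, h.2.im⟩

lemma intervalIntegrable_sqrt (ha : a ∈ Icc (-1 : ℝ) 1) (hb : b ∈ Ioo (-1 : ℝ) 1)
    (hab : 0 ≤ a + b) :
    IntervalIntegrable (fun θ => √((cos θ + a) / (cos θ - b))) volume 0 π := by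
  simpa [sqrtRatioBoundary_re] using intervalIntegrable_re (integral_sqrtRatioBoundary ha hb hab).1

lemma intervalIntegrable_sqrt_neg (ha : a ∈ Icc (-1 : ℝ) 1) (hb : b ∈ Ioo (-1 : ℝ) 1)
    (hab : 0 ≤ a + b) :
    IntervalIntegrable (fun θ => √(-((cos θ + a) / (cos θ - b)))) volume 0 π := by
  simpa [sqrtRatioBoundary_im] using intervalIntegrable_im (integral_sqrtRatioBoundary ha hb hab).1

/-- The conformal map `log ((1 + u) / (1 - u))` of the disc onto a strip. -/
noncomputable def stripLog (u : ℂ) : ℂ := Complex.log (1 + u) - Complex.log (1 - u)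

lemma one_add_mem_slitPlane {u : ℂ} (hu : u ∈ Metric.ball (0 : ℂ) 1) :
    1 + u ∈ Complex.slitPlane := by
  have hu1 : ‖u‖ < 1 := by simpa using hu
  refine Complex.mem_slitPlane_iff.2 (Or.inl ?_)
  have := (abs_lt.1 ((Complex.abs_re_le_norm u).trans_lt hu1)).1
  simp only [Complex.add_re, Complex.one_re]; linarith

lemma neg_mem_unitBall {u : ℂ} (hu : u ∈ Metric.ball (0 : ℂ) 1) :
    -u ∈ Metric.ball (0 : ℂ) 1 := by simpa using hu

lemma one_sub_mem_slitPlane {u : ℂ} (hu : u ∈ Metric.ball (0 : ℂ) 1) :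
    1 - u ∈ Complex.slitPlane := by
  rw [sub_eq_add_neg]; exact one_add_mem_slitPlane (neg_mem_unitBall hu)

lemma differentiableOn_stripLog : DifferentiableOn ℂ stripLog (Metric.ball 0 1) := by
  unfold stripLog
  refine DifferentiableOn.sub ?_ ?_
  · exact DifferentiableOn.clog (by fun_prop) fun u hu => one_add_mem_slitPlane hu
  · exact DifferentiableOn.clog (by fun_prop) fun u hu => one_sub_mem_slitPlane hu

lemma stripLog_conj {u : ℂ} (hu : u ∈ Metric.ball (0 : ℂ) 1) :
    stripLog ((starRingEnd ℂ) u) = (starRingEnd ℂ) (stripLog u) := by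
  unfold stripLog
  have h1 := Complex.log_conj _ (Complex.slitPlane_arg_ne_pi (one_add_mem_slitPlane hu))
  have h2 := Complex.log_conj _ (Complex.slitPlane_arg_ne_pi (one_sub_mem_slitPlane hu))
  simp only [map_add, map_sub, map_one] at h1 h2 ⊢
  rw [h1, h2]

/-- The bound -log s ≤ 2 s^{-1/2} is log y ≤ y at y = s^{-1/2}; log 2 and the argument are absorbed
because s^{-1/2} ≥ 1. -/
lemma norm_log_le {w : ℂ} {s : ℝ} (hs : 0 < s) (hs1 : s ≤ 1) (h1 : s ≤ ‖w‖) (h2 : ‖w‖ ≤ 2) :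
    ‖Complex.log w‖ ≤ (2 + π) * s ^ (-(1 / 2) : ℝ) := by
  have hone : 1 ≤ s ^ (-(1 / 2) : ℝ) := one_le_rpow_of_pos_of_le_one_of_nonpos hs hs1 (by norm_num)
  have e1 : |Real.log ‖w‖| ≤ 2 * s ^ (-(1 / 2) : ℝ) := by
    rw [abs_le]
    constructor
    · have h3 : Real.log s ≤ Real.log ‖w‖ := Real.log_le_log hs h1
      have h4 := Real.log_le_self (rpow_nonneg hs.le (-(1 / 2) : ℝ))
      rw [Real.log_rpow hs] at h4
      linarith
    · have h3 := Real.log_le_log (hs.trans_le h1) h2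
      have := Real.log_two_lt_d9
      linarith
  have e2 : ‖Complex.log w‖ ≤ |Real.log ‖w‖| + |w.arg| := by
    have := Complex.norm_le_abs_re_add_abs_im (Complex.log w)
    rwa [Complex.log_re, Complex.log_im] at this
  have e3 := Complex.abs_arg_le_pi w
  have := pi_pos
  nlinarith

/-- |1 + re^{iθ}|² = sin²θ + (r + cos θ)², whence a bound free of r. -/
lemma abs_sin_le_norm_one_add (r θ : ℝ) : |sin θ| ≤ ‖1 + circleMap 0 r θ‖ := by
  rw [← sqrt_sq_eq_abs, Complex.norm_def]
  refine Real.sqrt_le_sqrt ?_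
  have hre : (1 + circleMap 0 r θ).re = 1 + r * cos θ := by
    simp [circleMap_zero, Complex.exp_ofReal_mul_I_re]
  have him : (1 + circleMap 0 r θ).im = r * sin θ := by
    simp [circleMap_zero, Complex.exp_ofReal_mul_I_im]
  rw [Complex.normSq_apply, hre, him]
  nlinarith [sin_sq_add_cos_sq θ, sq_nonneg (r + cos θ)]

lemma norm_stripLog_le {r : ℝ} (h0 : 0 ≤ r) (h1 : r < 1) {θ : ℝ} (hθ : sin θ ≠ 0) :
    ‖stripLog (circleMap 0 r θ)‖ ≤ 2 * (2 + π) * |sin θ| ^ (-(1 / 2) : ℝ) := by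
  have hs : 0 < |sin θ| := abs_pos.2 hθ
  have hs1 : |sin θ| ≤ 1 := abs_sin_le_one θ
  have hn : ‖circleMap 0 r θ‖ ≤ 1 := by simp [abs_of_nonneg h0, h1.le]
  have e1 := norm_log_le (w := 1 + circleMap 0 r θ) hs hs1 (abs_sin_le_norm_one_add r θ)
    ((norm_add_le _ _).trans (by rw [norm_one]; linarith))
  have e2 := norm_log_le (w := 1 - circleMap 0 r θ) hs hs1
    (by
      have := abs_sin_le_norm_one_add (-r) θ
      rwa [show circleMap 0 (-r) θ = - circleMap 0 r θ by simp [circleMap_zero],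
        ← sub_eq_add_neg] at this)
    ((norm_sub_le _ _).trans (by rw [norm_one]; linarith))
  unfold stripLog
  refine (norm_sub_le _ _).trans ?_
  linarith

lemma one_add_exp_mul_I (θ : ℝ) : 1 + Complex.exp (θ * Complex.I) =
    ((2 * cos (θ / 2) : ℝ) : ℂ) * Complex.exp ((θ / 2 : ℝ) * Complex.I) := by
  have h : Complex.exp (θ * Complex.I) = Complex.exp ((θ / 2 : ℝ) * Complex.I) ^ 2 := by
    rw [← Complex.exp_nat_mul]; congr 1; push_cast; ring
  have h1 : Complex.exp ((θ / 2 : ℝ) * Complex.I) * Complex.exp (-((θ / 2 : ℝ) * Complex.I)) = 1 := by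
    rw [← Complex.exp_add]; simp
  rw [h]
  push_cast [Complex.cos, neg_mul]
  push_cast at h1
  linear_combination -h1

lemma one_sub_exp_mul_I (θ : ℝ) : 1 - Complex.exp (θ * Complex.I) =
    ((2 * sin (θ / 2) : ℝ) : ℂ) * Complex.exp ((θ / 2 - π / 2 : ℝ) * Complex.I) := by
  have h := one_add_exp_mul_I (θ - π)
  have e : Complex.exp ((θ - π : ℝ) * Complex.I) = - Complex.exp (θ * Complex.I) := by
    push_cast
    rw [sub_mul, Complex.exp_sub, Complex.exp_pi_mul_I, div_neg, div_one]
  rw [e, ← sub_eq_add_neg] at h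
  rw [h, sub_div, cos_sub_pi_div_two]

lemma log_boundary {ρ φ : ℝ} (hρ : 0 < ρ) (hφ : φ ∈ Ioc (-π) π) :
    Complex.log ((ρ : ℂ) * Complex.exp (φ * Complex.I)) = Real.log ρ + φ * Complex.I := by
  rw [Complex.log_ofReal_mul hρ (Complex.exp_ne_zero _), Complex.log_exp]
  · simpa using hφ.1
  · simpa using hφ.2

/-- By the half-angle forms, 1 + e^{iθ} has argument θ/2 and 1 - e^{iθ} has argument θ/2 - π/2;
their difference is the constant π/2. -/
lemma tendsto_stripLog_boundary {θ : ℝ} (hθ : θ ∈ Ioo 0 π) :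
    Tendsto (fun r : ℝ => stripLog (circleMap 0 r θ)) (𝓝[<] 1)
      (𝓝 ((Real.log ‖(1 + Complex.exp (Complex.I * θ)) / (1 - Complex.exp (Complex.I * θ))‖ : ℝ) +
        (π / 2 : ℝ) * Complex.I)) := by
  have hc : 0 < cos (θ / 2) := cos_pos_of_mem_Ioo ⟨by linarith [hθ.1, pi_pos], by linarith [hθ.2]⟩
  have hs : 0 < sin (θ / 2) := sin_pos_of_pos_of_lt_pi (by linarith [hθ.1])
    (by linarith [hθ.2, pi_pos])
  have hπ := pi_pos
  have e1 := one_add_exp_mul_I θ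
  have e2 := one_sub_exp_mul_I θ
  have hval : stripLog (circleMap 0 1 θ) =
      (Real.log ‖(1 + Complex.exp (Complex.I * θ)) / (1 - Complex.exp (Complex.I * θ))‖ : ℝ) +
        (π / 2 : ℝ) * Complex.I := by
    unfold stripLog
    rw [circleMap_zero, Complex.ofReal_one, one_mul, mul_comm Complex.I, e1, e2,
      log_boundary (by positivity) ⟨by linarith [hθ.1], by linarith [hθ.2]⟩,
      log_boundary (by positivity) ⟨by linarith [hθ.1], by linarith [hθ.2]⟩, norm_div, norm_mul,
      norm_mul, Complex.norm_exp_ofReal_mul_I, Complex.norm_exp_ofReal_mul_I, Complex.norm_real,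
      Complex.norm_real, mul_one, mul_one, Real.norm_of_nonneg (by positivity),
      Real.norm_of_nonneg (by positivity), Real.log_div (by positivity) (by positivity)]
    push_cast
    ring
  rw [← hval]
  have hcm : Continuous fun r : ℝ => circleMap 0 r θ := by
    simp only [circleMap_zero]; fun_prop
  have hcont : ContinuousAt (fun r : ℝ => stripLog (circleMap 0 r θ)) 1 := by
    unfold stripLog
    refine ContinuousAt.sub (ContinuousAt.clog ?_ ?_) (ContinuousAt.clog ?_ ?_)
    · exact (continuous_const.add hcm).continuousAt
    · rw [circleMap_zero, Complex.ofReal_one, one_mul]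
      refine Complex.mem_slitPlane_iff.2 (Or.inr ?_)
      simp [Complex.exp_ofReal_mul_I_im, (sin_pos_of_pos_of_lt_pi hθ.1 hθ.2).ne']
    · exact (continuous_const.sub hcm).continuousAt
    · rw [circleMap_zero, Complex.ofReal_one, one_mul]
      refine Complex.mem_slitPlane_iff.2 (Or.inr ?_)
      simp [Complex.exp_ofReal_mul_I_im, (sin_pos_of_pos_of_lt_pi hθ.1 hθ.2).ne']
  exact hcont.tendsto.mono_left nhdsWithin_le_nhds

/-- The logarithmic integral over the support equals an integral over the gap. -/
lemma integral_log_mul_sqrt (ha : a ∈ Icc (-1 : ℝ) 1) (hb : b ∈ Ioo (-1 : ℝ) 1)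
    (hab : 0 ≤ a + b) :
    IntervalIntegrable (fun θ : ℝ =>
      Real.log ‖(1 + Complex.exp (Complex.I * θ)) / (1 - Complex.exp (Complex.I * θ))‖ *
        √((cos θ + a) / (cos θ - b))) volume 0 π ∧
    ∫ θ in (0 : ℝ)..π,
      Real.log ‖(1 + Complex.exp (Complex.I * θ)) / (1 - Complex.exp (Complex.I * θ))‖ *
        √((cos θ + a) / (cos θ - b)) =
      π / 2 * ∫ θ in (0 : ℝ)..π, √(-((cos θ + a) / (cos θ - b))) := by
  have hb' := mem_Icc_of_mem_Ioo_neg hb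
  have hmv := integral_re_boundary (F := fun u => stripLog u * sqrtRatio a b u)
    (Fhat := fun θ => ((Real.log ‖(1 + Complex.exp (Complex.I * θ)) /
      (1 - Complex.exp (Complex.I * θ))‖ : ℝ) + (π / 2 : ℝ) * Complex.I) * sqrtRatioBoundary a b θ)
    (differentiableOn_stripLog.mul (differentiableOn_sqrtRatio ha hb' hab))
    (fun z hz => by simp only [map_mul]; rw [stripLog_conj hz, sqrtRatio_conj ha hb' hab hz])
    ((intervalIntegrable_sin_mul_cos_sub_rpow hb).const_mul (2 * (2 + π) * 3))
    (by
      filter_upwards [eventually_mem_Ioo_left_one] with r hr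
      filter_upwards [ae_cos_ne (c := b), ae_ne_real π] with θ h1 h2 hθ
      have hs : sin θ ≠ 0 := (sin_pos_of_pos_of_lt_pi hθ.1 (lt_of_le_of_ne hθ.2 h2)).ne'
      have hr0 : 0 ≤ r := by linarith [hr.1]
      rw [norm_mul]
      refine (mul_le_mul (norm_stripLog_le hr0 hr.2 hs)
        (norm_sqrtRatio_circleMap_le ha hb' hr0 hr.2 (h1 hθ)) (norm_nonneg _)
        (by positivity)).trans (le_of_eq (by ring)))
    (by
      filter_upwards [ae_tendsto_sqrtRatio ha hb hab, ae_ne_real π] with θ h1 h2 hθ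
      exact (tendsto_stripLog_boundary ⟨hθ.1, lt_of_le_of_ne hθ.2 h2⟩).mul (h1 hθ))
  obtain ⟨hi, hmv⟩ := hmv
  have hz : stripLog 0 = 0 := by simp [stripLog]
  have hre : ∀ θ : ℝ, (((Real.log ‖(1 + Complex.exp (Complex.I * θ)) /
      (1 - Complex.exp (Complex.I * θ))‖ : ℝ) + (π / 2 : ℝ) * Complex.I) *
        sqrtRatioBoundary a b θ).re =
      Real.log ‖(1 + Complex.exp (Complex.I * θ)) / (1 - Complex.exp (Complex.I * θ))‖ *
        √((cos θ + a) / (cos θ - b)) - π / 2 * √(-((cos θ + a) / (cos θ - b))) := by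
    intro θ
    rw [Complex.mul_re, sqrtRatioBoundary_re, sqrtRatioBoundary_im]
    simp
  have hi' := intervalIntegrable_re hi
  simp only [hre] at hmv hi'
  have hi2 := (intervalIntegrable_sqrt_neg ha hb hab).const_mul (π / 2)
  have hi1 := hi'.add hi2
  simp only [sub_add_cancel] at hi1
  refine ⟨hi1, ?_⟩
  -- `stripLog` vanishes at the centre, so the mean of the product is zero and the two terms of its
  -- real part balance.
  rw [hz, zero_mul, Complex.zero_re, mul_zero, intervalIntegral.integral_sub hi1 hi2,
    intervalIntegral.integral_const_mul] at hmv
  linarith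

end

/-! ### The kernel of the constant and its derivative kernel -/

section

/-- The analytic function `(√ratio - 1) / u`. -/
noncomputable def logKernel (a b : ℝ) (u : ℂ) : ℂ :=
  2 * (a + b) / (quad (-b) u * (1 + sqrtRatio a b u))

/-- `1 / √(quad a · quad (-b))`. -/
noncomputable def firstKernel (a b : ℝ) (u : ℂ) : ℂ := sqrtRatio a b u / quad a u

/-- The boundary values of `u * firstKernel a b u` on the upper half circle. -/
noncomputable def firstKernelBoundary (a b θ : ℝ) : ℂ :=
  sqrtRatioBoundary a b θ / ((2 * (cos θ + a) : ℝ) : ℂ)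

variable {a b : ℝ}

lemma one_le_norm_one_add_sqrtRatio (a b : ℝ) (u : ℂ) : 1 ≤ ‖1 + sqrtRatio a b u‖ := by
  have h1 := Complex.re_le_norm (1 + sqrtRatio a b u)
  have h2 := sqrtRatio_re_nonneg a b u
  rw [Complex.add_re, Complex.one_re] at h1
  linarith

lemma one_add_sqrtRatio_ne_zero (a b : ℝ) (u : ℂ) : 1 + sqrtRatio a b u ≠ 0 := by
  have := one_le_norm_one_add_sqrtRatio a b u
  exact norm_pos_iff.1 (by linarith)

/-- Rationalisation: (s - 1)(s + 1) = s² - 1 = 2(a + b)u / quad (-b). Writing the quotient (s - 1)/u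
this way removes the singularity at 0 and makes analyticity and bounds immediate. -/
lemma mul_logKernel (hb : -b ∈ Icc (-1 : ℝ) 1) {u : ℂ} (hu : u ∈ Metric.ball (0 : ℂ) 1) :
    u * logKernel a b u = sqrtRatio a b u - 1 := by
  have h1 := one_add_sqrtRatio_ne_zero a b u
  have h2 := quad_ne_zero hb hu
  have h3 := sqrtRatio_sq a b u
  rw [eq_div_iff h2] at h3
  unfold logKernel
  rw [mul_div_assoc', div_eq_iff (mul_ne_zero h2 h1)]
  have h4 : quad a u - quad (-b) u = 2 * (a + b) * u := by unfold quad; push_cast; ring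
  linear_combination -h3 - h4

lemma differentiableOn_logKernel (ha : a ∈ Icc (-1 : ℝ) 1) (hb : -b ∈ Icc (-1 : ℝ) 1)
    (hab : 0 ≤ a + b) : DifferentiableOn ℂ (logKernel a b) (Metric.ball 0 1) := by
  refine DifferentiableOn.div (differentiableOn_const _) ?_ fun u hu =>
    mul_ne_zero (quad_ne_zero hb hu) (one_add_sqrtRatio_ne_zero a b u)
  exact (differentiable_quad (-b)).differentiableOn.mul
    ((differentiableOn_const _).add (differentiableOn_sqrtRatio ha hb hab))

lemma differentiableOn_firstKernel (ha : a ∈ Icc (-1 : ℝ) 1) (hb : -b ∈ Icc (-1 : ℝ) 1)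
    (hab : 0 ≤ a + b) : DifferentiableOn ℂ (firstKernel a b) (Metric.ball 0 1) :=
  (differentiableOn_sqrtRatio ha hb hab).div (differentiable_quad a).differentiableOn
    fun _ hu => quad_ne_zero ha hu

lemma firstKernel_conj (ha : a ∈ Icc (-1 : ℝ) 1) (hb : -b ∈ Icc (-1 : ℝ) 1)
    (hab : 0 ≤ a + b) {u : ℂ} (hu : u ∈ Metric.ball (0 : ℂ) 1) :
    firstKernel a b ((starRingEnd ℂ) u) = (starRingEnd ℂ) (firstKernel a b u) := by
  unfold firstKernel
  rw [sqrtRatio_conj ha hb hab hu, quad_conj, map_div₀]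

/-- Since |1 + s| ≥ 1, only the zeros of `quad (-b)` matter. The bound does not degenerate when cos
θ + a vanishes, which gives continuity up to the ends of the range of T. -/
lemma norm_logKernel_le (hb : -b ∈ Icc (-1 : ℝ) 1) (hab : 0 ≤ a + b) {r : ℝ} (h0 : 0 ≤ r)
    (h1 : r < 1) {θ : ℝ} (hθ : cos θ ≠ b) :
    ‖logKernel a b (circleMap 0 r θ)‖ ≤ 4 * (a + b) / |cos θ - b| := by
  have hp : 0 < |cos θ - b| := abs_pos.2 (sub_ne_zero.2 hθ)
  have e2 : |cos θ - b| ≤ 2 * ‖quad (-b) (circleMap 0 r θ)‖ := by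
    have := abs_cos_add_le_norm_quad hb h0 h1.le θ
    rwa [← sub_eq_add_neg] at this
  have e3 := one_le_norm_one_add_sqrtRatio a b (circleMap 0 r θ)
  unfold logKernel
  rw [norm_div, norm_mul, norm_mul, ← Complex.ofReal_add, Complex.norm_real,
    Real.norm_of_nonneg hab, Complex.norm_ofNat,
    div_le_div_iff₀ (mul_pos (by linarith) (by linarith)) hp]
  have : |cos θ - b| ≤ 2 * (‖quad (-b) (circleMap 0 r θ)‖ *
      ‖1 + sqrtRatio a b (circleMap 0 r θ)‖) := by
    nlinarith [norm_nonneg (quad (-b) (circleMap 0 r θ))]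
  nlinarith

lemma intervalIntegrable_ray {h : ℂ → ℂ} (hh : DifferentiableOn ℂ h (Metric.ball 0 1)) {θ C : ℝ}
    (hC : ∀ t ∈ Ioo (0 : ℝ) 1, ‖h (circleMap 0 t θ)‖ ≤ C) :
    IntervalIntegrable (fun t : ℝ => Complex.exp (θ * Complex.I) * h (circleMap 0 t θ))
      volume 0 1 := by
  rw [intervalIntegrable_iff_integrableOn_Ioo_of_le zero_le_one]
  refine Integrable.mono' (g := fun _ => C) (integrable_const _) ?_ ?_
  · refine ContinuousOn.aestronglyMeasurable ?_ measurableSet_Ioo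
    refine continuousOn_const.mul (hh.continuousOn.comp (t := Metric.ball 0 1) ?_ ?_)
    · simp only [circleMap_zero]; fun_prop
    · intro t ht; exact circleMap_mem_unitBall ht.1.le ht.2 θ
  · rw [ae_restrict_iff' measurableSet_Ioo]
    refine Eventually.of_forall fun t ht => ?_
    rw [norm_mul, Complex.norm_exp_ofReal_mul_I, one_mul]
    exact hC t ht

lemma intervalIntegrable_ray_logKernel (ha : a ∈ Icc (-1 : ℝ) 1) (hb : -b ∈ Icc (-1 : ℝ) 1)
    (hab : 0 ≤ a + b) {θ : ℝ} (hθ : cos θ ≠ b) :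
    IntervalIntegrable
      (fun t : ℝ => Complex.exp (θ * Complex.I) * logKernel a b (circleMap 0 t θ)) volume 0 1 :=
  intervalIntegrable_ray (differentiableOn_logKernel ha hb hab)
    fun _ ht => norm_logKernel_le hb hab ht.1.le ht.2 hθ

lemma intervalIntegrable_ray_firstKernel (ha : a ∈ Icc (-1 : ℝ) 1) (hb : -b ∈ Icc (-1 : ℝ) 1)
    (hab : 0 ≤ a + b) {θ : ℝ} (hθ : cos θ ≠ b) (hθa : cos θ + a ≠ 0) :
    IntervalIntegrable
      (fun t : ℝ => Complex.exp (θ * Complex.I) * firstKernel a b (circleMap 0 t θ))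
      volume 0 1 :=
  intervalIntegrable_ray (differentiableOn_firstKernel ha hb hab)
    fun _ ht => norm_sqrtRatio_div_quad_le ha hb ht.1.le ht.2 hθ hθa

lemma cos_zero_ne (hb : b ∈ Ioo (-1 : ℝ) 1) : cos 0 ≠ b := by
  rw [cos_zero]; exact hb.2.ne'

lemma cos_pi_ne (hb : b ∈ Ioo (-1 : ℝ) 1) : cos π ≠ b := by
  rw [cos_pi]; exact hb.1.ne

lemma cos_zero_add_ne (ha : a ∈ Ioo (-1 : ℝ) 1) : cos 0 + a ≠ 0 := by
  rw [cos_zero]; linarith [ha.1]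

lemma cos_pi_add_ne (ha : a ∈ Ioo (-1 : ℝ) 1) : cos π + a ≠ 0 := by
  rw [cos_pi]; linarith [ha.2]

/-- On the circle the tangential derivative of a primitive is iu times the kernel, here i(s - 1).
Its singularity at cos θ = b is integrable, so the path may pass from the inner arc into the gap. -/
lemma rayIntegral_logKernel (ha : a ∈ Icc (-1 : ℝ) 1) (hb : b ∈ Ioo (-1 : ℝ) 1)
    (hab : 0 ≤ a + b) {θ : ℝ} (hθ : θ ∈ Icc 0 π) (hθb : cos θ ≠ b) :
    rayIntegral (logKernel a b) θ = rayIntegral (logKernel a b) 0 +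
      ∫ α in (0 : ℝ)..θ, Complex.I * (sqrtRatioBoundary a b α - 1) := by
  have hb' := mem_Icc_of_mem_Ioo_neg hb
  refine rayIntegral_eq_add (D := fun θ => 3 * |cos θ - b| ^ (-(1 / 2) : ℝ) + 1)
    (differentiableOn_logKernel ha hb' hab)
    (intervalIntegrable_ray_logKernel ha hb' hab (cos_zero_ne hb))
    (((intervalIntegrable_cos_sub_rpow hb).const_mul 3).add intervalIntegrable_const) ?_ ?_ hθ
    (intervalIntegrable_ray_logKernel ha hb' hab hθb)
  · filter_upwards [ae_norm_sqrtRatio_le ha hb, eventually_mem_Ioo_left_one] with r h1 hr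
    filter_upwards [h1] with α h2 hα
    rw [mul_logKernel hb' (circleMap_mem_unitBall (by linarith [hr.1]) hr.2 α)]
    refine (norm_sub_le _ _).trans ?_
    rw [norm_one]
    linarith [h2 hα]
  · filter_upwards [ae_tendsto_sqrtRatio ha hb hab] with α h hα
    refine ((h hα).sub_const 1).congr' ?_
    filter_upwards [eventually_mem_Ioo_left_one] with r hr
    rw [mul_logKernel hb' (circleMap_mem_unitBall (by linarith [hr.1]) hr.2 α)]

section FirstKind

lemma ae_norm_mul_firstKernel_le (ha : a ∈ Ioo (-1 : ℝ) 1) (hb : b ∈ Ioo (-1 : ℝ) 1) :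
    ∀ᶠ r in 𝓝[<] (1 : ℝ), ∀ᵐ θ : ℝ, θ ∈ Ioc 0 π →
      ‖circleMap 0 r θ * firstKernel a b (circleMap 0 r θ)‖ ≤
        2 * (|cos θ - b| ^ (-(1 / 2) : ℝ) * |cos θ + a| ^ (-(1 / 2) : ℝ)) := by
  filter_upwards [eventually_mem_Ioo_left_one] with r hr
  have hr0 : 0 ≤ r := by linarith [hr.1]
  filter_upwards [ae_cos_ne (c := b), ae_cos_ne (c := -a)] with θ h1 h2 hθ
  have h3 := norm_sqrtRatio_div_quad_le (Ioo_subset_Icc_self ha) (mem_Icc_of_mem_Ioo_neg hb) hr0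
    hr.2 (h1 hθ) (fun h => h2 hθ (by linarith))
  rw [norm_mul]
  have hn : ‖circleMap 0 r θ‖ ≤ 1 := by simp [abs_of_nonneg hr0, hr.2.le]
  exact (mul_le_of_le_one_left (norm_nonneg _) hn).trans h3

lemma ae_tendsto_mul_firstKernel (ha : a ∈ Ioo (-1 : ℝ) 1) (hb : b ∈ Ioo (-1 : ℝ) 1)
    (hab : 0 ≤ a + b) : ∀ᵐ θ : ℝ, θ ∈ Ioc 0 π →
      Tendsto (fun r => circleMap 0 r θ * firstKernel a b (circleMap 0 r θ)) (𝓝[<] 1)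
        (𝓝 (firstKernelBoundary a b θ)) := by
  filter_upwards [ae_tendsto_sqrtRatio (Ioo_subset_Icc_self ha) hb hab,
    ae_cos_ne (c := -a)] with θ h1 h2 hθ
  have hne : cos θ + a ≠ 0 := fun h => h2 hθ (by linarith)
  have hcm : Continuous fun r : ℝ => circleMap 0 r θ := by
    simp only [circleMap_zero]; fun_prop
  have hq : Tendsto (fun r : ℝ => quad a (circleMap 0 r θ)) (𝓝[<] 1)
      (𝓝 (quad a (circleMap 0 1 θ))) :=
    (((differentiable_quad a).continuous.comp hcm).tendsto 1).mono_left nhdsWithin_le_nhds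
  have hc := (hcm.tendsto 1).mono_left (nhdsWithin_le_nhds (s := Iio 1))
  have hone : circleMap 0 1 θ = Complex.exp (θ * Complex.I) := by simp [circleMap_zero]
  have hexp := Complex.exp_ne_zero (θ * Complex.I)
  have hr : ((cos θ + a : ℝ) : ℂ) ≠ 0 := Complex.ofReal_ne_zero.2 hne
  have hval : firstKernelBoundary a b θ =
      circleMap 0 1 θ * (sqrtRatioBoundary a b θ / quad a (circleMap 0 1 θ)) := by
    unfold firstKernelBoundary
    rw [hone, quad_exp, Complex.ofReal_mul, Complex.ofReal_ofNat]
    field_simp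
  rw [hval]
  refine hc.mul ((h1 hθ).div hq ?_)
  rw [hone, quad_exp]
  exact mul_ne_zero (mul_ne_zero two_ne_zero hexp) hr

lemma intervalIntegrable_firstKernelBoundary (ha : a ∈ Ioo (-1 : ℝ) 1)
    (hb : b ∈ Ioo (-1 : ℝ) 1) (hab : 0 < a + b) :
    IntervalIntegrable (firstKernelBoundary a b) volume 0 π := by
  refine (intervalIntegrable_of_dominated_limit pi_pos.le ?_
    ((intervalIntegrable_cos_sub_mul_cos_add_rpow ha hb hab).const_mul 2)
    (ae_norm_mul_firstKernel_le ha hb) (ae_tendsto_mul_firstKernel ha hb hab.le)).1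
  filter_upwards [eventually_mem_Ioo_left_one] with r hr
  exact (continuous_circleMap 0 r).mul (continuous_comp_circleMap
    (differentiableOn_firstKernel (Ioo_subset_Icc_self ha) (mem_Icc_of_mem_Ioo_neg hb) hab.le)
    (by linarith [hr.1]) hr.2)

/-- The boundary values of the primitive of `firstKernel`. -/
noncomputable def firstPrimitiveBoundary (a b θ : ℝ) : ℂ :=
  rayIntegral (firstKernel a b) 0 + ∫ α in (0 : ℝ)..θ, Complex.I * firstKernelBoundary a b α

lemma rayIntegral_firstKernel (ha : a ∈ Ioo (-1 : ℝ) 1) (hb : b ∈ Ioo (-1 : ℝ) 1)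
    (hab : 0 < a + b) {θ : ℝ} (hθ : θ ∈ Icc 0 π) (hθb : cos θ ≠ b) (hθa : cos θ + a ≠ 0) :
    rayIntegral (firstKernel a b) θ = firstPrimitiveBoundary a b θ := by
  have ha' := Ioo_subset_Icc_self ha
  have hb' := mem_Icc_of_mem_Ioo_neg hb
  exact rayIntegral_eq_add (differentiableOn_firstKernel ha' hb' hab.le)
    (intervalIntegrable_ray_firstKernel ha' hb' hab.le (cos_zero_ne hb) (cos_zero_add_ne ha))
    ((intervalIntegrable_cos_sub_mul_cos_add_rpow ha hb hab).const_mul 2)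
    (ae_norm_mul_firstKernel_le ha hb) (ae_tendsto_mul_firstKernel ha hb hab.le) hθ
    (intervalIntegrable_ray_firstKernel ha' hb' hab.le hθb hθa)

/-- Mean value property for H · `sqrtRatio`, where H is the primitive of `firstKernel` vanishing at
0. This single identity is the source of the bilinear relation. -/
lemma integral_re_firstPrimitive_mul (ha : a ∈ Ioo (-1 : ℝ) 1) (hb : b ∈ Ioo (-1 : ℝ) 1)
    (hab : 0 < a + b) :
    IntervalIntegrable (fun θ => firstPrimitiveBoundary a b θ * sqrtRatioBoundary a b θ)
      volume 0 π ∧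
    ∫ θ in (0 : ℝ)..π, (firstPrimitiveBoundary a b θ * sqrtRatioBoundary a b θ).re = 0 := by
  have ha' := Ioo_subset_Icc_self ha
  have hb' := mem_Icc_of_mem_Ioo_neg hb
  have hh := differentiableOn_firstKernel ha' hb' hab.le
  have h0 := intervalIntegrable_ray_firstKernel ha' hb' hab.le (cos_zero_ne hb)
    (cos_zero_add_ne ha)
  have hD := (intervalIntegrable_cos_sub_mul_cos_add_rpow ha hb hab).const_mul 2
  have hbd := ae_norm_mul_firstKernel_le ha hb
  have hlim := ae_tendsto_mul_firstKernel ha hb hab.le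
  obtain ⟨H1, hH1⟩ := hh.isExactOn_ball
  -- The normalisation H(0) = 0 makes the mean zero and gives H the conjugation symmetry.
  set H := fun z => H1 z - H1 0 with hHdef
  have hH : ∀ z ∈ Metric.ball (0 : ℂ) 1, HasDerivAt H (firstKernel a b z) z :=
    fun z hz => (hH1 z hz).sub_const _
  have hH0 : H 0 = 0 := sub_self _
  obtain ⟨M, hM⟩ := exists_bound_primitive_boundary hh hH h0 hD hbd
  have := integral_re_boundary (F := fun u => H u * sqrtRatio a b u)
    (Fhat := fun θ => firstPrimitiveBoundary a b θ * sqrtRatioBoundary a b θ)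
    (DifferentiableOn.mul (fun z hz => (hH z hz).differentiableAt.differentiableWithinAt)
      (differentiableOn_sqrtRatio ha' hb' hab.le))
    (fun z hz => by
      simp only [map_mul]
      rw [primitive_conj hh hH hH0 (fun z hz => firstKernel_conj ha' hb' hab.le hz) z hz,
        sqrtRatio_conj ha' hb' hab.le hz])
    ((intervalIntegrable_cos_sub_rpow hb).const_mul (M * 3))
    (by
      filter_upwards [hM, ae_norm_sqrtRatio_le ha' hb] with r h1 h2
      filter_upwards [h2] with θ h3 hθ
      rw [norm_mul, mul_assoc]
      have h4 := h1 θ (Ioc_subset_Icc_self hθ)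
      exact mul_le_mul h4 (h3 hθ) (norm_nonneg _) ((norm_nonneg _).trans h4))
    (by
      filter_upwards [ae_tendsto_sqrtRatio ha' hb hab.le] with θ h1 hθ
      have h2 := tendsto_primitive_boundary hh hH h0 hD hbd hlim (Ioc_subset_Icc_self hθ)
      rw [hH0, zero_add] at h2
      exact h2.mul (h1 hθ))
  refine ⟨this.1, ?_⟩
  rw [this.2, hH0, zero_mul, Complex.zero_re, mul_zero]

end FirstKind

end

/-! ### Constancy on the arcs and the bilinear relation -/

section

section Signs

variable {L T : ℝ}

lemma cos_mem_Ioo {x : ℝ} (h0 : 0 < x) (h1 : x < π) : cos x ∈ Ioo (-1 : ℝ) 1 := by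
  constructor
  · rw [← cos_pi]; exact cos_lt_cos_of_nonneg_of_le_pi h0.le le_rfl h1
  · rw [← cos_zero]; exact cos_lt_cos_of_nonneg_of_le_pi le_rfl h1.le h0

lemma cos_mem_Icc (x : ℝ) : cos x ∈ Icc (-1 : ℝ) 1 := ⟨neg_one_le_cos x, cos_le_one x⟩

lemma cos_add_cos_nonneg (hL : 0 < L) (hT : T ∈ Icc 0 (π - L)) : 0 ≤ cos T + cos L := by
  have := cos_le_cos_of_nonneg_of_le_pi hT.1 (by linarith) hT.2
  rw [cos_pi_sub] at this
  linarith

lemma cos_add_cos_pos (hL : 0 < L) (hT : T ∈ Ioo 0 (π - L)) : 0 < cos T + cos L := by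
  have := cos_lt_cos_of_nonneg_of_le_pi hT.1.le (by linarith) hT.2
  rw [cos_pi_sub] at this
  linarith

lemma ratio_nonneg_inner (hL : 0 < L) (hT : T ∈ Icc 0 (π - L)) {θ : ℝ}
    (hθ : θ ∈ Icc 0 L) : 0 ≤ (cos θ + cos T) / (cos θ - cos L) := by
  have h1 := cos_le_cos_of_nonneg_of_le_pi hθ.1 (by linarith [hT.1, hT.2]) hθ.2
  have h2 := cos_add_cos_nonneg hL hT
  exact div_nonneg (by linarith) (by linarith)

lemma ratio_nonpos_gap (hL : 0 < L) (hT : T ∈ Icc 0 (π - L)) {θ : ℝ}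
    (hθ : θ ∈ Icc L (π - T)) : (cos θ + cos T) / (cos θ - cos L) ≤ 0 := by
  have h1 := cos_le_cos_of_nonneg_of_le_pi hL.le (by linarith [hT.1, hθ.2]) hθ.1
  have h2 := cos_le_cos_of_nonneg_of_le_pi (by linarith [hθ.1]) (by linarith [hT.1]) hθ.2
  rw [cos_pi_sub] at h2
  exact div_nonpos_of_nonneg_of_nonpos (by linarith) (by linarith)

lemma ratio_nonneg_outer (hL : 0 < L) (hT : T ∈ Icc 0 (π - L)) {θ : ℝ}
    (hθ : θ ∈ Icc (π - T) π) : 0 ≤ (cos θ + cos T) / (cos θ - cos L) := by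
  have h2 := cos_le_cos_of_nonneg_of_le_pi (by linarith [hT.2]) hθ.2 hθ.1
  rw [cos_pi_sub] at h2
  have h3 := cos_add_cos_nonneg hL hT
  exact div_nonneg_of_nonpos (by linarith) (by linarith)

lemma edgeRatio_eq_zero_of_mem_gap (hL : 0 < L) (hT : T ∈ Icc 0 (π - L)) {θ : ℝ}
    (hθ : θ ∈ Icc L (π - T)) : √((cos θ + cos T) / (cos θ - cos L)) = 0 :=
  Real.sqrt_eq_zero_of_nonpos (ratio_nonpos_gap hL hT hθ)

lemma sqrt_neg_eq_zero {x : ℝ} (h : 0 ≤ x) : √(-x) = 0 :=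
  Real.sqrt_eq_zero_of_nonpos (by linarith)

end Signs

lemma I_mul_firstKernelBoundary_re (a b θ : ℝ) :
    (Complex.I * firstKernelBoundary a b θ).re =
      -(√(-((cos θ + a) / (cos θ - b))) / (2 * (cos θ + a))) := by
  rw [firstKernelBoundary, Complex.mul_re, Complex.div_ofReal_im, sqrtRatioBoundary_im]
  simp

lemma I_mul_firstKernelBoundary_im (a b θ : ℝ) :
    (Complex.I * firstKernelBoundary a b θ).im =
      √((cos θ + a) / (cos θ - b)) / (2 * (cos θ + a)) := by
  rw [firstKernelBoundary, Complex.mul_im, Complex.div_ofReal_re, sqrtRatioBoundary_re]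
  simp

lemma uIcc_subset_zero_pi {c d : ℝ} (hc : c ∈ Icc 0 π) (hd : d ∈ Icc 0 π) :
    uIcc c d ⊆ uIcc 0 π := by
  rw [uIcc_of_le pi_pos.le]
  exact uIcc_subset_Icc hc hd

section Increments

variable {a b : ℝ}

lemma firstPrimitiveBoundary_sub (ha : a ∈ Ioo (-1 : ℝ) 1) (hb : b ∈ Ioo (-1 : ℝ) 1)
    (hab : 0 < a + b) {c d : ℝ} (hc : c ∈ Icc 0 π) (hd : d ∈ Icc 0 π) :
    IntervalIntegrable (fun α => Complex.I * firstKernelBoundary a b α) volume c d ∧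
    firstPrimitiveBoundary a b d - firstPrimitiveBoundary a b c =
      ∫ α in c..d, Complex.I * firstKernelBoundary a b α := by
  have hi := (intervalIntegrable_firstKernelBoundary ha hb hab).const_mul Complex.I
  have h0 : (0 : ℝ) ∈ Icc 0 π := ⟨le_rfl, pi_pos.le⟩
  refine ⟨hi.mono_set (uIcc_subset_zero_pi hc hd), ?_⟩
  unfold firstPrimitiveBoundary
  rw [add_sub_add_left_eq_sub]
  exact intervalIntegral.integral_interval_sub_left
    (hi.mono_set (uIcc_subset_zero_pi h0 hd)) (hi.mono_set (uIcc_subset_zero_pi h0 hc))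

/-- On the support the boundary kernel is real, so the tangential derivative, i times it, moves only
the imaginary part. -/
lemma firstPrimitiveBoundary_re_eq (ha : a ∈ Ioo (-1 : ℝ) 1) (hb : b ∈ Ioo (-1 : ℝ) 1)
    (hab : 0 < a + b) {c d : ℝ} (hc : c ∈ Icc 0 π) (hd : d ∈ Icc 0 π)
    (h : ∀ θ ∈ uIcc c d, 0 ≤ (cos θ + a) / (cos θ - b)) :
    (firstPrimitiveBoundary a b d).re = (firstPrimitiveBoundary a b c).re := by
  obtain ⟨hi, hs⟩ := firstPrimitiveBoundary_sub ha hb hab hc hd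
  have h1 := congrArg Complex.re hs
  rw [Complex.sub_re, show (∫ α in c..d, Complex.I * firstKernelBoundary a b α).re =
    ∫ α in c..d, (Complex.I * firstKernelBoundary a b α).re from
    (Complex.reCLM.intervalIntegral_comp_comm hi).symm] at h1
  rw [intervalIntegral.integral_congr (g := fun _ => (0 : ℝ)) fun θ hθ => by
    simp only [I_mul_firstKernelBoundary_re, sqrt_neg_eq_zero (h θ hθ), zero_div, neg_zero]] at h1
  rw [intervalIntegral.integral_zero] at h1
  linarith

/-- On the gap the boundary kernel is purely imaginary, so only the real part moves. -/
lemma firstPrimitiveBoundary_im_eq (ha : a ∈ Ioo (-1 : ℝ) 1) (hb : b ∈ Ioo (-1 : ℝ) 1)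
    (hab : 0 < a + b) {c d : ℝ} (hc : c ∈ Icc 0 π) (hd : d ∈ Icc 0 π)
    (h : ∀ θ ∈ uIcc c d, (cos θ + a) / (cos θ - b) ≤ 0) :
    (firstPrimitiveBoundary a b d).im = (firstPrimitiveBoundary a b c).im := by
  obtain ⟨hi, hs⟩ := firstPrimitiveBoundary_sub ha hb hab hc hd
  have h1 := congrArg Complex.im hs
  rw [Complex.sub_im, show (∫ α in c..d, Complex.I * firstKernelBoundary a b α).im =
    ∫ α in c..d, (Complex.I * firstKernelBoundary a b α).im from
    (Complex.imCLM.intervalIntegral_comp_comm hi).symm] at h1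
  rw [intervalIntegral.integral_congr (g := fun _ => (0 : ℝ)) fun θ hθ => by
    simp only [I_mul_firstKernelBoundary_im, Real.sqrt_eq_zero_of_nonpos (h θ hθ),
      zero_div]] at h1
  rw [intervalIntegral.integral_zero] at h1
  linarith

end Increments

lemma integral_split_three {f : ℝ → ℝ} {c d : ℝ} (hc : 0 ≤ c) (hcd : c ≤ d) (hd : d ≤ π)
    (hf : IntervalIntegrable f volume 0 π) : ∫ θ in (0 : ℝ)..π, f θ =
      (∫ θ in (0 : ℝ)..c, f θ) + (∫ θ in c..d, f θ) + ∫ θ in d..π, f θ := by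
  have h0 : (0 : ℝ) ∈ Icc 0 π := ⟨le_rfl, pi_pos.le⟩
  have hπ : π ∈ Icc 0 π := ⟨pi_pos.le, le_rfl⟩
  have hc' : c ∈ Icc 0 π := ⟨hc, hcd.trans hd⟩
  have hd' : d ∈ Icc 0 π := ⟨hc.trans hcd, hd⟩
  rw [intervalIntegral.integral_add_adjacent_intervals
    (hf.mono_set (uIcc_subset_zero_pi h0 hc')) (hf.mono_set (uIcc_subset_zero_pi hc' hd')),
    intervalIntegral.integral_add_adjacent_intervals
    (hf.mono_set (uIcc_subset_zero_pi h0 hd')) (hf.mono_set (uIcc_subset_zero_pi hd' hπ))]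

variable {L T : ℝ}

/-- The mass integral over the inner arc complements the one over the outer arc. -/
lemma integral_inner_add_outer (hL : 0 < L) (hLπ : L < π) (hT : T ∈ Icc 0 (π - L)) :
    (∫ θ in (0 : ℝ)..L, √((cos θ + cos T) / (cos θ - cos L))) +
      (∫ θ in (π - T)..π, √((cos θ + cos T) / (cos θ - cos L))) = π := by
  have hb := cos_mem_Ioo hL hLπ
  have hab := cos_add_cos_nonneg hL hT
  have h1 := (integral_sqrtRatioBoundary (cos_mem_Icc T) hb hab).2
  rw [integral_split_three hL.le (by linarith [hT.2] : L ≤ π - T) (by linarith [hT.1])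
    (intervalIntegrable_sqrt (cos_mem_Icc T) hb hab),
    intervalIntegral.integral_congr (a := L) (b := π - T) (g := fun _ => (0 : ℝ)) fun θ hθ => by
      rw [uIcc_of_le (by linarith [hT.2])] at hθ
      exact edgeRatio_eq_zero_of_mem_gap hL hT hθ] at h1
  simpa using h1

/-- The bilinear relation between the complete integrals of the first and third kind. -/
lemma bilinear_relation (hL : 0 < L) (hLπ : L < π) (hT : T ∈ Ioo 0 (π - L)) {θ₀ : ℝ}
    (hθ₀ : θ₀ ∈ Ioo L (π - T)) :
    (rayIntegral (firstKernel (cos T) (cos L)) 0).re *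
        (π - ∫ θ in (π - T)..π, √((cos θ + cos T) / (cos θ - cos L))) +
      (rayIntegral (firstKernel (cos T) (cos L)) π).re *
        (∫ θ in (π - T)..π, √((cos θ + cos T) / (cos θ - cos L))) -
      (rayIntegral (firstKernel (cos T) (cos L)) θ₀).im *
        (∫ θ in (0 : ℝ)..π, √(-((cos θ + cos T) / (cos θ - cos L)))) = 0 := by
  have hT' : T ∈ Icc 0 (π - L) := Ioo_subset_Icc_self hT
  have hb := cos_mem_Ioo hL hLπ
  have ha := cos_mem_Ioo hT.1 (by linarith [hT.2])
  have hab := cos_add_cos_pos hL hT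
  have hLT : L ≤ π - T := by linarith [hT.2]
  have hTπ : π - T ≤ π := by linarith [hT.1]
  have h0 : (0 : ℝ) ∈ Icc 0 π := ⟨le_rfl, pi_pos.le⟩
  have hπ : π ∈ Icc 0 π := ⟨pi_pos.le, le_rfl⟩
  have hθ₀' : θ₀ ∈ Icc 0 π := ⟨by linarith [hθ₀.1], by linarith [hθ₀.2]⟩
  have hcos1 : cos θ₀ ≠ cos L :=
    (cos_lt_cos_of_nonneg_of_le_pi hL.le hθ₀'.2 hθ₀.1).ne
  have hcos2 : cos θ₀ + cos T ≠ 0 := by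
    have := cos_lt_cos_of_nonneg_of_le_pi hθ₀'.1 hTπ hθ₀.2
    rw [cos_pi_sub] at this
    linarith
  rw [rayIntegral_firstKernel ha hb hab h0 (cos_zero_ne hb) (cos_zero_add_ne ha),
    rayIntegral_firstKernel ha hb hab hπ (cos_pi_ne hb) (cos_pi_add_ne ha),
    rayIntegral_firstKernel ha hb hab hθ₀' hcos1 hcos2]
  obtain ⟨hi, hint⟩ := integral_re_firstPrimitive_mul ha hb hab
  rw [integral_split_three hL.le hLT hTπ (intervalIntegrable_re hi)] at hint
  have hX := integral_split_three hL.le hLT hTπ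
    (intervalIntegrable_sqrt_neg (cos_mem_Icc T) hb hab.le)
  have hre : ∀ θ, (firstPrimitiveBoundary (cos T) (cos L) θ *
      sqrtRatioBoundary (cos T) (cos L) θ).re =
      (firstPrimitiveBoundary (cos T) (cos L) θ).re * √((cos θ + cos T) / (cos θ - cos L)) -
      (firstPrimitiveBoundary (cos T) (cos L) θ).im *
        √(-((cos θ + cos T) / (cos θ - cos L))) := by
    intro θ
    rw [Complex.mul_re, sqrtRatioBoundary_re, sqrtRatioBoundary_im]
  have hin : ∀ θ ∈ uIcc 0 L, 0 ≤ (cos θ + cos T) / (cos θ - cos L) := fun θ hθ => by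
    rw [uIcc_of_le hL.le] at hθ; exact ratio_nonneg_inner hL hT' hθ
  have hgap : ∀ θ ∈ uIcc L (π - T), (cos θ + cos T) / (cos θ - cos L) ≤ 0 := fun θ hθ => by
    rw [uIcc_of_le hLT] at hθ; exact ratio_nonpos_gap hL hT' hθ
  have hout : ∀ θ ∈ uIcc (π - T) π, 0 ≤ (cos θ + cos T) / (cos θ - cos L) := fun θ hθ => by
    rw [uIcc_of_le hTπ] at hθ; exact ratio_nonneg_outer hL hT' hθ
  have hL0 : L ∈ Icc 0 π := ⟨hL.le, hLπ.le⟩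
  have hT0 : π - T ∈ Icc 0 π := ⟨by linarith, hTπ⟩
  have sub : ∀ {c d θ : ℝ}, c ∈ Icc 0 π → d ∈ Icc 0 π → θ ∈ uIcc c d → θ ∈ Icc 0 π := by
    intro c d θ hc hd hθ
    have := uIcc_subset_zero_pi hc hd hθ
    rwa [uIcc_of_le pi_pos.le] at this
  -- On each of the three intervals only one of the two terms of the real part survives, and there
  -- the part of the primitive that multiplies it is constant.
  have I1 : (∫ θ in (0 : ℝ)..L, (firstPrimitiveBoundary (cos T) (cos L) θ *
      sqrtRatioBoundary (cos T) (cos L) θ).re) =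
      (firstPrimitiveBoundary (cos T) (cos L) 0).re *
        ∫ θ in (0 : ℝ)..L, √((cos θ + cos T) / (cos θ - cos L)) := by
    rw [← intervalIntegral.integral_const_mul]
    refine intervalIntegral.integral_congr fun θ hθ => ?_
    simp only [hre, sqrt_neg_eq_zero (hin θ hθ), mul_zero, sub_zero]
    rw [firstPrimitiveBoundary_re_eq ha hb hab h0 (sub h0 hL0 hθ)
      fun α hα => hin α (uIcc_subset_uIcc_left hθ hα)]
  have I2 : (∫ θ in L..(π - T), (firstPrimitiveBoundary (cos T) (cos L) θ *
      sqrtRatioBoundary (cos T) (cos L) θ).re) =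
      -((firstPrimitiveBoundary (cos T) (cos L) θ₀).im *
        ∫ θ in L..(π - T), √(-((cos θ + cos T) / (cos θ - cos L)))) := by
    rw [← intervalIntegral.integral_const_mul, ← intervalIntegral.integral_neg]
    refine intervalIntegral.integral_congr fun θ hθ => ?_
    simp only [hre, Real.sqrt_eq_zero_of_nonpos (hgap θ hθ), mul_zero, zero_sub]
    rw [firstPrimitiveBoundary_im_eq ha hb hab hθ₀' (sub hL0 hT0 hθ)
      fun α hα => hgap α (uIcc_subset_uIcc (by rw [uIcc_of_le hLT]; exact Ioo_subset_Icc_self hθ₀)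
        hθ hα)]
  have I3 : (∫ θ in (π - T)..π, (firstPrimitiveBoundary (cos T) (cos L) θ *
      sqrtRatioBoundary (cos T) (cos L) θ).re) =
      (firstPrimitiveBoundary (cos T) (cos L) π).re *
        ∫ θ in (π - T)..π, √((cos θ + cos T) / (cos θ - cos L)) := by
    rw [← intervalIntegral.integral_const_mul]
    refine intervalIntegral.integral_congr fun θ hθ => ?_
    simp only [hre, sqrt_neg_eq_zero (hout θ hθ), mul_zero, sub_zero]
    rw [firstPrimitiveBoundary_re_eq ha hb hab hπ (sub hT0 hπ hθ)
      fun α hα => hout α (uIcc_subset_uIcc right_mem_uIcc hθ hα)]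
  have J1 : (∫ θ in (0 : ℝ)..L, √(-((cos θ + cos T) / (cos θ - cos L)))) = 0 := by
    rw [intervalIntegral.integral_congr (g := fun _ => (0 : ℝ)) fun θ hθ => by
      simp only [sqrt_neg_eq_zero (hin θ hθ)], intervalIntegral.integral_zero]
  have J3 : (∫ θ in (π - T)..π, √(-((cos θ + cos T) / (cos θ - cos L)))) = 0 := by
    rw [intervalIntegral.integral_congr (g := fun _ => (0 : ℝ)) fun θ hθ => by
      simp only [sqrt_neg_eq_zero (hout θ hθ)], intervalIntegral.integral_zero]
  have hsum := integral_inner_add_outer hL hLπ hT'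
  rw [I1, I2, I3] at hint
  rw [J1, J3, zero_add, add_zero] at hX
  rw [hX]
  linear_combination hint - (firstPrimitiveBoundary (cos T) (cos L) 0).re * hsum

end

/-! ### Differentiation of the radial integrals in T -/

section

/-- Only the numerator depends on T, with derivative -2 sin T · u; dividing by twice the root leaves
u / √(quad a · quad (-b)), which is how `firstKernel` arises. -/
lemma hasDerivAt_sqrtRatio_cos {b T : ℝ} {u : ℂ} (hb : -b ∈ Icc (-1 : ℝ) 1)
    (hab : 0 ≤ cos T + b) (hu : u ∈ Metric.ball (0 : ℂ) 1) :
    HasDerivAt (fun s : ℝ => sqrtRatio (cos s) b u)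
      (-(sin T : ℂ) * (u * firstKernel (cos T) b u)) T := by
  have ha := cos_mem_Icc T
  have h1 : HasDerivAt (fun s : ℝ => quad (cos s) u / quad (-b) u)
      (2 * (-(sin T : ℝ) : ℂ) * u / quad (-b) u) T := by
    have hc : HasDerivAt (fun s : ℝ => ((cos s : ℝ) : ℂ)) ((-sin T : ℝ) : ℂ) T :=
      (hasDerivAt_cos T).ofReal_comp
    rw [Complex.ofReal_neg] at hc
    exact ((((hc.const_mul 2).mul_const u).const_add (u ^ 2)).add_const 1).div_const _
  have h2 : HasDerivAt (fun z : ℂ => z ^ (1 / 2 : ℂ))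
      ((1 / 2 : ℂ) * (quad (cos T) u / quad (-b) u) ^ ((1 / 2 : ℂ) - 1) * 1)
      (quad (cos T) u / quad (-b) u) :=
    (hasDerivAt_id _).cpow_const (quad_div_mem_slitPlane ha hb hu hab)
  have h3 := h2.comp T h1
  have hq1 := quad_ne_zero ha hu
  have hq2 := quad_ne_zero hb hu
  have hval : (1 / 2 : ℂ) * (quad (cos T) u / quad (-b) u) ^ ((1 / 2 : ℂ) - 1) * 1 *
      (2 * (-(sin T : ℝ) : ℂ) * u / quad (-b) u) =
      -(sin T : ℂ) * (u * firstKernel (cos T) b u) := by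
    rw [Complex.cpow_sub _ _ (div_ne_zero hq1 hq2), Complex.cpow_one, firstKernel, sqrtRatio]
    push_cast
    field_simp
  rw [hval] at h3
  exact h3

lemma hasDerivAt_logKernel_cos {b T : ℝ} {u : ℂ} (hb : -b ∈ Ioo (-1 : ℝ) 1)
    (hab : 0 ≤ cos T + b) (hu : u ∈ Metric.ball (0 : ℂ) 1) (hu0 : u ≠ 0) :
    HasDerivAt (fun s : ℝ => logKernel (cos s) b u)
      (-(sin T : ℂ) * firstKernel (cos T) b u) T := by
  have hb' := Ioo_subset_Icc_self hb
  have h1 := ((hasDerivAt_sqrtRatio_cos hb' hab hu).sub_const 1).div_const u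
  have hval : -(sin T : ℂ) * (u * firstKernel (cos T) b u) / u =
      -(sin T : ℂ) * firstKernel (cos T) b u := by field_simp
  rw [hval] at h1
  refine h1.congr_of_eventuallyEq (Eventually.of_forall fun s => ?_)
  simp only
  rw [eq_div_iff hu0, mul_comm, mul_logKernel hb' hu]

variable {L T : ℝ}

/-- The radial integrals of `logKernel` are differentiable in the endpoint parameter. -/
lemma hasDerivAt_rayIntegral_logKernel (hL : 0 < L) (hLπ : L < π) (hT : T ∈ Ioo 0 (π - L))
    {θ : ℝ} (hθ : cos θ ≠ cos L) (hθa : cos θ + cos T ≠ 0) :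
    HasDerivAt (fun s => rayIntegral (logKernel (cos s) (cos L)) θ)
      (-(sin T : ℂ) * rayIntegral (firstKernel (cos T) (cos L)) θ) T := by
  have hb := cos_mem_Ioo hL hLπ
  have hbn : -cos L ∈ Ioo (-1 : ℝ) 1 := ⟨by linarith [hb.2], by linarith [hb.1]⟩
  have hb' := Ioo_subset_Icc_self hbn
  have hδ : 0 < |cos θ + cos T| / 2 := half_pos (abs_pos.2 hθa)
  -- Near T the quantity |cos θ + cos s| stays above half its value at T, which yields a majorant
  -- independent of s and of the radius.
  set δ := |cos θ + cos T| / 2 with hδdef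
  have hs : Ioo 0 (π - L) ∩ {s | δ < |cos θ + cos s|} ∈ 𝓝 T := by
    refine inter_mem (Ioo_mem_nhds hT.1 hT.2) ?_
    refine (isOpen_lt continuous_const (by fun_prop)).mem_nhds ?_
    simp only [mem_ofPred_eq, hδdef]
    linarith
  have hint : ∀ s ∈ Ioo 0 (π - L), IntervalIntegrable
      (fun t : ℝ => Complex.exp (θ * Complex.I) * logKernel (cos s) (cos L) (circleMap 0 t θ))
      volume 0 1 := fun s hs => intervalIntegrable_ray_logKernel (cos_mem_Icc s) hb'
        (cos_add_cos_pos hL hs).le hθ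
  have hder := intervalIntegral.hasDerivAt_integral_of_dominated_loc_of_deriv_le
    (μ := volume) (a := (0 : ℝ)) (b := 1) (x₀ := T) (𝕜 := ℝ)
    (F := fun s t => Complex.exp (θ * Complex.I) * logKernel (cos s) (cos L) (circleMap 0 t θ))
    (F' := fun s t => Complex.exp (θ * Complex.I) *
      (-(sin s : ℂ) * firstKernel (cos s) (cos L) (circleMap 0 t θ)))
    (bound := fun _ => 2 * (|cos θ - cos L| ^ (-(1 / 2) : ℝ) * δ ^ (-(1 / 2) : ℝ)))
    hs
    (by
      filter_upwards [Ioo_mem_nhds hT.1 hT.2] with s hs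
      rw [uIoc_of_le zero_le_one]
      exact (hint s hs).1.aestronglyMeasurable)
    (hint T hT)
    (by
      rw [uIoc_of_le zero_le_one]
      have := ((intervalIntegrable_ray_firstKernel (cos_mem_Icc T) hb'
        (cos_add_cos_pos hL hT).le hθ hθa).const_mul (-(sin T : ℂ))).1.aestronglyMeasurable
      refine this.congr (Eventually.of_forall fun t => ?_)
      simp only; ring)
    (by
      filter_upwards [ae_ne_real 1] with t ht1 ht s hs
      rw [uIoc_of_le zero_le_one] at ht
      have hlt : t < 1 := lt_of_le_of_ne ht.2 ht1
      rw [norm_mul, Complex.norm_exp_ofReal_mul_I, one_mul, norm_mul, norm_neg,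
        Complex.norm_real, Real.norm_eq_abs]
      have hpos : 0 < |cos θ + cos s| := hδ.trans hs.2
      have h1 := norm_sqrtRatio_div_quad_le (cos_mem_Icc s) hb' ht.1.le hlt hθ (abs_pos.1 hpos)
      have h2 := rpow_le_rpow_of_nonpos hδ (le_of_lt hs.2) (by norm_num : (-(1 / 2) : ℝ) ≤ 0)
      refine (mul_le_of_le_one_left (norm_nonneg _) (abs_sin_le_one s)).trans (h1.trans ?_)
      gcongr)
    intervalIntegrable_const
    (by
      filter_upwards [ae_ne_real 1] with t ht1 ht s hs
      rw [uIoc_of_le zero_le_one] at ht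
      have hlt : t < 1 := lt_of_le_of_ne ht.2 ht1
      refine (hasDerivAt_logKernel_cos hbn (cos_add_cos_pos hL hs.1).le
        (circleMap_mem_unitBall ht.1.le hlt θ) ?_).const_mul _
      simp [circleMap_zero, ht.1.ne'])
  have h := hder.2
  have hval : (∫ t in (0 : ℝ)..1, Complex.exp (θ * Complex.I) *
      (-(sin T : ℂ) * firstKernel (cos T) (cos L) (circleMap 0 t θ))) =
      -(sin T : ℂ) * rayIntegral (firstKernel (cos T) (cos L)) θ := by
    unfold rayIntegral
    rw [← intervalIntegral.integral_const_mul]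
    congr 1; ext t; ring
  rw [hval] at h
  exact h

lemma integral_congr_Ioo {E : Type*} [NormedAddCommGroup E] [NormedSpace ℝ E] {f g : ℝ → E}
    {c d : ℝ} (hcd : c ≤ d) (h : ∀ t ∈ Ioo c d, f t = g t) :
    ∫ t in c..d, f t = ∫ t in c..d, g t := by
  rw [intervalIntegral.integral_of_le hcd, intervalIntegral.integral_of_le hcd,
    integral_Ioc_eq_integral_Ioo, integral_Ioc_eq_integral_Ioo]
  exact setIntegral_congr_fun measurableSet_Ioo h

lemma logKernel_ofReal {a b x : ℝ} (ha : a ∈ Icc (-1 : ℝ) 1) (hb : -b ∈ Icc (-1 : ℝ) 1)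
    (hx : |x| < 1) (hx0 : x ≠ 0) : logKernel a b (x : ℂ) =
      ((1 / x * (√((x ^ 2 + 2 * a * x + 1) / (x ^ 2 + 2 * (-b) * x + 1)) - 1) : ℝ) : ℂ) := by
  have hm : (x : ℂ) ∈ Metric.ball (0 : ℂ) 1 := by simpa using hx
  have h := mul_logKernel (a := a) hb hm
  rw [sqrtRatio_ofReal ha hb hx] at h
  have hxc : (x : ℂ) ≠ 0 := Complex.ofReal_ne_zero.2 hx0
  rw [Complex.ofReal_mul, Complex.ofReal_sub, Complex.ofReal_one, ← h, Complex.ofReal_div,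
    Complex.ofReal_one]
  field_simp

/-! ### Constant, endpoint integral and mass as radial integrals -/

/-- The elliptic constant as a radial integral. -/
lemma rayIntegral_logKernel_zero (L T : ℝ) :
    rayIntegral (logKernel (cos T) (cos L)) 0 = (elConst L T : ℂ) := by
  unfold rayIntegral elConst
  rw [← intervalIntegral.integral_neg, ← intervalIntegral.integral_ofReal]
  refine integral_congr_Ioo zero_le_one fun t ht => ?_
  have h1 : circleMap 0 t 0 = (t : ℂ) := by simp [circleMap_zero]
  rw [h1, logKernel_ofReal (cos_mem_Icc T) ⟨by linarith [cos_le_one L], by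
    linarith [neg_one_le_cos L]⟩ (abs_lt.2 ⟨by linarith [ht.1], ht.2⟩) ht.1.ne']
  simp only [Complex.ofReal_zero, zero_mul, Complex.exp_zero, one_mul]
  congr 1
  rw [show t ^ 2 + 2 * cos T * t + 1 = t ^ 2 + 2 * t * cos T + 1 by ring,
    show t ^ 2 + 2 * (-cos L) * t + 1 = t ^ 2 - 2 * t * cos L + 1 by ring]
  ring

/-- The analogue of `elConst` for the radius ending at `-1`. -/
noncomputable def elConstNeg (L T : ℝ) : ℝ :=
  ∫ u in (0 : ℝ)..1, 1 / u *
    (√((u ^ 2 - 2 * u * cos T + 1) / (u ^ 2 + 2 * u * cos L + 1)) - 1)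

lemma rayIntegral_logKernel_pi (L T : ℝ) :
    rayIntegral (logKernel (cos T) (cos L)) π = (elConstNeg L T : ℂ) := by
  unfold rayIntegral elConstNeg
  rw [← intervalIntegral.integral_ofReal]
  refine integral_congr_Ioo zero_le_one fun t ht => ?_
  have h1 : circleMap 0 t π = ((-t : ℝ) : ℂ) := by
    simp [circleMap_zero]
  rw [h1, logKernel_ofReal (cos_mem_Icc T) ⟨by linarith [cos_le_one L], by
    linarith [neg_one_le_cos L]⟩ (abs_lt.2 ⟨by linarith [ht.2], by linarith [ht.1]⟩)
    (neg_ne_zero.2 ht.1.ne'), Complex.exp_pi_mul_I, neg_one_mul, ← Complex.ofReal_neg]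
  congr 1
  rw [show (-t) ^ 2 + 2 * cos T * (-t) + 1 = t ^ 2 - 2 * t * cos T + 1 by ring,
    show (-t) ^ 2 + 2 * (-cos L) * (-t) + 1 = t ^ 2 + 2 * t * cos L + 1 by ring, one_div_neg_eq_neg_one_div]
  ring

/-- Reflection of an integral at a point of symmetry. -/
lemma integral_reflect {φ : ℝ → ℝ} {p c : ℝ} (hsymm : ∀ θ, φ (2 * p - θ) = φ θ)
    (hφ : IntervalIntegrable φ volume p (p + c)) :
    IntervalIntegrable φ volume (p - c) p ∧
      ∫ θ in (p - c)..p, φ θ = ∫ θ in p..(p + c), φ θ := by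
  constructor
  · have := hφ.comp_sub_left (2 * p)
    simp only [hsymm] at this
    rw [show 2 * p - p = p by ring, show 2 * p - (p + c) = p - c by ring] at this
    exact this.symm
  · have := intervalIntegral.integral_comp_sub_left (a := p - c) (b := p) φ (2 * p)
    simp only [hsymm] at this
    rwa [show 2 * p - p = p by ring, show 2 * p - (p - c) = p + c by ring] at this

lemma edgeRatio_neg (L T θ : ℝ) : edgeRatio L T (-θ) = edgeRatio L T θ := by
  simp [edgeRatio]

lemma edgeRatio_two_pi_sub (L T θ : ℝ) : edgeRatio L T (2 * π - θ) = edgeRatio L T θ := by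
  simp [edgeRatio, cos_two_pi_sub]

lemma norm_cayley_neg (θ : ℝ) :
    ‖(1 + Complex.exp (Complex.I * ((-θ : ℝ) : ℂ))) /
      (1 - Complex.exp (Complex.I * ((-θ : ℝ) : ℂ)))‖ =
    ‖(1 + Complex.exp (Complex.I * θ)) / (1 - Complex.exp (Complex.I * θ))‖ := by
  rw [← Complex.norm_conj]
  congr 1
  simp [← Complex.exp_conj]

lemma norm_cayley_two_pi_sub (θ : ℝ) :
    ‖(1 + Complex.exp (Complex.I * ((2 * π - θ : ℝ) : ℂ))) /
      (1 - Complex.exp (Complex.I * ((2 * π - θ : ℝ) : ℂ)))‖ =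
    ‖(1 + Complex.exp (Complex.I * θ)) / (1 - Complex.exp (Complex.I * θ))‖ := by
  rw [← norm_cayley_neg θ]
  have : Complex.exp (Complex.I * ((2 * π - θ : ℝ) : ℂ)) =
      Complex.exp (Complex.I * ((-θ : ℝ) : ℂ)) := by
    rw [show Complex.I * ((2 * π - θ : ℝ) : ℂ) = Complex.I * ((-θ : ℝ) : ℂ) + 2 * π * Complex.I by
      push_cast; ring, Complex.exp_add, Complex.exp_two_pi_mul_I, mul_one]
  rw [this]

/-- The endpoint integral is an integral over the gap. -/
lemma endpointIntegral_eq_gap (hL : 0 < L) (hLπ : L < π) (hT : T ∈ Icc 0 (π - L)) :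
    endpointIntegral L T = ∫ θ in (0 : ℝ)..π, √(-((cos θ + cos T) / (cos θ - cos L))) := by
  have hb := cos_mem_Ioo hL hLπ
  have hab := cos_add_cos_nonneg hL hT
  obtain ⟨hi, hint⟩ := integral_log_mul_sqrt (cos_mem_Icc T) hb hab
  set f : ℝ → ℝ := fun θ =>
    Real.log ‖(1 + Complex.exp (Complex.I * θ)) / (1 - Complex.exp (Complex.I * θ))‖ *
      edgeRatio L T θ with hf
  change IntervalIntegrable f volume 0 π at hi
  change (∫ θ in (0 : ℝ)..π, f θ) = _ at hint
  have hLT : L ≤ π - T := by linarith [hT.2]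
  have hTπ : π - T ≤ π := by linarith [hT.1]
  have h0 : (0 : ℝ) ∈ Icc 0 π := ⟨le_rfl, pi_pos.le⟩
  have hπ : π ∈ Icc 0 π := ⟨pi_pos.le, le_rfl⟩
  have hL0 : L ∈ Icc 0 π := ⟨hL.le, hLπ.le⟩
  have hT0 : π - T ∈ Icc 0 π := ⟨by linarith, hTπ⟩
  have hneg : ∀ θ, f (2 * 0 - θ) = f θ := by
    intro θ
    rw [mul_zero, zero_sub]
    simp only [hf]
    rw [norm_cayley_neg, edgeRatio_neg]
  have hsub : ∀ θ, f (2 * π - θ) = f θ := by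
    intro θ
    simp only [hf]
    rw [norm_cayley_two_pi_sub, edgeRatio_two_pi_sub]
  have i1 : IntervalIntegrable f volume 0 (0 + L) := by
    rw [zero_add]; exact hi.mono_set (uIcc_subset_zero_pi h0 hL0)
  -- Reflection is used with the negative length -T, so that it carries the known interval [π - T,
  -- π] onto [π, π + T].
  have i2 : IntervalIntegrable f volume π (π + -T) := by
    rw [← sub_eq_add_neg]; exact hi.mono_set (uIcc_subset_zero_pi hπ hT0)
  obtain ⟨i3, e1⟩ := integral_reflect hneg i1
  obtain ⟨i4, e2⟩ := integral_reflect hsub i2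
  rw [zero_add] at i1 e1
  rw [zero_sub] at i3 e1
  rw [← sub_eq_add_neg] at i2 e2
  rw [sub_neg_eq_add] at i4 e2
  have hgap : ∫ θ in L..(π - T), f θ = 0 := by
    rw [intervalIntegral.integral_congr (g := fun _ => (0 : ℝ)) fun θ hθ => by
      rw [uIcc_of_le hLT] at hθ
      simp only [hf, edgeRatio, edgeRatio_eq_zero_of_mem_gap hL hT hθ, mul_zero],
      intervalIntegral.integral_zero]
  have hsplit := integral_split_three hL.le hLT hTπ hi
  unfold endpointIntegral
  -- The arcs meet at most in the point L, which happens when T = π - L.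
  have hunion : (∫ θ in Icc (-L) L ∪ Icc (π - T) (π + T), f θ) =
      (∫ θ in (-L)..L, f θ) + ∫ θ in (π - T)..(π + T), f θ := by
    rw [intervalIntegral.integral_of_le (by linarith), intervalIntegral.integral_of_le
      (by linarith [hT.1]), ← integral_Icc_eq_integral_Ioc, ← integral_Icc_eq_integral_Ioc]
    refine setIntegral_union₀ ?_ measurableSet_Icc.nullMeasurableSet ?_ ?_
    · refine measure_mono_null (t := {L}) ?_ (by simp)
      rintro x ⟨⟨_, hx1⟩, ⟨hx2, _⟩⟩
      exact le_antisymm hx1 (hLT.trans hx2)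
    · rw [← intervalIntegrable_iff_integrableOn_Icc_of_le (by linarith)]
      exact i3.trans i1
    · rw [← intervalIntegrable_iff_integrableOn_Icc_of_le (by linarith [hT.1])]
      exact i2.symm.trans i4.symm
  have e3 : (∫ θ in (-L)..L, f θ) = 2 * ∫ θ in (0 : ℝ)..L, f θ := by
    rw [← intervalIntegral.integral_add_adjacent_intervals i3 i1, e1]; ring
  have e4 : (∫ θ in (π - T)..(π + T), f θ) = 2 * ∫ θ in (π - T)..π, f θ := by
    rw [← intervalIntegral.integral_add_adjacent_intervals i2.symm i4.symm,
      intervalIntegral.integral_symm (π + T) π, e2, intervalIntegral.integral_symm π (π - T)]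
    ring
  rw [hunion, e3, e4]
  rw [hsplit, hgap] at hint
  have hπ0 := pi_ne_zero
  field_simp
  linarith

/-- The mass of the outer arc, by symmetry. -/
lemma arcMass_eq (hL : 0 < L) (hLπ : L < π) (hT : T ∈ Icc 0 (π - L)) :
    arcMass L T = (1 / π) * ∫ θ in (π - T)..π, √((cos θ + cos T) / (cos θ - cos L)) := by
  have hb := cos_mem_Ioo hL hLπ
  have hab := cos_add_cos_nonneg hL hT
  have hi : IntervalIntegrable (edgeRatio L T) volume 0 π :=
    intervalIntegrable_sqrt (cos_mem_Icc T) hb hab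
  have hLT : L ≤ π - T := by linarith [hT.2]
  have hTπ : π - T ≤ π := by linarith [hT.1]
  have hπ : π ∈ Icc 0 π := ⟨pi_pos.le, le_rfl⟩
  have hT0 : π - T ∈ Icc 0 π := ⟨by linarith, hTπ⟩
  have i2 : IntervalIntegrable (edgeRatio L T) volume π (π + -T) := by
    rw [← sub_eq_add_neg]; exact hi.mono_set (uIcc_subset_zero_pi hπ hT0)
  obtain ⟨i4, e2⟩ := integral_reflect (edgeRatio_two_pi_sub L T) i2
  rw [← sub_eq_add_neg] at i2 e2
  rw [sub_neg_eq_add] at i4 e2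
  unfold arcMass
  rw [← intervalIntegral.integral_add_adjacent_intervals i2.symm i4.symm,
      intervalIntegral.integral_symm (π + T) π, e2, intervalIntegral.integral_symm (π - T) π]
  change _ = (1 / π) * ∫ θ in (π - T)..π, edgeRatio L T θ
  have hπ0 := pi_ne_zero
  field_simp
  ring

lemma I_mul_sub_one_re (a b θ : ℝ) : (Complex.I * (sqrtRatioBoundary a b θ - 1)).re =
    -√(-((cos θ + a) / (cos θ - b))) := by
  rw [Complex.mul_re, Complex.sub_im, sqrtRatioBoundary_im]
  simp

lemma I_mul_sub_one_im (a b θ : ℝ) : (Complex.I * (sqrtRatioBoundary a b θ - 1)).im =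
    √((cos θ + a) / (cos θ - b)) - 1 := by
  rw [Complex.mul_im, Complex.sub_re, sqrtRatioBoundary_re]
  simp

lemma intervalIntegrable_I_mul_sub_one (hL : 0 < L) (hLπ : L < π) (hT : T ∈ Icc 0 (π - L)) :
    IntervalIntegrable (fun α => Complex.I * (sqrtRatioBoundary (cos T) (cos L) α - 1))
      volume 0 π :=
  ((integral_sqrtRatioBoundary (cos_mem_Icc T) (cos_mem_Ioo hL hLπ)
    (cos_add_cos_nonneg hL hT)).1.sub intervalIntegrable_const).const_mul _

/-- The endpoint integral as a difference of two regular integrals. -/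
lemma endpointIntegral_eq_sub (hL : 0 < L) (hLπ : L < π) (hT : T ∈ Icc 0 (π - L)) :
    endpointIntegral L T = elConst L T - elConstNeg L T := by
  have hb := cos_mem_Ioo hL hLπ
  have hi := intervalIntegrable_I_mul_sub_one hL hLπ hT
  have h := congrArg Complex.re (rayIntegral_logKernel (cos_mem_Icc T) hb
    (cos_add_cos_nonneg hL hT) ⟨pi_pos.le, le_rfl⟩ (cos_pi_ne hb))
  rw [rayIntegral_logKernel_pi, rayIntegral_logKernel_zero, Complex.add_re, Complex.ofReal_re,
    Complex.ofReal_re, show (∫ α in (0 : ℝ)..π,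
      Complex.I * (sqrtRatioBoundary (cos T) (cos L) α - 1)).re = ∫ α in (0 : ℝ)..π,
      (Complex.I * (sqrtRatioBoundary (cos T) (cos L) α - 1)).re from
    (Complex.reCLM.intervalIntegral_comp_comm hi).symm] at h
  simp only [I_mul_sub_one_re] at h
  rw [intervalIntegral.integral_neg] at h
  rw [endpointIntegral_eq_gap hL hLπ hT]
  linarith

/-- The mass of the outer arc through a radial integral ending in the gap. -/
lemma arcMass_eq_rayIntegral (hL : 0 < L) (hLπ : L < π) (hT : T ∈ Icc 0 (π - L)) {θ : ℝ}
    (hθ : θ ∈ Ioc L (π - T)) :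
    arcMass L T = 1 - ((rayIntegral (logKernel (cos T) (cos L)) θ).im + θ) / π := by
  have hb := cos_mem_Ioo hL hLπ
  have hab := cos_add_cos_nonneg hL hT
  have hθπ : θ ≤ π := by linarith [hθ.2, hT.1]
  have h0 : (0 : ℝ) ∈ Icc 0 π := ⟨le_rfl, pi_pos.le⟩
  have hL0 : L ∈ Icc 0 π := ⟨hL.le, hLπ.le⟩
  have hθ0 : θ ∈ Icc 0 π := ⟨by linarith [hθ.1], hθπ⟩
  have hi := (intervalIntegrable_I_mul_sub_one hL hLπ hT).mono_set (uIcc_subset_zero_pi h0 hθ0)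
  have h := congrArg Complex.im (rayIntegral_logKernel (cos_mem_Icc T) hb hab hθ0
    (cos_lt_cos_of_nonneg_of_le_pi hL.le hθπ hθ.1).ne)
  rw [rayIntegral_logKernel_zero, Complex.add_im, Complex.ofReal_im,
    show (∫ α in (0 : ℝ)..θ,
      Complex.I * (sqrtRatioBoundary (cos T) (cos L) α - 1)).im = ∫ α in (0 : ℝ)..θ,
      (Complex.I * (sqrtRatioBoundary (cos T) (cos L) α - 1)).im from
    (Complex.imCLM.intervalIntegral_comp_comm hi).symm] at h
  simp only [I_mul_sub_one_im] at h
  have hs := intervalIntegrable_sqrt (cos_mem_Icc T) hb hab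
  rw [intervalIntegral.integral_sub (hs.mono_set (uIcc_subset_zero_pi h0 hθ0))
    intervalIntegrable_const, ← intervalIntegral.integral_add_adjacent_intervals
      (hs.mono_set (uIcc_subset_zero_pi h0 hL0)) (hs.mono_set (uIcc_subset_zero_pi hL0 hθ0)),
    intervalIntegral.integral_congr (a := L) (b := θ) (g := fun _ => (0 : ℝ)) fun α hα => by
      rw [uIcc_of_le hθ.1.le] at hα
      exact edgeRatio_eq_zero_of_mem_gap hL hT ⟨hα.1, hα.2.trans hθ.2⟩] at h
  simp only [intervalIntegral.integral_zero, intervalIntegral.integral_const, smul_eq_mul] at h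
  have hsum := integral_inner_add_outer hL hLπ hT
  rw [arcMass_eq hL hLπ hT, h]
  have hπ0 := pi_ne_zero
  field_simp
  linarith

end

/-! ### Derivatives with respect to T -/

section

variable {L T : ℝ}

section Derivatives

lemma hasDerivAt_re_of_complex {f : ℝ → ℂ} {f' : ℂ} {x : ℝ} (h : HasDerivAt f f' x) :
    HasDerivAt (fun y => (f y).re) f'.re x := by
  exact Complex.reCLM.hasFDerivAt.comp_hasDerivAt x h

lemma hasDerivAt_im_of_complex {f : ℝ → ℂ} {f' : ℂ} {x : ℝ} (h : HasDerivAt f f' x) :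
    HasDerivAt (fun y => (f y).im) f'.im x := by
  exact Complex.imCLM.hasFDerivAt.comp_hasDerivAt x h

lemma hasDerivAt_elConst (hL : 0 < L) (hLπ : L < π) (hT : T ∈ Ioo 0 (π - L)) :
    HasDerivAt (elConst L) (-sin T * (rayIntegral (firstKernel (cos T) (cos L)) 0).re) T := by
  have ha := cos_mem_Ioo hT.1 (by linarith [hT.2])
  have h := hasDerivAt_re_of_complex (hasDerivAt_rayIntegral_logKernel hL hLπ hT
    (cos_zero_ne (cos_mem_Ioo hL hLπ)) (cos_zero_add_ne ha))
  simp only [rayIntegral_logKernel_zero, Complex.ofReal_re] at h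
  rwa [← Complex.ofReal_neg, Complex.re_ofReal_mul] at h

lemma hasDerivAt_elConstNeg (hL : 0 < L) (hLπ : L < π) (hT : T ∈ Ioo 0 (π - L)) :
    HasDerivAt (elConstNeg L)
      (-sin T * (rayIntegral (firstKernel (cos T) (cos L)) π).re) T := by
  have ha := cos_mem_Ioo hT.1 (by linarith [hT.2])
  have h := hasDerivAt_re_of_complex (hasDerivAt_rayIntegral_logKernel hL hLπ hT
    (cos_pi_ne (cos_mem_Ioo hL hLπ)) (cos_pi_add_ne ha))
  simp only [rayIntegral_logKernel_pi, Complex.ofReal_re] at h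
  rwa [← Complex.ofReal_neg, Complex.re_ofReal_mul] at h

lemma hasDerivAt_endpointIntegral (hL : 0 < L) (hLπ : L < π) (hT : T ∈ Ioo 0 (π - L)) :
    HasDerivAt (endpointIntegral L)
      (-sin T * ((rayIntegral (firstKernel (cos T) (cos L)) 0).re -
        (rayIntegral (firstKernel (cos T) (cos L)) π).re)) T := by
  have h := (hasDerivAt_elConst hL hLπ hT).sub (hasDerivAt_elConstNeg hL hLπ hT)
  rw [← mul_sub] at h
  refine h.congr_of_eventuallyEq ?_
  filter_upwards [Ioo_mem_nhds hT.1 hT.2] with s hs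
  exact endpointIntegral_eq_sub hL hLπ (Ioo_subset_Icc_self hs)

lemma cos_ne_of_mem_gap (hL : 0 < L) (hT : T ∈ Ioo 0 (π - L)) {θ : ℝ}
    (hθ : θ ∈ Ioo L (π - T)) : cos θ ≠ cos L ∧ cos θ + cos T ≠ 0 := by
  have h1 := cos_lt_cos_of_nonneg_of_le_pi hL.le (by linarith [hθ.2, hT.1] : θ ≤ π) hθ.1
  have h2 := cos_lt_cos_of_nonneg_of_le_pi (by linarith [hθ.1]) (by linarith [hT.1]) hθ.2
  rw [cos_pi_sub] at h2
  exact ⟨h1.ne, by linarith⟩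

/-- The angle θ is held fixed in the gap while T varies, so neither a moving limit of integration
nor a singular integrand has to be differentiated. Every θ in the gap serves, the imaginary part
being constant there. -/
lemma hasDerivAt_arcMass (hL : 0 < L) (hLπ : L < π) (hT : T ∈ Ioo 0 (π - L)) {θ : ℝ}
    (hθ : θ ∈ Ioo L (π - T)) :
    HasDerivAt (arcMass L)
      (sin T * (rayIntegral (firstKernel (cos T) (cos L)) θ).im / π) T := by
  obtain ⟨h1, h2⟩ := cos_ne_of_mem_gap hL hT hθ
  have h := hasDerivAt_im_of_complex (hasDerivAt_rayIntegral_logKernel hL hLπ hT h1 h2)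
  rw [← Complex.ofReal_neg, Complex.im_ofReal_mul] at h
  have h3 := ((h.add_const θ).div_const π).const_sub 1
  rw [show -(-sin T * (rayIntegral (firstKernel (cos T) (cos L)) θ).im / π) =
    sin T * (rayIntegral (firstKernel (cos T) (cos L)) θ).im / π by ring] at h3
  refine h3.congr_of_eventuallyEq ?_
  -- The fixed θ remains in the gap as long as s < π - θ.
  filter_upwards [Ioo_mem_nhds hT.1 (by linarith [hθ.2] : T < π - θ)] with s hs
  exact arcMass_eq_rayIntegral hL hLπ ⟨hs.1.le, by linarith [hs.2, hθ.1]⟩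
    ⟨hθ.1, by linarith [hs.2]⟩

lemma firstKernel_ofReal {a b x : ℝ} (ha : a ∈ Icc (-1 : ℝ) 1) (hb : -b ∈ Icc (-1 : ℝ) 1)
    (hx : |x| < 1) : firstKernel a b (x : ℂ) =
      ((√((x ^ 2 + 2 * a * x + 1) / (x ^ 2 + 2 * (-b) * x + 1)) /
        (x ^ 2 + 2 * a * x + 1) : ℝ) : ℂ) := by
  rw [firstKernel, sqrtRatio_ofReal ha hb hx, quad_ofReal, Complex.ofReal_div]

lemma firstKernel_ofReal_re_pos {a b x : ℝ} (ha : a ∈ Icc (-1 : ℝ) 1)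
    (hb : -b ∈ Icc (-1 : ℝ) 1) (hx : |x| < 1) : 0 < (firstKernel a b (x : ℂ)).re := by
  rw [firstKernel_ofReal ha hb hx, Complex.ofReal_re]
  have h1 := quad_real_pos ha hx
  have h2 := quad_real_pos hb hx
  positivity

lemma rayIntegral_firstKernel_zero_pos (hL : 0 < L) (hLπ : L < π) (hT : T ∈ Ioo 0 (π - L)) :
    0 < (rayIntegral (firstKernel (cos T) (cos L)) 0).re := by
  have ha := cos_mem_Ioo hT.1 (by linarith [hT.2])
  have hb := cos_mem_Ioo hL hLπ
  have hi := intervalIntegrable_ray_firstKernel (cos_mem_Icc T) (mem_Icc_of_mem_Ioo_neg hb)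
    (cos_add_cos_pos hL hT).le (cos_zero_ne hb) (cos_zero_add_ne ha)
  rw [rayIntegral, show (∫ t in (0 : ℝ)..1, Complex.exp ((0 : ℝ) * Complex.I) *
    firstKernel (cos T) (cos L) (circleMap 0 t 0)).re = ∫ t in (0 : ℝ)..1,
    (Complex.exp ((0 : ℝ) * Complex.I) * firstKernel (cos T) (cos L) (circleMap 0 t 0)).re from
    (Complex.reCLM.intervalIntegral_comp_comm hi).symm]
  refine intervalIntegral.intervalIntegral_pos_of_pos_on (intervalIntegrable_re hi) ?_ zero_lt_one
  intro t ht
  have h1 : circleMap 0 t 0 = (t : ℂ) := by simp [circleMap_zero]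
  rw [h1, Complex.ofReal_zero, zero_mul, Complex.exp_zero, one_mul]
  exact firstKernel_ofReal_re_pos (cos_mem_Icc T) (mem_Icc_of_mem_Ioo_neg hb)
    (abs_lt.2 ⟨by linarith [ht.1], ht.2⟩)

lemma rayIntegral_firstKernel_pi_neg (hL : 0 < L) (hLπ : L < π) (hT : T ∈ Ioo 0 (π - L)) :
    (rayIntegral (firstKernel (cos T) (cos L)) π).re < 0 := by
  have ha := cos_mem_Ioo hT.1 (by linarith [hT.2])
  have hb := cos_mem_Ioo hL hLπ
  have hi := intervalIntegrable_ray_firstKernel (cos_mem_Icc T) (mem_Icc_of_mem_Ioo_neg hb)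
    (cos_add_cos_pos hL hT).le (cos_pi_ne hb) (cos_pi_add_ne ha)
  rw [← neg_pos, rayIntegral, show (∫ t in (0 : ℝ)..1, Complex.exp (π * Complex.I) *
    firstKernel (cos T) (cos L) (circleMap 0 t π)).re = ∫ t in (0 : ℝ)..1,
    (Complex.exp (π * Complex.I) * firstKernel (cos T) (cos L) (circleMap 0 t π)).re from
    (Complex.reCLM.intervalIntegral_comp_comm hi).symm, ← intervalIntegral.integral_neg]
  refine intervalIntegral.intervalIntegral_pos_of_pos_on (intervalIntegrable_re hi).neg ?_
    zero_lt_one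
  intro t ht
  have h1 : circleMap 0 t π = ((-t : ℝ) : ℂ) := by simp [circleMap_zero]
  rw [h1, Complex.exp_pi_mul_I, neg_one_mul, Complex.neg_re, neg_neg]
  exact firstKernel_ofReal_re_pos (cos_mem_Icc T) (mem_Icc_of_mem_Ioo_neg hb)
    (abs_lt.2 ⟨by linarith [ht.2], by linarith [ht.1]⟩)

/-- In the endpoint parameter all three functions are differentiable, the endpoint integral with
negative derivative, and their derivatives satisfy a bilinear relation. -/
lemma exists_derivatives (hL : 0 < L) (hLπ : L < π) (hT : T ∈ Ioo 0 (π - L)) :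
    ∃ l' X' M' : ℝ, HasDerivAt (elConst L) l' T ∧ HasDerivAt (endpointIntegral L) X' T ∧
      HasDerivAt (arcMass L) M' T ∧ X' < 0 ∧
      l' + endpointIntegral L T * M' = arcMass L T * X' := by
  have hθ : (L + (π - T)) / 2 ∈ Ioo L (π - T) := by
    constructor <;> linarith [hT.1, hT.2]
  have hsin : 0 < sin T := sin_pos_of_pos_of_lt_pi hT.1 (by linarith [hT.2])
  refine ⟨_, _, _, hasDerivAt_elConst hL hLπ hT, hasDerivAt_endpointIntegral hL hLπ hT,
    hasDerivAt_arcMass hL hLπ hT hθ, ?_, ?_⟩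
  · have h1 := rayIntegral_firstKernel_zero_pos hL hLπ hT
    have h2 := rayIntegral_firstKernel_pi_neg hL hLπ hT
    nlinarith
  · have h := bilinear_relation hL hLπ hT hθ
    have hT' := Ioo_subset_Icc_self hT
    rw [endpointIntegral_eq_gap hL hLπ hT', arcMass_eq hL hLπ hT']
    have hπ0 := pi_ne_zero
    field_simp
    linear_combination - h

end Derivatives

/-! ### Continuity on the closed range of T -/

section Continuity

lemma continuousOn_rayIntegral_logKernel (hL : 0 < L) (hLπ : L < π) {θ : ℝ}
    (hθ : cos θ ≠ cos L) :
    ContinuousOn (fun s => rayIntegral (logKernel (cos s) (cos L)) θ) (Icc 0 (π - L)) := by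
  have hb := cos_mem_Ioo hL hLπ
  have hbn : -cos L ∈ Ioo (-1 : ℝ) 1 := ⟨by linarith [hb.2], by linarith [hb.1]⟩
  have hb' := Ioo_subset_Icc_self hbn
  have hp : 0 < |cos θ - cos L| := abs_pos.2 (sub_ne_zero.2 hθ)
  intro T hT
  refine intervalIntegral.continuousWithinAt_of_dominated_interval
    (bound := fun _ => 4 * 2 / |cos θ - cos L|) ?_ ?_ intervalIntegrable_const ?_
  · filter_upwards [self_mem_nhdsWithin] with s hs
    rw [uIoc_of_le zero_le_one]
    exact (intervalIntegrable_ray_logKernel (cos_mem_Icc s) hb' (cos_add_cos_nonneg hL hs)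
      hθ).1.aestronglyMeasurable
  · filter_upwards [self_mem_nhdsWithin] with s hs
    filter_upwards [ae_ne_real 1] with t ht1 ht
    rw [uIoc_of_le zero_le_one] at ht
    rw [norm_mul, Complex.norm_exp_ofReal_mul_I, one_mul]
    refine (norm_logKernel_le hb' (cos_add_cos_nonneg hL hs) ht.1.le (lt_of_le_of_ne ht.2 ht1)
      hθ).trans ?_
    have := cos_le_one s
    have := cos_le_one L
    gcongr
    linarith
  · filter_upwards [ae_ne_real 1] with t ht1 ht
    rw [uIoc_of_le zero_le_one] at ht
    refine (continuousAt_const.mul (hasDerivAt_logKernel_cos hbn (cos_add_cos_nonneg hL hT)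
        (circleMap_mem_unitBall ht.1.le (lt_of_le_of_ne ht.2 ht1) θ)
        ?_).continuousAt).continuousWithinAt
    simp [circleMap_zero, ht.1.ne']

lemma continuousOn_elConst (hL : 0 < L) (hLπ : L < π) :
    ContinuousOn (elConst L) (Icc 0 (π - L)) := by
  have h := Complex.continuous_re.comp_continuousOn
    (continuousOn_rayIntegral_logKernel hL hLπ (cos_zero_ne (cos_mem_Ioo hL hLπ)))
  simpa only [Function.comp_def, rayIntegral_logKernel_zero, Complex.ofReal_re] using h

lemma continuousOn_elConstNeg (hL : 0 < L) (hLπ : L < π) :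
    ContinuousOn (elConstNeg L) (Icc 0 (π - L)) := by
  have h := Complex.continuous_re.comp_continuousOn
    (continuousOn_rayIntegral_logKernel hL hLπ (cos_pi_ne (cos_mem_Ioo hL hLπ)))
  simpa only [Function.comp_def, rayIntegral_logKernel_pi, Complex.ofReal_re] using h

lemma continuousOn_endpointIntegral (hL : 0 < L) (hLπ : L < π) :
    ContinuousOn (endpointIntegral L) (Icc 0 (π - L)) :=
  ((continuousOn_elConst hL hLπ).sub (continuousOn_elConstNeg hL hLπ)).congr
    fun _ hs => endpointIntegral_eq_sub hL hLπ hs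

/-- The formula with a fixed angle in the gap is lost at T = π - L, where the gap closes. Instead
the integrand, being zero on the gap, is integrated over the fixed interval [L, π] and dominated by
√2 |cos θ - cos L|^{-1/2}. -/
lemma continuousOn_arcMass (hL : 0 < L) (hLπ : L < π) :
    ContinuousOn (arcMass L) (Icc 0 (π - L)) := by
  have hb := cos_mem_Ioo hL hLπ
  have hL0 : L ∈ Icc 0 π := ⟨hL.le, hLπ.le⟩
  have hπ : π ∈ Icc 0 π := ⟨pi_pos.le, le_rfl⟩
  have heq : ∀ s ∈ Icc 0 (π - L), arcMass L s =
      (1 / π) * ∫ θ in L..π, √((cos θ + cos s) / (cos θ - cos L)) := by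
    intro s hs
    rw [arcMass_eq hL hLπ hs]
    have hsub : π - s ∈ Icc 0 π := ⟨by linarith [hs.2], by linarith [hs.1]⟩
    have hi := intervalIntegrable_sqrt (cos_mem_Icc s) hb (cos_add_cos_nonneg hL hs)
    rw [← intervalIntegral.integral_add_adjacent_intervals (a := L) (b := π - s)
      (hi.mono_set (uIcc_subset_zero_pi hL0 hsub)) (hi.mono_set (uIcc_subset_zero_pi hsub hπ)),
      intervalIntegral.integral_congr (a := L) (b := π - s) (g := fun _ => (0 : ℝ)) fun α hα => by
        rw [uIcc_of_le (by linarith [hs.2])] at hα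
        exact edgeRatio_eq_zero_of_mem_gap hL hs hα,
      intervalIntegral.integral_zero, zero_add]
  refine ContinuousOn.congr (continuousOn_const.mul ?_) heq
  intro T hT
  refine intervalIntegral.continuousWithinAt_of_dominated_interval
    (bound := fun θ => √2 * |cos θ - cos L| ^ (-(1 / 2) : ℝ)) ?_ ?_
    (((intervalIntegrable_cos_sub_rpow hb).const_mul √2).mono_set
      (uIcc_subset_zero_pi hL0 hπ)) ?_
  · filter_upwards [self_mem_nhdsWithin] with s hs
    rw [uIoc_of_le hLπ.le]
    exact ((intervalIntegrable_sqrt (cos_mem_Icc s) hb (cos_add_cos_nonneg hL hs)).mono_set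
      (uIcc_subset_zero_pi hL0 hπ)).1.aestronglyMeasurable
  · refine Eventually.of_forall fun s => Eventually.of_forall fun θ _ => ?_
    rw [Real.norm_of_nonneg (Real.sqrt_nonneg _), rpow_neg (abs_nonneg _), ← Real.sqrt_eq_rpow,
      ← div_eq_mul_inv, ← Real.sqrt_div (by norm_num)]
    refine Real.sqrt_le_sqrt ((le_abs_self _).trans ?_)
    rw [abs_div]
    gcongr
    have h1 := abs_add_le (cos θ) (cos s)
    have h2 := abs_cos_le_one θ
    have h3 := abs_cos_le_one s
    linarith
  · refine Eventually.of_forall fun θ _ => ContinuousAt.continuousWithinAt ?_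
    fun_prop

end Continuity

/-! ### Explicit values at T = 0 and T = π - L -/

section Values

lemma endpointIntegral_pi_sub (hL : 0 < L) (hLπ : L < π) : endpointIntegral L (π - L) = 0 := by
  have hb := cos_mem_Ioo hL hLπ
  rw [endpointIntegral_eq_gap hL hLπ ⟨by linarith, le_rfl⟩,
    intervalIntegral.integral_congr (g := fun _ => (0 : ℝ)) fun θ _ => by
      simp only
      rw [cos_pi_sub, ← sub_eq_add_neg]
      refine sqrt_neg_eq_zero ?_
      -- The quotient is 1, or 0/0 = 0 by convention at cos θ = cos L; the root of its negative
      -- vanishes in both cases.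
      rcases eq_or_ne (cos θ - cos L) 0 with h | h
      · simp [h]
      · simp [div_self h], intervalIntegral.integral_zero]

lemma intervalIntegrable_ray_re (hL : 0 < L) (hLπ : L < π) {θ : ℝ} (hθ : cos θ ≠ cos L) :
    IntervalIntegrable (fun t => (Complex.exp (θ * Complex.I) *
      logKernel (cos 0) (cos L) (circleMap 0 t θ)).re) volume 0 1 :=
  intervalIntegrable_re (intervalIntegrable_ray_logKernel (cos_mem_Icc 0)
    (mem_Icc_of_mem_Ioo_neg (cos_mem_Ioo hL hLπ))
    (cos_add_cos_nonneg hL ⟨le_rfl, by linarith⟩) hθ)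

/-- Positivity of the arguments of the two logarithms in the primitives below: the quadratic exceeds
(u - c)² by 1 - c² and (cu - 1)² by (1 - c²)u². -/
lemma sqrt_quad_identities {c u : ℝ} (hc : c ∈ Ioo (-1 : ℝ) 1) (hu : 0 ≤ u) :
    0 < √(u ^ 2 - 2 * u * c + 1) ∧ √(u ^ 2 - 2 * u * c + 1) ^ 2 = u ^ 2 - 2 * u * c + 1 ∧
      0 < u - c + √(u ^ 2 - 2 * u * c + 1) ∧ 0 < 1 - c * u + √(u ^ 2 - 2 * u * c + 1) := by
  have hq : (u - c) ^ 2 < u ^ 2 - 2 * u * c + 1 := by nlinarith [hc.1, hc.2]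
  have hq2 : (c * u - 1) ^ 2 ≤ u ^ 2 - 2 * u * c + 1 := by
    have : c ^ 2 ≤ 1 := by nlinarith [hc.1, hc.2]
    nlinarith [mul_le_mul_of_nonneg_right this (sq_nonneg u)]
  have h0 : 0 < u ^ 2 - 2 * u * c + 1 := lt_of_le_of_lt (sq_nonneg _) hq
  refine ⟨Real.sqrt_pos.2 h0, Real.sq_sqrt h0.le, ?_, ?_⟩
  · have := Real.lt_sqrt_of_sq_lt (x := -(u - c)) (by rwa [neg_sq])
    linarith
  · have h1 := Real.le_sqrt_of_sq_le hq2
    rcases hu.eq_or_lt with h | h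
    · subst h; simp
    · rcases h1.eq_or_lt with h2 | h2
      · have h3 : (c * u - 1) ^ 2 = u ^ 2 - 2 * u * c + 1 := by rw [h2, Real.sq_sqrt h0.le]
        have h4 : (1 - c ^ 2) * u ^ 2 = 0 := by linarith
        have h5 : 0 < 1 - c ^ 2 := by nlinarith [hc.1, hc.2]
        have : 0 < (1 - c ^ 2) * u ^ 2 := by positivity
        linarith
      · linarith

lemma hasDerivAt_sqrt_quad {c u : ℝ} (hc : c ∈ Ioo (-1 : ℝ) 1) (hu : 0 ≤ u) :
    HasDerivAt (fun v => √(v ^ 2 - 2 * v * c + 1)) ((u - c) / √(u ^ 2 - 2 * u * c + 1)) u := by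
  obtain ⟨h1, h2, _, _⟩ := sqrt_quad_identities hc hu
  have h3 : HasDerivAt (fun v : ℝ => v ^ 2 - 2 * v * c + 1) (2 * u - 2 * c) u := by
    have := (((hasDerivAt_pow 2 u).sub (((hasDerivAt_id u).const_mul 2).mul_const c)).add_const 1)
    simpa using this
  have h4 := h3.sqrt (by rw [← h2]; positivity)
  rw [show (u - c) / √(u ^ 2 - 2 * u * c + 1) =
    (2 * u - 2 * c) / (2 * √(u ^ 2 - 2 * u * c + 1)) by rw [← mul_sub, mul_div_mul_left _ _ two_ne_zero]]
  exact h4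

lemma sqrt_sq_div {p q : ℝ} (hp : 0 ≤ p) : √(p ^ 2 / q) = p / √q := by
  rw [Real.sqrt_div (sq_nonneg p), Real.sqrt_sq hp]

/-- The Euler–Lagrange constant of the one-arc measure. -/
lemma elConst_zero (hL : 0 < L) (hLπ : L < π) : elConst L 0 = -2 * Real.log (sin (L / 2)) := by
  have hb := cos_mem_Ioo hL hLπ
  set c := cos L with hcdef
  -- At T = 0 the numerator is (1 + u)². With s the root of the denominator the integrand is 1/s -
  -- (s - 1)/(us), and the two logarithms are primitives of these terms.
  set F : ℝ → ℝ := fun u => Real.log (u - c + √(u ^ 2 - 2 * u * c + 1)) -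
    Real.log (1 - c * u + √(u ^ 2 - 2 * u * c + 1)) with hF
  have hd : ∀ u, 0 ≤ u → HasDerivAt F
      ((1 + (u - c) / √(u ^ 2 - 2 * u * c + 1)) / (u - c + √(u ^ 2 - 2 * u * c + 1)) -
        (-c + (u - c) / √(u ^ 2 - 2 * u * c + 1)) / (1 - c * u + √(u ^ 2 - 2 * u * c + 1))) u := by
    intro u hu
    obtain ⟨h1, h2, h3, h4⟩ := sqrt_quad_identities hb hu
    have hs := hasDerivAt_sqrt_quad hb hu
    have e1 := (((hasDerivAt_id u).sub_const c).add hs).log h3.ne'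
    have e2 := ((((hasDerivAt_id u).const_mul c).const_sub 1).add hs).log h4.ne'
    exact (e1.sub e2).congr_deriv (by simp)
  have hint := intervalIntegrable_ray_re hL hLπ (cos_zero_ne hb)
  have hval : ∀ u ∈ Ioo (0 : ℝ) 1, (Complex.exp ((0 : ℝ) * Complex.I) *
      logKernel (cos 0) (cos L) (circleMap 0 u 0)).re =
      ((1 + (u - c) / √(u ^ 2 - 2 * u * c + 1)) / (u - c + √(u ^ 2 - 2 * u * c + 1)) -
        (-c + (u - c) / √(u ^ 2 - 2 * u * c + 1)) / (1 - c * u + √(u ^ 2 - 2 * u * c + 1))) := by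
    intro u hu
    obtain ⟨h1, h2, h3, h4⟩ := sqrt_quad_identities hb hu.1.le
    have hm : circleMap 0 u 0 = (u : ℂ) := by simp [circleMap_zero]
    rw [hm, logKernel_ofReal (cos_mem_Icc 0) (mem_Icc_of_mem_Ioo_neg hb)
      (abs_lt.2 ⟨by linarith [hu.1], hu.2⟩) hu.1.ne', cos_zero,
      show u ^ 2 + 2 * 1 * u + 1 = (1 + u) ^ 2 by ring,
      show u ^ 2 + 2 * (-cos L) * u + 1 = u ^ 2 - 2 * u * c + 1 by rw [hcdef]; ring,
      sqrt_sq_div (by linarith [hu.1])]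
    generalize √(u ^ 2 - 2 * u * c + 1) = s at h1 h2 h3 h4 ⊢
    have hu0 := hu.1.ne'
    simp only [Complex.ofReal_zero, zero_mul, Complex.exp_zero, one_mul, Complex.ofReal_re]
    have a1 : (1 + (u - c) / s) / (u - c + s) = 1 / s := by field_simp; ring
    have a2 : (-c + (u - c) / s) / (1 - c * u + s) = (s - 1) / (u * s) := by
      rw [div_eq_div_iff h4.ne' (by positivity)]
      field_simp
      linear_combination -h2
    rw [a1, a2]
    field_simp
    ring
  have hftc := intervalIntegral.integral_eq_sub_of_hasDerivAt_of_le zero_le_one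
    (f := F) (f' := fun u => (Complex.exp ((0 : ℝ) * Complex.I) *
      logKernel (cos 0) (cos L) (circleMap 0 u 0)).re)
    (fun u hu => (hd u hu.1).continuousAt.continuousWithinAt)
    (fun u hu => by rw [hval u hu]; exact hd u hu.1.le) hint
  have hray := congrArg Complex.re (rayIntegral_logKernel_zero L 0)
  rw [Complex.ofReal_re, rayIntegral, show (∫ t in (0 : ℝ)..1, Complex.exp ((0 : ℝ) * Complex.I) *
    logKernel (cos 0) (cos L) (circleMap 0 t 0)).re = ∫ t in (0 : ℝ)..1,
    (Complex.exp ((0 : ℝ) * Complex.I) * logKernel (cos 0) (cos L) (circleMap 0 t 0)).re from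
    (Complex.reCLM.intervalIntegral_comp_comm (intervalIntegrable_ray_logKernel (cos_mem_Icc 0)
      (mem_Icc_of_mem_Ioo_neg hb) (cos_add_cos_nonneg hL ⟨le_rfl, by linarith⟩)
      (cos_zero_ne hb))).symm, hftc] at hray
  rw [← hray]
  have hk : 0 < sin (L / 2) := sin_pos_of_pos_of_lt_pi (by linarith) (by linarith)
  have hck : 1 - c = 2 * sin (L / 2) ^ 2 := by
    have := cos_sq_add_sin_sq (L / 2)
    have h2 := cos_two_mul (L / 2)
    rw [show 2 * (L / 2) = L by ring] at h2
    rw [hcdef, h2]; linarith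
  simp only [hF]
  -- At u = 1 the two logarithms agree, so only the value at u = 0 remains.
  norm_num
  rw [show -c + 1 = 2 * sin (L / 2) ^ 2 by linarith, Real.log_mul (by norm_num) (by positivity),
    Real.log_pow]
  push_cast
  ring

/-- On the radius to -1 the numerator is (1 - u)² and c becomes -cos L. The integrand is -1/s - (s -
1)/(us), with the same two elementary primitives but equal signs. -/
lemma elConstNeg_zero (hL : 0 < L) (hLπ : L < π) :
    elConstNeg L 0 = -2 * Real.log (1 + cos (L / 2)) := by
  have hb := cos_mem_Ioo hL hLπ
  have hb2 : -cos L ∈ Ioo (-1 : ℝ) 1 := ⟨by linarith [hb.2], by linarith [hb.1]⟩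
  set c := -cos L with hcdef
  set F : ℝ → ℝ := fun u => -Real.log (1 - c * u + √(u ^ 2 - 2 * u * c + 1)) -
    Real.log (u - c + √(u ^ 2 - 2 * u * c + 1)) with hF
  have hd : ∀ u, 0 ≤ u → HasDerivAt F
      (-((-c + (u - c) / √(u ^ 2 - 2 * u * c + 1)) / (1 - c * u + √(u ^ 2 - 2 * u * c + 1))) -
      (1 + (u - c) / √(u ^ 2 - 2 * u * c + 1)) / (u - c + √(u ^ 2 - 2 * u * c + 1))) u := by
    intro u hu
    obtain ⟨h1, h2, h3, h4⟩ := sqrt_quad_identities hb2 hu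
    have hs := hasDerivAt_sqrt_quad hb2 hu
    have e1 := (((hasDerivAt_id u).sub_const c).add hs).log h3.ne'
    have e2 := ((((hasDerivAt_id u).const_mul c).const_sub 1).add hs).log h4.ne'
    exact (e2.neg.sub e1).congr_deriv (by simp)
  have hint := intervalIntegrable_ray_re hL hLπ (cos_pi_ne hb)
  have hval : ∀ u ∈ Ioo (0 : ℝ) 1, (Complex.exp (π * Complex.I) *
      logKernel (cos 0) (cos L) (circleMap 0 u π)).re =
      -((-c + (u - c) / √(u ^ 2 - 2 * u * c + 1)) / (1 - c * u + √(u ^ 2 - 2 * u * c + 1))) -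
      (1 + (u - c) / √(u ^ 2 - 2 * u * c + 1)) / (u - c + √(u ^ 2 - 2 * u * c + 1)) := by
    intro u hu
    obtain ⟨h1, h2, h3, h4⟩ := sqrt_quad_identities hb2 hu.1.le
    have hm : circleMap 0 u π = ((-u : ℝ) : ℂ) := by simp [circleMap_zero]
    rw [hm, logKernel_ofReal (cos_mem_Icc 0) (mem_Icc_of_mem_Ioo_neg hb)
      (abs_lt.2 ⟨by linarith [hu.2], by linarith [hu.1]⟩) (neg_ne_zero.2 hu.1.ne'), cos_zero,
      show (-u) ^ 2 + 2 * 1 * (-u) + 1 = (1 - u) ^ 2 by ring,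
      show (-u) ^ 2 + 2 * (-cos L) * (-u) + 1 = u ^ 2 - 2 * u * c + 1 by rw [hcdef]; ring,
      sqrt_sq_div (by linarith [hu.2]), Complex.exp_pi_mul_I, neg_one_mul, Complex.neg_re,
      Complex.ofReal_re]
    generalize √(u ^ 2 - 2 * u * c + 1) = s at h1 h2 h3 h4 ⊢
    have hu0 := hu.1.ne'
    have a1 : (1 + (u - c) / s) / (u - c + s) = 1 / s := by field_simp; ring
    have a2 : (-c + (u - c) / s) / (1 - c * u + s) = (s - 1) / (u * s) := by
      rw [div_eq_div_iff h4.ne' (by positivity)]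
      field_simp
      linear_combination -h2
    rw [a1, a2]
    field_simp
    ring
  have hftc := intervalIntegral.integral_eq_sub_of_hasDerivAt_of_le zero_le_one
    (f := F) (f' := fun u => (Complex.exp (π * Complex.I) *
      logKernel (cos 0) (cos L) (circleMap 0 u π)).re)
    (fun u hu => (hd u hu.1).continuousAt.continuousWithinAt)
    (fun u hu => by rw [hval u hu]; exact hd u hu.1.le) hint
  have hray := congrArg Complex.re (rayIntegral_logKernel_pi L 0)
  rw [Complex.ofReal_re, rayIntegral, show (∫ t in (0 : ℝ)..1, Complex.exp (π * Complex.I) *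
    logKernel (cos 0) (cos L) (circleMap 0 t π)).re = ∫ t in (0 : ℝ)..1,
    (Complex.exp (π * Complex.I) * logKernel (cos 0) (cos L) (circleMap 0 t π)).re from
    (Complex.reCLM.intervalIntegral_comp_comm (intervalIntegrable_ray_logKernel (cos_mem_Icc 0)
      (mem_Icc_of_mem_Ioo_neg hb) (cos_add_cos_nonneg hL ⟨le_rfl, by linarith⟩)
      (cos_pi_ne hb))).symm, hftc] at hray
  rw [← hray]
  have hk : 0 < cos (L / 2) := cos_pos_of_mem_Ioo ⟨by linarith [pi_pos], by linarith⟩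
  have hck : 1 - c = 2 * cos (L / 2) ^ 2 := by
    have h2 := cos_two_mul (L / 2)
    rw [show 2 * (L / 2) = L by ring] at h2
    rw [hcdef, h2]; ring
  have hs1 : √(1 ^ 2 - 2 * 1 * c + 1) = 2 * cos (L / 2) := by
    rw [show (1 : ℝ) ^ 2 - 2 * 1 * c + 1 = (2 * cos (L / 2)) ^ 2 by linarith]
    exact Real.sqrt_sq (by positivity)
  have hs0 : √((0 : ℝ) ^ 2 - 2 * 0 * c + 1) = 1 := by norm_num
  simp only [hF]
  rw [hs1, hs0, show 1 - c * 1 + 2 * cos (L / 2) = 2 * (cos (L / 2) * (1 + cos (L / 2))) by linarith,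
    show 1 - c + 2 * cos (L / 2) = 2 * (cos (L / 2) * (1 + cos (L / 2))) by linarith,
    show 1 - c * 0 + 1 = (2 : ℝ) by ring, show 0 - c + 1 = 2 * (cos (L / 2) * cos (L / 2)) by linarith,
    Real.log_mul (by norm_num) (by positivity), Real.log_mul (by positivity) (by positivity),
    Real.log_mul (by norm_num) (by positivity), Real.log_mul (by positivity) (by positivity)]
  ring

/-- The origin of the critical value: the difference of the two constants is 2 log((1 + cos(L/2)) /
sin(L/2)), and this quotient is cot(L/4). -/
lemma endpointIntegral_zero (hL : 0 < L) (hLπ : L < π) : endpointIntegral L 0 = xCrit L := by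
  rw [endpointIntegral_eq_sub hL hLπ ⟨le_rfl, by linarith⟩, elConst_zero hL hLπ,
    elConstNeg_zero hL hLπ, xCrit]
  have hs : 0 < sin (L / 4) := sin_pos_of_pos_of_lt_pi (by linarith) (by linarith)
  have hc : 0 < cos (L / 4) := cos_pos_of_mem_Ioo ⟨by linarith [pi_pos], by linarith⟩
  have e1 : sin (L / 2) = 2 * sin (L / 4) * cos (L / 4) := by
    rw [← sin_two_mul]; congr 1; ring
  have e2 : 1 + cos (L / 2) = 2 * (cos (L / 4) * cos (L / 4)) := by
    rw [show L / 2 = 2 * (L / 4) by ring, cos_two_mul]; ring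
  rw [e1, e2, tan_eq_sin_div_cos, Real.log_div hs.ne' hc.ne',
    Real.log_mul (by positivity) hc.ne', Real.log_mul (by norm_num) hs.ne',
    Real.log_mul (by norm_num) (by positivity), Real.log_mul hc.ne' hc.ne']
  ring

lemma arcMass_zero (L : ℝ) : arcMass L 0 = 0 := by simp [arcMass]

lemma elConst_pi_sub (hL : 0 < L) (hLπ : L < π) : elConst L (π - L) = 0 := by
  have hb := mem_Icc_of_mem_Ioo_neg (cos_mem_Ioo hL hLπ)
  unfold elConst
  rw [integral_congr_Ioo (g := fun _ => (0 : ℝ)) zero_le_one fun u hu => by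
    have h1 := quad_real_pos hb (x := u) (abs_lt.2 ⟨by linarith [hu.1], hu.2⟩)
    rw [cos_pi_sub, show u ^ 2 + 2 * u * -cos L + 1 = u ^ 2 - 2 * u * cos L + 1 by ring,
      div_self (by linarith), Real.sqrt_one, sub_self, mul_zero],
    intervalIntegral.integral_zero, neg_zero]

end Values

end

/-! ### Passage to the parameter x, and integration -/

section

variable {L x : ℝ}

lemma strictAntiOn_endpointIntegral (hL : 0 < L) (hLπ : L < π) :
    StrictAntiOn (endpointIntegral L) (Icc 0 (π - L)) := by
  refine strictAntiOn_of_deriv_neg (convex_Icc _ _) (continuousOn_endpointIntegral hL hLπ) ?_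
  intro T hT
  rw [interior_Icc] at hT
  obtain ⟨_, X', _, _, hX, _, hneg, _⟩ := exists_derivatives hL hLπ hT
  rwa [hX.deriv]

lemma exists_isEndpoint (hL : 0 < L) (hLπ : L < π) (hx : x ∈ Icc 0 (xCrit L)) :
    ∃ T, IsEndpoint L x T := by
  have h := intermediate_value_Icc' (by linarith : (0 : ℝ) ≤ π - L)
    (continuousOn_endpointIntegral hL hLπ)
  rw [endpointIntegral_zero hL hLπ, endpointIntegral_pi_sub hL hLπ] at h
  exact h hx

lemma isEndpoint_unique (hL : 0 < L) (hLπ : L < π) {T S : ℝ} (hT : IsEndpoint L x T)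
    (hS : IsEndpoint L x S) : T = S :=
  (strictAntiOn_endpointIntegral hL hLπ).injOn hT.1 hS.1 (hT.2.trans hS.2.symm)

lemma isEndpoint_endpointT (hL : 0 < L) (hLπ : L < π) (hx : x ∈ Icc 0 (xCrit L)) :
    IsEndpoint L x (endpointT L x) := by
  have h := exists_isEndpoint hL hLπ hx
  rw [endpointT, dif_pos h]
  exact Classical.choose_spec h

lemma xCrit_pos (hL : 0 < L) (hLπ : L < π) : 0 < xCrit L := by
  have h := strictAntiOn_endpointIntegral hL hLπ (a := 0) (b := π - L) ⟨le_rfl, by linarith⟩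
    ⟨by linarith, le_rfl⟩ (by linarith)
  rwa [endpointIntegral_zero hL hLπ, endpointIntegral_pi_sub hL hLπ] at h

lemma endpointT_xCrit (hL : 0 < L) (hLπ : L < π) : endpointT L (xCrit L) = 0 :=
  isEndpoint_unique hL hLπ (isEndpoint_endpointT hL hLπ ⟨(xCrit_pos hL hLπ).le, le_rfl⟩)
    ⟨⟨le_rfl, by linarith⟩, endpointIntegral_zero hL hLπ⟩

lemma endpointT_zero (hL : 0 < L) (hLπ : L < π) : endpointT L 0 = π - L :=
  isEndpoint_unique hL hLπ (isEndpoint_endpointT hL hLπ ⟨le_rfl, (xCrit_pos hL hLπ).le⟩)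
    ⟨⟨by linarith, le_rfl⟩, endpointIntegral_pi_sub hL hLπ⟩

lemma mapsTo_endpointT (hL : 0 < L) (hLπ : L < π) :
    MapsTo (endpointT L) (Icc 0 (xCrit L)) (Icc 0 (π - L)) :=
  fun _ hx => (isEndpoint_endpointT hL hLπ hx).1

lemma endpointT_mem_Ioo (hL : 0 < L) (hLπ : L < π) (hx : x ∈ Ioo 0 (xCrit L)) :
    endpointT L x ∈ Ioo 0 (π - L) := by
  have h := isEndpoint_endpointT hL hLπ (Ioo_subset_Icc_self hx)
  refine ⟨lt_of_le_of_ne h.1.1 fun h0 => ?_, lt_of_le_of_ne h.1.2 fun h0 => ?_⟩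
  · have := h.2
    rw [← h0, endpointIntegral_zero hL hLπ] at this
    exact hx.2.ne' this
  · have := h.2
    rw [h0, endpointIntegral_pi_sub hL hLπ] at this
    exact hx.1.ne this

/-- Inverse of a continuous injection on a compact interval: the preimage of a closed set is the
image of a compact set, hence closed. -/
lemma continuousOn_endpointT (hL : 0 < L) (hLπ : L < π) :
    ContinuousOn (endpointT L) (Icc 0 (xCrit L)) := by
  rw [continuousOn_iff_isClosed]
  intro t ht
  refine ⟨endpointIntegral L '' (t ∩ Icc 0 (π - L)), ?_, ?_⟩
  · exact ((isCompact_Icc.inter_left ht).image_of_continuousOn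
      ((continuousOn_endpointIntegral hL hLπ).mono inter_subset_right)).isClosed
  · ext y
    constructor
    · rintro ⟨h1, h2⟩
      have h := isEndpoint_endpointT hL hLπ h2
      exact ⟨⟨_, ⟨h1, h.1⟩, h.2⟩, h2⟩
    · rintro ⟨⟨T, ⟨h1, h2⟩, h3⟩, h4⟩
      refine ⟨?_, h4⟩
      rw [mem_preimage, isEndpoint_unique hL hLπ (isEndpoint_endpointT hL hLπ h4) ⟨h2, h3⟩]
      exact h1

lemma continuousOn_ell (hL : 0 < L) (hLπ : L < π) : ContinuousOn (ell L) (Icc 0 (xCrit L)) :=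
  (continuousOn_elConst hL hLπ).comp (continuousOn_endpointT hL hLπ) (mapsTo_endpointT hL hLπ)

lemma continuousOn_Omega (hL : 0 < L) (hLπ : L < π) :
    ContinuousOn (Omega L) (Icc 0 (xCrit L)) :=
  (continuousOn_arcMass hL hLπ).comp (continuousOn_endpointT hL hLπ) (mapsTo_endpointT hL hLπ)

/-- Differentiability of `ell` and `Omega`, and the relation between their derivatives. -/
lemma exists_hasDerivAt_ell_Omega (hL : 0 < L) (hLπ : L < π) (hx : x ∈ Ioo 0 (xCrit L)) :
    ∃ l' M' : ℝ, HasDerivAt (ell L) l' x ∧ HasDerivAt (Omega L) M' x ∧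
      Omega L x = l' + x * M' := by
  obtain ⟨l', X', M', hl, hX, hM, hneg, hrel⟩ :=
    exists_derivatives hL hLπ (endpointT_mem_Ioo hL hLπ hx)
  have hnhds : Icc 0 (xCrit L) ∈ 𝓝 x := Icc_mem_nhds hx.1 hx.2
  -- Inverse function rule: the derivative of the endpoint integral is negative, hence invertible,
  -- and T is already known to be continuous.
  have hτ : HasDerivAt (endpointT L) X'⁻¹ x := by
    refine HasDerivAt.of_local_left_inverse ((continuousOn_endpointT hL hLπ).continuousAt hnhds)
      hX hneg.ne ?_
    filter_upwards [hnhds] with y hy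
    exact (isEndpoint_endpointT hL hLπ hy).2
  refine ⟨l' * X'⁻¹, M' * X'⁻¹, hl.comp x hτ, hM.comp x hτ, ?_⟩
  rw [(isEndpoint_endpointT hL hLπ (Ioo_subset_Icc_self hx)).2] at hrel
  rw [Omega]
  have hne := hneg.ne
  field_simp
  linarith

/-- `ell + x * Omega` is a primitive of `2 * Omega`. -/
lemma hasDerivAt_ell_add_mul_Omega (hL : 0 < L) (hLπ : L < π) (hx : x ∈ Ioo 0 (xCrit L)) :
    HasDerivAt (fun y => ell L y + y * Omega L y) (2 * Omega L x) x := by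
  obtain ⟨l', M', hl, hM, hrel⟩ := exists_hasDerivAt_ell_Omega hL hLπ hx
  refine (hl.add ((hasDerivAt_id x).mul hM)).congr_deriv ?_
  simp only [id]
  linarith

lemma ell_xCrit (hL : 0 < L) (hLπ : L < π) : ell L (xCrit L) = ellInfty L := by
  rw [ell, endpointT_xCrit hL hLπ, ellInfty]

lemma Omega_xCrit (hL : 0 < L) (hLπ : L < π) : Omega L (xCrit L) = 0 := by
  rw [Omega, endpointT_xCrit hL hLπ, arcMass_zero]

lemma ell_zero (hL : 0 < L) (hLπ : L < π) : ell L 0 = 0 := by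
  rw [ell, endpointT_zero hL hLπ, elConst_pi_sub hL hLπ]

lemma intervalIntegrable_Omega (hL : 0 < L) (hLπ : L < π) :
    IntervalIntegrable (fun x => Omega L x) volume 0 (xCrit L) := by
  refine ContinuousOn.intervalIntegrable ?_
  rw [uIcc_of_le (xCrit_pos hL hLπ).le]
  exact continuousOn_Omega hL hLπ

/-- The primitive ℓ + xΩ of 2Ω equals ℓ_∞ at x_c, where the outer arc has no mass, and 0 at x = 0,
where the square root is identically 1. -/
lemma integral_Omega (hL : 0 < L) (hLπ : L < π) :
    ∫ x in (0 : ℝ)..(xCrit L), Omega L x = ellInfty L / 2 := by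
  have h := intervalIntegral.integral_eq_sub_of_hasDerivAt_of_le (xCrit_pos hL hLπ).le
    ((continuousOn_ell hL hLπ).add (continuousOn_id.mul (continuousOn_Omega hL hLπ)))
    (fun x hx => hasDerivAt_ell_add_mul_Omega hL hLπ hx)
    ((intervalIntegrable_Omega hL hLπ).const_mul 2)
  rw [intervalIntegral.integral_const_mul] at h
  simp only [Pi.add_apply, Pi.mul_apply, id, ell_xCrit hL hLπ, Omega_xCrit hL hLπ, ell_zero hL hLπ,
    mul_zero, zero_mul, add_zero, sub_zero] at h
  linarith

lemma div_mem_Icc_xCrit {y ζ c : ℝ} (hy : 0 < y) (hc : 0 < c) (hζ : ζ ∈ Icc (y / c) 1) :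
    0 < ζ ∧ y / ζ ∈ Icc y c := by
  have h0 : 0 < ζ := (div_pos hy hc).trans_le hζ.1
  refine ⟨h0, ?_, ?_⟩
  · rw [le_div_iff₀ h0]; nlinarith [hζ.2]
  · rw [div_le_iff₀ h0]
    have := (div_le_iff₀ hc).1 hζ.1
    linarith

lemma div_mem_Ioo_xCrit {y ζ c : ℝ} (hy : 0 < y) (hc : 0 < c) (hζ : ζ ∈ Ioo (y / c) 1) :
    0 < ζ ∧ y / ζ ∈ Ioo y c := by
  have h0 : 0 < ζ := (div_pos hy hc).trans hζ.1
  refine ⟨h0, ?_, ?_⟩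
  · rw [lt_div_iff₀ h0]; nlinarith [hζ.2]
  · rw [div_lt_iff₀ h0]
    have := (div_lt_iff₀ hc).1 hζ.1
    linarith

lemma continuousOn_comp_div {f : ℝ → ℝ} (hL : 0 < L) (hLπ : L < π)
    (hf : ContinuousOn f (Icc 0 (xCrit L))) (hx : x ∈ Ioo 0 (xCrit L)) :
    ContinuousOn (fun ζ => f (x / ζ)) (Icc (x / xCrit L) 1) := by
  refine hf.comp (continuousOn_const.div continuousOn_id fun ζ hζ => ?_) fun ζ hζ => ?_
  · exact (div_mem_Icc_xCrit hx.1 (xCrit_pos hL hLπ) hζ).1.ne'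
  · have := (div_mem_Icc_xCrit hx.1 (xCrit_pos hL hLπ) hζ).2
    exact ⟨hx.1.le.trans this.1, this.2⟩

lemma div_xCrit_lt_one (hL : 0 < L) (hLπ : L < π) (hx : x ∈ Ioo 0 (xCrit L)) :
    x / xCrit L < 1 := (div_lt_one (xCrit_pos hL hLπ)).2 hx.2

lemma intervalIntegrable_mul_ell_div (hL : 0 < L) (hLπ : L < π) (hx : x ∈ Ioo 0 (xCrit L)) :
    IntervalIntegrable (fun ζ => ζ * ell L (x / ζ)) volume (x / xCrit L) 1 := by
  refine ContinuousOn.intervalIntegrable ?_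
  rw [uIcc_of_le (div_xCrit_lt_one hL hLπ hx).le]
  exact continuousOn_id.mul (continuousOn_comp_div hL hLπ (continuousOn_ell hL hLπ) hx)

/-- With y = x/ζ, the function ζ²/2 · (ℓ(y) + yΩ(y)) is a primitive of ζℓ(y): the product rule gives
ζℓ + xΩ, and the chain rule with (ℓ + yΩ)' = 2Ω and dy/dζ = -x/ζ² gives -xΩ. -/
lemma integral_mul_ell_div (hL : 0 < L) (hLπ : L < π) (hx : x ∈ Ioo 0 (xCrit L)) :
    ∫ ζ in (x / xCrit L)..1, ζ * ell L (x / ζ) =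
      (ell L x + x * Omega L x) / 2 - ellInfty L / 2 * (x / xCrit L) ^ 2 := by
  have hc := xCrit_pos hL hLπ
  have hx0 := hx.1.ne'
  have hg : ContinuousOn (fun y => ell L y + y * Omega L y) (Icc 0 (xCrit L)) :=
    (continuousOn_ell hL hLπ).add (continuousOn_id.mul (continuousOn_Omega hL hLπ))
  have h := intervalIntegral.integral_eq_sub_of_hasDerivAt_of_le
    (f := fun ζ => ζ ^ 2 / 2 * (ell L (x / ζ) + x / ζ * Omega L (x / ζ)))
    (f' := fun ζ => ζ * ell L (x / ζ)) (div_xCrit_lt_one hL hLπ hx).le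
    (ContinuousOn.mul (by fun_prop) (continuousOn_comp_div hL hLπ hg hx))
    (fun ζ hζ => by
      obtain ⟨h0, hm⟩ := div_mem_Ioo_xCrit hx.1 hc hζ
      have h0' := h0.ne'
      have e1 := hasDerivAt_ell_add_mul_Omega hL hLπ ⟨hx.1.trans hm.1, hm.2⟩
      have e2 : HasDerivAt (fun ζ => x / ζ) (-x / ζ ^ 2) ζ := by
        refine ((hasDerivAt_const ζ x).div (hasDerivAt_id ζ) h0').congr_deriv ?_
        simp
      have e3 := ((hasDerivAt_pow 2 ζ).div_const 2).mul (e1.comp ζ e2)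
      refine e3.congr_deriv ?_
      simp only [Function.comp]
      field_simp
      push_cast
      ring)
    (intervalIntegrable_mul_ell_div hL hLπ hx)
  rw [h, div_div_cancel₀ hx0, ell_xCrit hL hLπ, Omega_xCrit hL hLπ, div_one]
  ring

end

end ThinnedCUE

theorem propositionA1 (L : ℝ) (hL : 0 < L) (hLπ : L < Real.pi) :
    (∀ x ∈ Set.Icc 0 (ThinnedCUE.xCrit L), ∃! T : ℝ, ThinnedCUE.IsEndpoint L x T) ∧
    (∀ x : ℝ, 0 < x → x < ThinnedCUE.xCrit L →
      DifferentiableAt ℝ (fun y => ThinnedCUE.ell L y) x ∧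
      DifferentiableAt ℝ (fun y => ThinnedCUE.Omega L y) x ∧
      ThinnedCUE.Omega L x =
        deriv (fun y => ThinnedCUE.ell L y) x + x * deriv (fun y => ThinnedCUE.Omega L y) x ∧
      IntervalIntegrable (fun ζ => ζ * ThinnedCUE.ell L (x / ζ)) MeasureTheory.volume
        (x / ThinnedCUE.xCrit L) 1 ∧
      HasDerivAt
        (fun y => -(ThinnedCUE.ellInfty L / 2) * (y / ThinnedCUE.xCrit L) ^ 2 -
          ∫ ζ in (y / ThinnedCUE.xCrit L)..1, ζ * ThinnedCUE.ell L (y / ζ))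
        (-ThinnedCUE.Omega L x) x) ∧
    IntervalIntegrable (fun x => ThinnedCUE.Omega L x) MeasureTheory.volume
      0 (ThinnedCUE.xCrit L) ∧
    -(∫ x in (0 : ℝ)..(ThinnedCUE.xCrit L), ThinnedCUE.Omega L x) =
      -ThinnedCUE.ellInfty L / 2 ∧
    -ThinnedCUE.ellInfty L / 2 = Real.log (Real.sin (L / 2)) := by
  open ThinnedCUE Topology in
  have hell : -ellInfty L / 2 = Real.log (Real.sin (L / 2)) := by
    rw [ellInfty, elConst_zero hL hLπ]; ring
  refine ⟨fun x hx => ?_, fun x hx0 hxc => ?_, intervalIntegrable_Omega hL hLπ, ?_, hell⟩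
  · obtain ⟨T, hT⟩ := exists_isEndpoint hL hLπ hx
    exact ⟨T, hT, fun S hS => isEndpoint_unique hL hLπ hS hT⟩
  · have hx : x ∈ Ioo 0 (xCrit L) := ⟨hx0, hxc⟩
    obtain ⟨l', M', hl, hM, hrel⟩ := exists_hasDerivAt_ell_Omega hL hLπ hx
    refine ⟨hl.differentiableAt, hM.differentiableAt, ?_,
      intervalIntegrable_mul_ell_div hL hLπ hx, ?_⟩
    · rw [hrel]
      congr 1
      · exact hl.deriv.symm
      · rw [show deriv (fun y => Omega L y) x = M' from hM.deriv]
    -- After insertion of the ζ-integral the terms in ℓ_∞ cancel, and the bracket is -(ℓ + yΩ)/2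
    -- near x.
    · have h := (hasDerivAt_ell_add_mul_Omega hL hLπ hx).const_mul (-(1 / 2))
      rw [show -(1 / 2) * (2 * Omega L x) = -Omega L x by ring] at h
      refine h.congr_of_eventuallyEq ?_
      filter_upwards [Ioo_mem_nhds hx.1 hx.2] with y hy
      rw [integral_mul_ell_div hL hLπ hy]
      ring
  · rw [integral_Omega hL hLπ]; ring
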